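/- Let $\tau\in\mathbb C$ with $\operatorname{Im}\tau>0$, $\Gamma=\mathbb Z+\mathbb Z\tau$, $T=\mathbb C/\Gamma$ with coordinate $w$ and canonical bundle $K$, and $w_0=0,\ w_1=\frac12,\ w_2=\frac{1+\tau}2,\ w_3=\frac\tau2$. Let $\pi\colon T\to\mathbb{CP}^1$ be the double cover $z=\frac{\wp(w)-\wp(w_2)}{\wp(w_1)-\wp(w_2)}$; it is branched over $z(w_0)=\infty,\ z(w_1)=1,\ z(w_2)=0,\ z(w_3)=:m$. For $s\in\mathbb C$ let $L(\bar\partial+s\,d\bar w)$ be the trivial smooth line bundle on $T$ with the holomorphic structure $\bar\partial+s\,d\bar w$. Let $\rho_0,\dots,\rho_3\in(0,\frac12)$, and let $\nabla=d+A_1\frac{dz}{z-1}+A_2\frac{dz}{z}+A_3\frac{dz}{z-m}$ be a Fuchsian system on $\mathbb C^2\to\mathbb{CP}^1$ such that $A_1,A_2,A_3$ and $A_0=-A_1-A_2-A_3$ are $2\times2$ matrices, where $A_i$ has the eigenvalues $\pm\rho_i$. Let $\Psi$ be a parabolic Higgs field for $\nabla$, i.e. an $\mathfrak{sl}(2,\mathbb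 C)$-valued meromorphic 1-form on $\mathbb{CP}^1$ with at most first order poles, at $\infty,1,0,m$ only, whose residue there annihilates $\ker(A_i-\rho_i)$ for $i=0,1,2,3$, respectively; assume $\det\Psi\not\equiv0$. Let $L^\pm\subset\mathbb C^2$ be the two eigenline bundles of $\pi^*\Psi$ on $T$. Let $S^*=L(2w_0)$ with the meromorphic connection $\nabla^s$ for which $\nabla^s\otimes\nabla^s$ annihilates the section of $(S^*)^2\cong L(w_0+w_1+w_2+w_3)$ with simple zeros at $w_0,\dots,w_3$, and let $\hat\nabla=\pi^*\nabla\otimes\nabla^s$ be the induced meromorphic connection on $(L^+\otimes S^*)\oplus(L^-\otimes S^*)=E\oplus E^*$. Let $\xi\in\mathbb C$ be such that $E\cong L(\bar\partial-\xi\,d\bar w)$ and $E^*\cong L(\bar\partial+\xi\,d\bar w)$, and fix smooth frames realizing these isomorphisms (each is unique up to a constant factor). Let $\vartheta$ be the (unique up to a constant factor) non-zero entire function with $\vartheta(0)=0$, $\vartheta(w+1)=\vartheta(w)$, $\vartheta(w+\tau)=-\vartheta(w)e^{-2\pi iw}$, and put $t_y(w)=\frac{\vartheta(w-y)}{\vartheta(w)}e^{\frac{2\pi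 i}{\bar\tau-\tau}y(w-\bar w)}$. Let $x=\frac{\tau-\bar\tau}{2\pi i}\xi$ and assume that $L(\bar\partial-\xi\,d\bar w)$ is not a spin bundle (that is, its square is not isomorphic to $K$). Put $\varepsilon_0=-1$, $\varepsilon_1=\varepsilon_2=\varepsilon_3=1$, and for $i=0,\dots,3$ $$\alpha_i^\pm(x)=\varepsilon_i\,e^{\mp\frac{4\pi i}{\bar\tau-\tau}x(w_i-\bar w_i)}\,\frac{\vartheta(w_i\pm x)}{\vartheta(w_i\mp x)}\,\frac{\vartheta'(0)}{\vartheta(\pm2x)}\Big(2\rho_i-\frac12\Big)$$ (where the $i$ in $4\pi i$ is the imaginary unit). Then, after multiplication of the frame of $E^*$ by a suitable non-zero constant, there is $\alpha\in\mathbb C$ with $$\hat\nabla=d+\begin{pmatrix}\alpha\,dw-\xi\,d\bar w&\beta_\xi^-\\ \beta_\xi^+&-\alpha\,dw+\xi\,d\bar w\end{pmatrix},\qquad \beta^\pm_\xi=\sum_{i=0}^3\alpha_i^\pm(x)\,t_{\mp2x}(w-w_i)\,dw.$$ Here $\beta^\pm_\xi$ is a meromorphic 1-form with at most simple poles, at $w_0,\dots,w_3$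 only, with values in $L(\bar\partial\pm2\xi\,d\bar w)\cong L([\mp2x]-[0])$. For each sign, $\beta_\xi^\pm$ is uniquely determined by its residues: the residue map $b\mapsto(\operatorname{res}_{w_0}b,\dots,\operatorname{res}_{w_3}b)$, from the space of all meromorphic sections of $L(\bar\partial\pm2\xi\,d\bar w)\otimes K$ with at most simple poles, at $w_0,\dots,w_3$ only, to $\mathbb C^4$, is an isomorphism. -/

import Mathlib

open Filter Topology Polynomial
open scoped ContDiff Matrix

noncomputable section

namespace Abelianization

/-! ### The torus `ℂ / Γ`, `Γ = ℤ + ℤ τ`, and its double cover of the projective line -/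

/-- The pair of periods `(1, τ)`. -/
def periods (τ : UpperHalfPlane) : PeriodPair where
  ω₁ := 1
  ω₂ := (τ : ℂ)
  indep := by
    rw [LinearIndependent.pair_iff]
    intro a b h
    have him := congrArg Complex.im h
    have hre := congrArg Complex.re h
    have hτ : (τ : ℂ).im ≠ 0 := τ.im_ne_zero
    simp only [Complex.add_im, Complex.smul_im, Complex.one_im, Complex.zero_im, smul_eq_mul,
      mul_zero, zero_add, mul_eq_zero] at him
    have hb : b = 0 := by
      rcases him with h | h
      · exact h
      · exact absurd h hτ
    subst hb
    simp at hre
    exact ⟨hre, rfl⟩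

/-- The lattice `Γ = ℤ + ℤ τ`. -/
def lattice (τ : UpperHalfPlane) : Submodule ℤ ℂ := (periods τ).lattice

/-- The set of all points of `ℂ` lying over the branch points, i.e. `½ Γ`. -/
def halfLattice (τ : UpperHalfPlane) : Set ℂ := {w | 2 * w ∈ lattice τ}

/-- `w₀ = 0`, `w₁ = 1/2`, `w₂ = (1 + τ)/2`, `w₃ = τ/2`. -/
def halfPeriod (τ : UpperHalfPlane) : Fin 4 → ℂ :=
  ![0, 1 / 2, (1 + (τ : ℂ)) / 2, (τ : ℂ) / 2]

/-- The Weierstrass function of the torus. -/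
def wp (τ : UpperHalfPlane) : ℂ → ℂ := (periods τ).weierstrassP

/-- The double cover `z = (℘ - ℘(w₂)) / (℘(w₁) - ℘(w₂))`, which maps `w₀, w₁, w₂` to
`∞, 1, 0`. -/
def cover (τ : UpperHalfPlane) (w : ℂ) : ℂ :=
  (wp τ w - wp τ (halfPeriod τ 2)) / (wp τ (halfPeriod τ 1) - wp τ (halfPeriod τ 2))

/-- The fourth branch point `m = z(w₃)`. -/
def branchPoint (τ : UpperHalfPlane) : ℂ := cover τ (halfPeriod τ 3)

/-! ### Fuchsian systems and parabolic Higgs fields -/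

/-- The residues `A₀, …, A₃` at `∞, 1, 0, m` of a Fuchsian system of rank two, where `A_i` has the
eigenvalues `± ρ_i`. -/
structure FuchsianSystem (ρ : Fin 4 → ℝ) where
  res : Fin 4 → Matrix (Fin 2) (Fin 2) ℂ
  sum_res : ∑ i, res i = 0
  charpoly_res : ∀ i, (res i).charpoly = (X - C (ρ i : ℂ)) * (X + C (ρ i : ℂ))

/-- The `dz`-coefficient `R₁ / (z - 1) + R₂ / z + R₃ / (z - m)` of the meromorphic one-form with
residues `R₀ = - R₁ - R₂ - R₃, R₁, R₂, R₃` at `∞, 1, 0, m`. -/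
def formCoeff (m : ℂ) (R : Fin 4 → Matrix (Fin 2) (Fin 2) ℂ) (z : ℂ) :
    Matrix (Fin 2) (Fin 2) ℂ :=
  (z - 1)⁻¹ • R 1 + z⁻¹ • R 2 + (z - m)⁻¹ • R 3

/-- A parabolic Higgs field for a Fuchsian system: a meromorphic `sl(2, ℂ)`-valued one-form with
at most first order poles at `∞, 1, 0, m`, given by its residues there, whose residue at each pole
annihilates the eigenline of the residue of the system for the eigenvalue `ρ_i`. -/
structure ParabolicHiggsField {ρ : Fin 4 → ℝ} (F : FuchsianSystem ρ) where
  res : Fin 4 → Matrix (Fin 2) (Fin 2) ℂ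
  sum_res : ∑ i, res i = 0
  trace_res : ∀ i, (res i).trace = 0
  ker_res : ∀ i v, F.res i *ᵥ v = (ρ i : ℂ) • v → res i *ᵥ v = 0

/-- The determinant of the Higgs field (with fourth pole `m`) is not identically zero. -/
def ParabolicHiggsField.DetNeZero {ρ : Fin 4 → ℝ} {F : FuchsianSystem ρ}
    (Ψ : ParabolicHiggsField F) (m : ℂ) : Prop :=
  ∃ z : ℂ, z ≠ 0 ∧ z ≠ 1 ∧ z ≠ m ∧ (formCoeff m Ψ.res z).det ≠ 0

/-- The `dw`-coefficient of the pull-back to the torus of the one-form with residues `R`. -/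
def pullback (τ : UpperHalfPlane) (R : Fin 4 → Matrix (Fin 2) (Fin 2) ℂ) (w : ℂ) :
    Matrix (Fin 2) (Fin 2) ℂ :=
  deriv (cover τ) w • formCoeff (branchPoint τ) R (cover τ w)

/-! ### Holomorphic line bundles `L(∂̄ + s dw̄)` on the torus -/

/-- The Wirtinger derivative `∂f/∂w̄`. -/
def dbar {V : Type*} [NormedAddCommGroup V] [NormedSpace ℝ V] [Module ℂ V] (f : ℂ → V) (w : ℂ) :
    V :=
  (1 / 2 : ℂ) • (fderiv ℝ f w 1 + Complex.I • fderiv ℝ f w Complex.I)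

/-- The line bundle `L(∂̄ + s dw̄)` (the trivial smooth line bundle on the torus with this
holomorphic structure) is holomorphically trivial. -/
def IsHolTrivial (τ : UpperHalfPlane) (s : ℂ) : Prop :=
  ∃ f : ℂ → ℂ, ContDiff ℝ ∞ f ∧ (∀ l ∈ lattice τ, ∀ w, f (w + l) = f w) ∧ (∀ w, f w ≠ 0) ∧
    ∀ w, dbar f w + s * f w = 0

/-- `L(∂̄ - ξ dw̄)` is a spin bundle of the torus: its square `L(∂̄ - 2ξ dw̄)` is isomorphic to the
canonical bundle, which is trivialized by `dw`. -/
def IsSpin (τ : UpperHalfPlane) (ξ : ℂ) : Prop := IsHolTrivial τ (-(2 * ξ))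

open Classical in
/-- The multiplicity at `p` of the divisor `[y] - [0]` on the torus. -/
def pointDivisor (τ : UpperHalfPlane) (y p : ℂ) : ℤ :=
  (if p - y ∈ lattice τ then 1 else 0) - (if p ∈ lattice τ then 1 else 0)

/-- `L(∂̄ + s dw̄) ≅ L([y] - [0])`: there is a meromorphic section `f` of `L(∂̄ + s dw̄)` with divisor
`[y] - [0]`. -/
def IsPointBundle (τ : UpperHalfPlane) (s y : ℂ) : Prop :=
  ∃ f : ℂ → ℂ, (∀ l ∈ lattice τ, ∀ w, f (w + l) = f w) ∧
    ∀ p, ∃ g : ℂ → ℂ, ContDiffAt ℝ ∞ g p ∧ g p ≠ 0 ∧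
      ∀ᶠ w in 𝓝[≠] p, f w = (w - p) ^ pointDivisor τ y p * g w ∧ dbar f w + s * f w = 0

/-- The space of meromorphic sections of `L(∂̄ + s dw̄) ⊗ K` with at most first order poles at
`w₀, …, w₃` and no other poles. The section `b dw` is represented by its coefficient `b`, as a
`Γ`-periodic function on `ℂ`, with the dummy value `0` at the points over `w₀, …, w₃`. -/
def meroSections (τ : UpperHalfPlane) (s : ℂ) : Submodule ℂ (ℂ → ℂ) where
  carrier := {b | (∀ l ∈ lattice τ, ∀ w, b (w + l) = b w) ∧ (∀ p ∈ halfLattice τ, b p = 0) ∧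
    (∀ p ∉ halfLattice τ, ContDiffAt ℝ ∞ b p ∧ dbar b p + s * b p = 0) ∧
    ∀ p ∈ halfLattice τ, ∃ g : ℂ → ℂ, ContDiffAt ℝ ∞ g p ∧
      ∀ᶠ w in 𝓝[≠] p, (w - p) * b w = g w}
  zero_mem' := by
    refine ⟨by simp, by simp, fun p _ => ⟨contDiffAt_const, ?_⟩,
      fun p _ => ⟨0, contDiffAt_const, by simp⟩⟩
    simp [dbar]
  add_mem' := by
    rintro a b ⟨ha1, ha2, ha3, ha4⟩ ⟨hb1, hb2, hb3, hb4⟩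
    refine ⟨fun l hl w => by simp [ha1 l hl w, hb1 l hl w],
      fun p hp => by simp [ha2 p hp, hb2 p hp], fun p hp => ?_, fun p hp => ?_⟩
    · obtain ⟨ha, ha'⟩ := ha3 p hp
      obtain ⟨hb, hb'⟩ := hb3 p hp
      refine ⟨ha.add hb, ?_⟩
      have h1 := fderiv_add (ha.differentiableAt (by simp)) (hb.differentiableAt (by simp))
      simp only [dbar, h1, add_apply, Pi.add_apply, smul_eq_mul] at ha' hb' ⊢
      linear_combination ha' + hb'
    · obtain ⟨g, hg, hg'⟩ := ha4 p hp
      obtain ⟨k, hk, hk'⟩ := hb4 p hp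
      refine ⟨g + k, hg.add hk, ?_⟩
      filter_upwards [hg', hk'] with w h1 h2
      simp [mul_add, h1, h2]
  smul_mem' := by
    rintro c b ⟨hb1, hb2, hb3, hb4⟩
    refine ⟨fun l hl w => by simp [hb1 l hl w], fun p hp => by simp [hb2 p hp],
      fun p hp => ?_, fun p hp => ?_⟩
    · obtain ⟨hb, hb'⟩ := hb3 p hp
      refine ⟨contDiffAt_const.smul hb, ?_⟩
      have h1 := fderiv_const_smul (hb.differentiableAt (by simp)) c
      simp only [dbar, h1, smul_apply, Pi.smul_apply, smul_eq_mul] at hb' ⊢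
      linear_combination c * hb'
    · obtain ⟨g, hg, hg'⟩ := hb4 p hp
      refine ⟨c • g, contDiffAt_const.smul hg, ?_⟩
      filter_upwards [hg'] with w h1
      simp [← h1]
      ring

theorem exists_tendsto_residue {τ : UpperHalfPlane} {s : ℂ} {b : ℂ → ℂ}
    (hb : b ∈ meroSections τ s) {p : ℂ} (hp : p ∈ halfLattice τ) :
    ∃ r, Tendsto (fun w => (w - p) * b w) (𝓝[≠] p) (𝓝 r) := by
  obtain ⟨g, hg, hg'⟩ := hb.2.2.2 p hp
  exact ⟨g p, (hg.continuousAt.tendsto.mono_left nhdsWithin_le_nhds).congr'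
    (hg'.mono fun w h => h.symm)⟩

theorem halfPeriod_mem (τ : UpperHalfPlane) (i : Fin 4) : halfPeriod τ i ∈ halfLattice τ := by
  simp only [halfLattice, Set.mem_ofPred_eq, lattice, PeriodPair.mem_lattice]
  fin_cases i
  · exact ⟨0, 0, by simp [halfPeriod]⟩
  · exact ⟨1, 0, by simp [halfPeriod, periods]⟩
  · exact ⟨1, 1, by simp [halfPeriod, periods]; ring⟩
  · exact ⟨0, 1, by simp [halfPeriod, periods]; ring⟩

/-- The residue map `b dw ↦ (res_{w₀}, …, res_{w₃})`, `res_{w_i} = lim_{w → w_i} (w - w_i) b(w)`. -/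
def residueMap (τ : UpperHalfPlane) (s : ℂ) : meroSections τ s →ₗ[ℂ] (Fin 4 → ℂ) where
  toFun b i := limUnder (𝓝[≠] (halfPeriod τ i)) fun w => (w - halfPeriod τ i) * b.1 w
  map_add' a b := by
    funext i
    obtain ⟨r, hr⟩ := exists_tendsto_residue a.2 (halfPeriod_mem τ i)
    obtain ⟨t, ht⟩ := exists_tendsto_residue b.2 (halfPeriod_mem τ i)
    have h := hr.add ht
    simp only [← mul_add] at h
    simp only [Pi.add_apply, Submodule.coe_add, hr.limUnder_eq, ht.limUnder_eq, h.limUnder_eq]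
  map_smul' c b := by
    funext i
    obtain ⟨t, ht⟩ := exists_tendsto_residue b.2 (halfPeriod_mem τ i)
    have h := ht.const_mul c
    simp only [mul_left_comm c] at h
    simp only [Pi.smul_apply, Submodule.coe_smul, smul_eq_mul, ht.limUnder_eq, h.limUnder_eq,
      RingHom.id_apply]

/-! ### The abelianized connection -/

/-- Let `S = L(-2 w₀)`, let `s` be the section of `S^* = L(2 w₀)` with a double zero in `w₀`, and let
`φ` be a `Γ`-periodic `ℂ²`-valued function on `ℂ` with poles at the lattice points. This says that
`φ ⊗ s` is a nowhere vanishing smooth frame of `L ⊗ S^*`, where `L` is the holomorphic line subbundle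
of the trivial `ℂ²`-bundle on the torus spanned by `φ`, and that in this frame the holomorphic
structure of `L ⊗ S^*` is `∂̄ - ξ dw̄`. -/
structure IsTwistedFrame (τ : UpperHalfPlane) (ξ : ℂ) (φ : ℂ → Fin 2 → ℂ) : Prop where
  periodic : ∀ l ∈ lattice τ, ∀ w, φ (w + l) = φ w
  smooth : ∀ p ∉ lattice τ, ContDiffAt ℝ ∞ φ p
  ne_zero : ∀ p ∉ lattice τ, φ p ≠ 0
  pole : ∀ p ∈ lattice τ, ∃ g : ℂ → Fin 2 → ℂ, ContDiffAt ℝ ∞ g p ∧ g p ≠ 0 ∧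
    ∀ᶠ w in 𝓝[≠] p, (w - p) ^ 2 • φ w = g w
  dbar_eq : ∀ p ∉ lattice τ, dbar φ p = -ξ • φ p

/-- `(φ⁺ ⊗ s, φ⁻ ⊗ s)` is a frame of `E ⊕ E^* = (L⁺ ⊗ S^*) ⊕ (L⁻ ⊗ S^*)` with `E = L(∂̄ - ξ dw̄)` and
`E^* = L(∂̄ + ξ dw̄)`, where `L^±` are the eigenline bundles of the pull-back of the Higgs field `Ψ` to
the torus. The corresponding eigenvalues are the one-forms `± μ dw`. -/
structure IsAbelianFrame (τ : UpperHalfPlane) {ρ : Fin 4 → ℝ} {F : FuchsianSystem ρ}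
    (Ψ : ParabolicHiggsField F) (ξ : ℂ) (φp φm : ℂ → Fin 2 → ℂ) : Prop where
  plus : IsTwistedFrame τ ξ φp
  minus : IsTwistedFrame τ (-ξ) φm
  eigen : ∃ μ : ℂ, ∀ w ∉ halfLattice τ,
    pullback τ Ψ.res w *ᵥ φp w = μ • φp w ∧ pullback τ Ψ.res w *ᵥ φm w = -μ • φm w

/-- The connection `∇̂ = π^*∇ ⊗ ∇^s` applied to `φ ⊗ s`, at the point `w` and in the direction `h`
(the factor `s` is omitted). Here `∇^s` is the connection on `S^*` whose square annihilates the
section of `(S^*)² = L(w₀ + w₁ + w₂ + w₃)` with simple zeros in `w₀, …, w₃`; this section is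
`℘' s²`, so `∇^s s = - ½ (℘''/℘') dw s`. -/
def hatNabla (τ : UpperHalfPlane) {ρ : Fin 4 → ℝ} (F : FuchsianSystem ρ) (φ : ℂ → Fin 2 → ℂ)
    (w h : ℂ) : Fin 2 → ℂ :=
  fderiv ℝ φ w h + h • (pullback τ F.res w *ᵥ φ w)
    - (1 / 2 * logDeriv (periods τ).derivWeierstrassP w * h) • φ w

/-- With respect to the frame `(φ⁺ ⊗ s, φ⁻ ⊗ s)` the connection `∇̂` is
`d + !![α dw - ξ dw̄, β⁻ dw; β⁺ dw, - α dw + ξ dw̄]`. -/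
def HasConnectionForm (τ : UpperHalfPlane) {ρ : Fin 4 → ℝ} (F : FuchsianSystem ρ)
    (φp φm : ℂ → Fin 2 → ℂ) (α ξ : ℂ) (βp βm : ℂ → ℂ) : Prop :=
  ∀ w ∉ halfLattice τ, ∀ h : ℂ,
    hatNabla τ F φp w h =
      (α * h - ξ * starRingEnd ℂ h) • φp w + (βp w * h) • φm w ∧
    hatNabla τ F φm w h =
      (βm w * h) • φp w + (-α * h + ξ * starRingEnd ℂ h) • φm w

/-! ### Theta functions and the explicit forms -/

/-- The shifted theta function, which is unique up to a multiplicative constant. -/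
structure IsShiftedTheta (τ : UpperHalfPlane) (ϑ : ℂ → ℂ) : Prop where
  differentiable : Differentiable ℂ ϑ
  ne_zero : ∃ w, ϑ w ≠ 0
  zero : ϑ 0 = 0
  add_one : ∀ w, ϑ (w + 1) = ϑ w
  add_tau : ∀ w, ϑ (w + τ) = -ϑ w * Complex.exp (-(2 * Real.pi * Complex.I * w))

/-- `t_x(w) = ϑ(w - x) / ϑ(w) · exp (2πi / (τ̄ - τ) · x (w - w̄))`. -/
def tFun (τ : UpperHalfPlane) (ϑ : ℂ → ℂ) (x w : ℂ) : ℂ :=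
  ϑ (w - x) / ϑ w * Complex.exp
    (2 * Real.pi * Complex.I / (starRingEnd ℂ (τ : ℂ) - τ) * x * (w - starRingEnd ℂ w))

/-- The signs `ε₀ = -1`, `ε₁ = ε₂ = ε₃ = 1`. -/
def branchSign : Fin 4 → ℂ := ![-1, 1, 1, 1]

/-- The coefficients
`α^±_i(x) = ε_i exp (∓ 4πi / (τ̄ - τ) · x (w_i - w̄_i)) · ϑ(w_i ± x) / ϑ(w_i ∓ x)
  · ϑ'(0) / ϑ(± 2x) · (2ρ_i - 1/2)`,
with `σ = ±1` for the sign. -/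
def alphaCoeff (τ : UpperHalfPlane) (ϑ : ℂ → ℂ) (ρ : Fin 4 → ℝ) (σ : ℤˣ) (x : ℂ) (i : Fin 4) :
    ℂ :=
  branchSign i *
    Complex.exp (-(σ : ℤ) * (4 * Real.pi * Complex.I / (starRingEnd ℂ (τ : ℂ) - τ) * x *
      (halfPeriod τ i - starRingEnd ℂ (halfPeriod τ i)))) *
    (ϑ (halfPeriod τ i + (σ : ℤ) * x) / ϑ (halfPeriod τ i - (σ : ℤ) * x)) *
    (deriv ϑ 0 / ϑ ((σ : ℤ) * (2 * x))) * (2 * (ρ i : ℂ) - 1 / 2)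

/-- The `dw`-coefficient of `β^±_ξ = ∑ i, α^±_i(x) t_{∓2x}(w - w_i) dw`, with `σ = ±1` for the
sign. -/
def betaForm (τ : UpperHalfPlane) (ϑ : ℂ → ℂ) (ρ : Fin 4 → ℝ) (σ : ℤˣ) (x w : ℂ) : ℂ :=
  ∑ i, alphaCoeff τ ϑ ρ σ x i * tFun τ ϑ (-(σ : ℤ) * (2 * x)) (w - halfPeriod τ i)

end Abelianization

end

/-!
# The abelianization of a Fuchsian system on the four-punctured sphere

**Holomorphic frames.** Multiplication by the unitary character `unitaryChar ξ` turns the smooth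
frame of `E` into a function `Φ : ℂ → ℂ²` which is holomorphic up to double poles at the lattice
points and has unitary multipliers (`IsTwistedFrame.isHolFrame`). The involution `w ↦ -w` changes
the sign of the pulled back Higgs field, hence `w ↦ Φ (-w)` spans the other eigenline, and the
frame of `E^*` is a constant multiple of it (`IsShiftedTheta.exists_eq_smul_reflect`). Both
eigenlines meet over the branch points exactly in the kernels of the residues of the Higgs field,
which are the eigenlines of the residues `A_i` for `ρ_i`; this makes `det (Φ (w), Φ (-w))` a
non-zero multiple of `℘'` (`IsShiftedTheta.exists_det2_eq_ne_zero`).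

**The matrix entries.** By Cramer's rule the entries of the connection in the frame
`(Φ (w), Φ (-w))` are quotients of determinants by `℘'`, with at most simple poles over the branch points
(`IsShiftedTheta.exists_sub_mul_entries`). The connection on the determinant bundle annihilates
`℘'`, so the diagonal entry is an even elliptic function with at most simple poles at fixed points
of the involution; its residues vanish and it is constant (`IsShiftedTheta.exists_holNabla_eq`).
At `w_i` the residue of the off-diagonal entry is `2 ρ_i - 1 / 2` times the character, which is
the eigenvalue on the eigenline of the residue `2 A_i` of the pulled back connection, corrected by
the contribution `- 1 / 2` of `S^*` and the order of the frame.

**Residues determine the second fundamental forms.** The difference of two sections of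
`L(∂̄ ± 2ξ dw̄) ⊗ K` with the same residues becomes, after multiplication by a character, a constant by
Liouville's theorem; the constant is zero because the multipliers are not trivial, `E` not being a
spin bundle (`residueMap_injective`). Translates of `t_y` show that all residues occur
(`IsShiftedTheta.residueMap_surjective`). The explicit forms have the residues
`exp (± 2πi x) (2 ρ_i - 1 / 2)`, by the reflection formula for `ϑ` (`IsShiftedTheta.alphaCoeff_mul`). The factor
`exp (± 2πi x)`, which does not depend on `i`, is absorbed in the frame of `E^*`.

**Theta and Weierstrass functions.** The zeros of `ϑ` are simple and form the lattice: entire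
functions with the multipliers of `ϑ²` form a space of dimension at most two, by their Fourier
series (`exists_linear_relation`), while further zeros would make three linearly independent
elliptic functions with poles cancelled by `ϑ²` available (`IsShiftedTheta.exists_relation`). The
same argument gives the factorization of `℘ - ℘(q)` (`IsShiftedTheta.exists_wp_sub`), from which
the divisors of `℘ - ℘(w_i)` and of `℘'` are read off.
-/

noncomputable section

namespace Abelianization

/-! ### Removable singularities and Liouville's theorem on the torus -/

theorem eq_of_eventuallyEq_punctured {F G : ℂ → ℂ} {p : ℂ} (hF : ContinuousAt F p)
    (hG : ContinuousAt G p) (h : F =ᶠ[𝓝[≠] p] G) : F p = G p :=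
  tendsto_nhds_unique_of_eventuallyEq (hF.tendsto.mono_left nhdsWithin_le_nhds)
    (hG.tendsto.mono_left nhdsWithin_le_nhds) h

/-- A function all of whose singularities are removable agrees with an entire function on punctured
neighbourhoods. -/
theorem exists_entire_of_removable {f : ℂ → ℂ}
    (hf : ∀ p, ∃ g, AnalyticAt ℂ g p ∧ f =ᶠ[𝓝[≠] p] g) :
    ∃ F, Differentiable ℂ F ∧ ∀ p, f =ᶠ[𝓝[≠] p] F := by
  have hmero : MeromorphicOn f Set.univ := fun p _ => by
    obtain ⟨g, hg, h⟩ := hf p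
    exact hg.meromorphicAt.congr h.symm
  have heq : ∀ p, toMeromorphicNFOn f Set.univ =ᶠ[𝓝[≠] p] f := fun p =>
    hmero.toMeromorphicNFOn_eq_self_on_nhdsNE (Set.mem_univ p)
  refine ⟨toMeromorphicNFOn f Set.univ, fun p => ?_, fun p => (heq p).symm⟩
  have hNF := meromorphicNFOn_toMeromorphicNFOn f Set.univ (Set.mem_univ p)
  refine (hNF.meromorphicOrderAt_nonneg_iff_analyticAt.1 ?_).differentiableAt
  rw [meromorphicOrderAt_congr (heq p), (hmero p trivial).meromorphicOrderAt_nonneg_iff]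
  exact hf p

theorem tendsto_add_const_punctured (p l : ℂ) :
    Tendsto (fun w => w + l) (𝓝[≠] p) (𝓝[≠] (p + l)) := by
  refine tendsto_nhdsWithin_iff.2 ⟨?_, ?_⟩
  · exact ((continuous_id.add continuous_const).tendsto p).mono_left nhdsWithin_le_nhds
  · filter_upwards [self_mem_nhdsWithin] with w hw
    simpa using hw

theorem tendsto_const_sub_punctured (p c : ℂ) :
    Tendsto (fun w => c - w) (𝓝[≠] p) (𝓝[≠] (c - p)) := by
  refine tendsto_nhdsWithin_iff.2 ⟨?_, ?_⟩
  · exact ((continuous_const.sub continuous_id).tendsto p).mono_left nhdsWithin_le_nhds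
  · filter_upwards [self_mem_nhdsWithin] with w hw
    simpa using hw

/-- Liouville's theorem on the torus, with removable singularities and unitary multipliers. -/
theorem eventuallyEq_const_of_norm_periodic (τ : UpperHalfPlane) {f : ℂ → ℂ}
    (hper : ∀ l ∈ lattice τ, ∀ w, ‖f (w + l)‖ = ‖f w‖)
    (hf : ∀ p, ∃ g, AnalyticAt ℂ g p ∧ f =ᶠ[𝓝[≠] p] g) :
    ∃ c, ∀ p, ∀ᶠ w in 𝓝[≠] p, f w = c := by
  obtain ⟨F, hF, hfF⟩ := exists_entire_of_removable hf
  have hFper : ∀ z w, w ∈ lattice τ → ‖F (z + w)‖ = ‖F z‖ := by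
    intro z w hw
    have h1 := (tendsto_add_const_punctured z w).eventually (hfF (z + w))
    refine tendsto_nhds_unique_of_eventuallyEq (l := 𝓝[≠] z) (f := fun u => ‖F (u + w)‖)
      (g := fun u => ‖F u‖) ?_ ?_ ?_
    · have : Continuous fun u => ‖F (u + w)‖ := by
        have := hF.continuous
        fun_prop
      exact (this.tendsto z).mono_left nhdsWithin_le_nhds
    · exact (hF.continuous.norm.tendsto z).mono_left nhdsWithin_le_nhds
    · filter_upwards [h1, hfF z] with u h2 h3
      rw [← h2, ← h3, hper w hw]
  have hbdd : Bornology.IsBounded (Set.range F) := by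
    have hc := (IsZLattice.isCompact_range_of_periodic (periods τ).lattice (fun z => ‖F z‖)
      hF.continuous.norm hFper).isBounded
    obtain ⟨C, hC⟩ := hc.exists_norm_le
    refine (isBounded_iff_forall_norm_le).2 ⟨C, ?_⟩
    rintro _ ⟨z, rfl⟩
    simpa using hC _ ⟨z, rfl⟩
  refine ⟨F 0, fun p => (hfF p).mono fun w hw => ?_⟩
  rw [hw, hF.apply_eq_apply_of_bounded hbdd w 0]

/-! ### Fourier coefficients of entire periodic functions -/

/-- The integral of an entire function of period `1` over a period segment does not depend on the
segment. -/
theorem intervalIntegral_add_eq_of_periodic {g : ℂ → ℂ} (hg : Differentiable ℂ g)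
    (hper : ∀ w, g (w + 1) = g w) (z : ℂ) :
    ∫ t in (0 : ℝ)..1, g (t + z) = ∫ t in (0 : ℝ)..1, g t := by
  -- With a primitive `G` on a large disc, the integral is `G (z + 1) - G z`, whose derivative in
  -- `z` vanishes by periodicity.
  obtain ⟨G, hG⟩ := (hg.differentiableOn (s := Metric.ball 0 (‖z‖ + 3))).isExactOn_ball
  have hint : ∀ u : ℂ, ‖u‖ < ‖z‖ + 2 → ∫ t in (0 : ℝ)..1, g (t + u) = G (1 + u) - G u := by
    intro u hu
    have h := intervalIntegral.integral_eq_sub_of_hasDerivAt (a := 0) (b := 1)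
      (f := fun t : ℝ => G (t + u)) (f' := fun t : ℝ => g (t + u)) ?_ ?_
    · simpa using h
    · intro t ht
      rw [Set.uIcc_of_le zero_le_one] at ht
      have hmem : (t : ℂ) + u ∈ Metric.ball (0 : ℂ) (‖z‖ + 3) := by
        rw [mem_ball_zero_iff]
        calc ‖(t : ℂ) + u‖ ≤ ‖(t : ℂ)‖ + ‖u‖ := norm_add_le _ _
          _ < 1 + (‖z‖ + 2) := by
            have : ‖(t : ℂ)‖ ≤ 1 := by
              rw [Complex.norm_real, Real.norm_eq_abs, abs_of_nonneg ht.1]; exact ht.2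
            linarith
          _ = _ := by ring
      exact ((hG _ hmem).comp_add_const (t : ℂ) u).comp_ofReal
    · have := hg.continuous
      exact Continuous.intervalIntegrable (by fun_prop) _ _
  have hconst : G (1 + z) - G z = G (1 + 0) - G 0 := by
    have hd : ∀ u ∈ Metric.ball (0 : ℂ) (‖z‖ + 1),
        HasDerivAt (fun u => G (1 + u) - G u) 0 u := by
      intro u hu
      rw [mem_ball_zero_iff] at hu
      have h1 : (1 : ℂ) + u ∈ Metric.ball (0 : ℂ) (‖z‖ + 3) := by
        rw [mem_ball_zero_iff]
        have := norm_add_le (1 : ℂ) u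
        rw [norm_one] at this
        linarith
      have h2 : u ∈ Metric.ball (0 : ℂ) (‖z‖ + 3) := by
        rw [mem_ball_zero_iff]
        linarith
      have h := ((hG _ h1).comp_const_add (1 : ℂ) u).sub (hG _ h2)
      rwa [add_comm, hper, sub_self] at h
    refine (convex_ball (0 : ℂ) (‖z‖ + 1)).is_const_of_fderivWithin_eq_zero (𝕜 := ℂ)
      (f := fun u => G (1 + u) - G u) ?_ ?_ ?_ ?_
    · exact fun u hu => (hd u hu).differentiableAt.differentiableWithinAt
    · intro u hu
      rw [fderivWithin_of_isOpen Metric.isOpen_ball hu]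
      ext
      simp [(hd u hu).deriv]
    · rw [mem_ball_zero_iff]; linarith
    · rw [mem_ball_zero_iff]; simp; positivity
  have h0 := hint 0 (by simp; positivity)
  rw [hint z (by linarith), hconst, ← h0]
  simp

/-- The `n`-th Fourier coefficient of the restriction of `f` to the real line. -/
def fourierIntegral (f : ℂ → ℂ) (n : ℤ) : ℂ :=
  ∫ t in (0 : ℝ)..1, f t * Complex.exp (-(2 * Real.pi * Complex.I * n * t))

theorem eq_zero_of_fourierIntegral_eq_zero {f : ℂ → ℂ} (hf : Differentiable ℂ f)
    (hper : ∀ w, f (w + 1) = f w) (h : ∀ n, fourierIntegral f n = 0) (w : ℂ) : f w = 0 := by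
  have hreal : ∀ t : ℝ, f t = 0 := by
    intro t
    have : Fact ((0 : ℝ) < 1) := ⟨one_pos⟩
    have hp : Function.Periodic (fun t : ℝ => f t) 1 := fun t => by simpa using hper t
    have hcont : Continuous (hp.lift : AddCircle (1 : ℝ) → ℂ) := by
      refine continuous_coinduced_dom.2 ?_
      exact hf.continuous.comp Complex.continuous_ofReal
    have hcoef : fourierCoeff (⟨hp.lift, hcont⟩ : C(AddCircle (1 : ℝ), ℂ)) = 0 := by
      funext n
      rw [fourierCoeff_eq_intervalIntegral _ n 0]
      have := h n
      rw [fourierIntegral] at this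
      simp only [zero_add, ContinuousMap.coe_mk, Function.Periodic.lift_coe, smul_eq_mul,
        Pi.zero_apply, fourier_coe_apply]
      have h1 : ∫ t in (0 : ℝ)..1,
          Complex.exp (2 * Real.pi * Complex.I * (-n : ℤ) * t / (1 : ℝ)) * f t = 0 := by
        rw [← this]
        refine intervalIntegral.integral_congr fun t _ => ?_
        rw [mul_comm]
        congr 2
        push_cast
        ring
      rw [h1, smul_zero]
    have hs := has_pointwise_sum_fourier_series_of_summable
      (f := (⟨hp.lift, hcont⟩ : C(AddCircle (1 : ℝ), ℂ))) (by rw [hcoef]; exact summable_zero)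
      (t : AddCircle (1 : ℝ))
    rw [hcoef] at hs
    simpa using hs.unique (by simp)
  have han : AnalyticOnNhd ℂ f Set.univ := hf.differentiableOn.analyticOnNhd isOpen_univ
  refine han.eqOn_zero_of_preconnected_of_frequently_eq_zero isPreconnected_univ
    (Set.mem_univ 0) ?_ (Set.mem_univ w)
  have ht : Tendsto (fun n : ℕ => ((1 / ((n : ℝ) + 1) : ℝ) : ℂ)) atTop (𝓝[≠] 0) := by
    refine tendsto_nhdsWithin_iff.2 ⟨?_, Eventually.of_forall fun n => ?_⟩
    · exact (Complex.continuous_ofReal.tendsto' 0 0 Complex.ofReal_zero).comp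
        (tendsto_one_div_add_atTop_nhds_zero_nat (𝕜 := ℝ))
    · have : (1 / ((n : ℝ) + 1)) ≠ 0 := by positivity
      exact Complex.ofReal_ne_zero.2 this
  exact ht.frequently (Frequently.of_forall fun n => hreal _)

/-- Entire functions with the multipliers of `ϑ²` under `1` and `τ`. -/
structure IsThetaDegreeTwo (τ : UpperHalfPlane) (f : ℂ → ℂ) : Prop where
  differentiable : Differentiable ℂ f
  add_one : ∀ w, f (w + 1) = f w
  add_tau : ∀ w, f (w + τ) = f w * Complex.exp (-(4 * Real.pi * Complex.I * w))

theorem IsThetaDegreeTwo.fourierIntegral_add_two {τ : UpperHalfPlane} {f : ℂ → ℂ}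
    (hf : IsThetaDegreeTwo τ f) (n : ℤ) :
    fourierIntegral f (n + 2) =
      Complex.exp (2 * Real.pi * Complex.I * n * τ) * fourierIntegral f n := by
  have hg : Differentiable ℂ fun w => f w * Complex.exp (-(2 * Real.pi * Complex.I * n * w)) := by
    have := hf.differentiable
    fun_prop
  have h := intervalIntegral_add_eq_of_periodic hg (fun w => ?_) τ
  · simp only [fourierIntegral]
    rw [← h, ← intervalIntegral.integral_const_mul]
    refine intervalIntegral.integral_congr fun t _ => ?_
    simp only [hf.add_tau]
    rw [mul_left_comm, mul_assoc (f t), ← Complex.exp_add, ← Complex.exp_add]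
    congr 2
    push_cast
    ring
  · rw [hf.add_one]
    congr 1
    rw [Complex.exp_eq_exp_iff_exists_int]
    exact ⟨-n, by push_cast; ring⟩

theorem IsThetaDegreeTwo.eq_zero {τ : UpperHalfPlane} {f : ℂ → ℂ}
    (hf : IsThetaDegreeTwo τ f) (h0 : fourierIntegral f 0 = 0) (h1 : fourierIntegral f 1 = 0)
    (w : ℂ) : f w = 0 := by
  refine eq_zero_of_fourierIntegral_eq_zero hf.differentiable hf.add_one (fun n => ?_) w
  have key : ∀ n : ℤ, fourierIntegral f n = 0 ∧ fourierIntegral f (n + 1) = 0 := by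
    intro n
    induction n using Int.induction_on with
    | zero => exact ⟨h0, by simpa using h1⟩
    | succ k ih =>
      refine ⟨ih.2, ?_⟩
      have := hf.fourierIntegral_add_two k
      rw [ih.1, mul_zero] at this
      rw [add_assoc]
      exact this
    | pred k ih =>
      refine ⟨?_, by simpa using ih.1⟩
      have := hf.fourierIntegral_add_two (-(k : ℤ) - 1)
      rw [show -(k : ℤ) - 1 + 2 = -k + 1 by ring, ih.2] at this
      simpa [Complex.exp_ne_zero] using this.symm
  exact (key n).1

theorem fourierIntegral_sum {ι : Type*} [Fintype ι] {f : ι → ℂ → ℂ}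
    (hf : ∀ i, Continuous (f i)) (a : ι → ℂ) (n : ℤ) :
    fourierIntegral (fun w => ∑ i, a i * f i w) n = ∑ i, a i * fourierIntegral (f i) n := by
  simp only [fourierIntegral, Finset.sum_mul, ← intervalIntegral.integral_const_mul]
  rw [intervalIntegral.integral_finsetSum]
  · simp only [mul_assoc]
  · intro i _
    have := hf i
    exact Continuous.intervalIntegrable (by fun_prop) _ _

/-- Theta functions of degree two form a space of dimension at most two. -/
theorem exists_linear_relation {τ : UpperHalfPlane} {f : Fin 3 → ℂ → ℂ}
    (hf : ∀ i, IsThetaDegreeTwo τ (f i)) :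
    ∃ a : Fin 3 → ℂ, a ≠ 0 ∧ ∀ w, ∑ i, a i * f i w = 0 := by
  let M : Matrix (Fin 2) (Fin 3) ℂ := fun j i => fourierIntegral (f i) (j : ℕ)
  obtain ⟨a, hMa, ha⟩ := Submodule.exists_mem_ne_zero_of_ne_bot
    (LinearMap.ker_ne_bot_of_finrank_lt (f := M.mulVecLin) (by simp))
  rw [LinearMap.mem_ker, Matrix.mulVecLin_apply] at hMa
  have hcoef : ∀ j : Fin 2,
      fourierIntegral (fun w => ∑ i, a i * f i w) ((j : ℕ) : ℤ) = 0 := by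
    intro j
    rw [fourierIntegral_sum fun i => (hf i).differentiable.continuous]
    refine Eq.trans ?_ (congrFun hMa j)
    exact Finset.sum_congr rfl fun i _ => mul_comm _ _
  refine ⟨a, ha, fun w => ?_⟩
  refine IsThetaDegreeTwo.eq_zero (τ := τ) (f := fun w => ∑ i, a i * f i w) ⟨?_, ?_, ?_⟩
    (by simpa using hcoef 0) (by simpa using hcoef 1) w
  · exact Differentiable.fun_sum fun i _ => (hf i).differentiable.const_mul _
  · intro w
    simp only [(hf _).add_one]
  · intro w
    simp only [(hf _).add_tau, Finset.sum_mul, mul_assoc]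

/-! ### Local factorizations -/

theorem exists_analyticAt_eq_sub_mul {f : ℂ → ℂ} {p : ℂ} (hf : AnalyticAt ℂ f p) (h0 : f p = 0) :
    ∃ k, AnalyticAt ℂ k p ∧ k p = deriv f p ∧ ∀ w, f w = (w - p) * k w := by
  obtain ⟨P, hP⟩ := hf
  refine ⟨dslope f p, hP.has_fpower_series_dslope_fslope.analyticAt, dslope_same f p, fun w => ?_⟩
  have := sub_smul_dslope f p w
  rw [h0, sub_zero, smul_eq_mul] at this
  exact this.symm

/-- The logarithmic derivative has a simple pole with the order as residue. -/
theorem exists_sub_mul_logDeriv {f : ℂ → ℂ} {p : ℂ} {n : ℤ} (hm : MeromorphicAt f p)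
    (hf : meromorphicOrderAt f p = n) :
    ∃ k : ℂ → ℂ, AnalyticAt ℂ k p ∧ k p = n ∧ ∀ᶠ w in 𝓝[≠] p, (w - p) * logDeriv f w = k w := by
  obtain ⟨g, hg, hg0, h⟩ := (meromorphicOrderAt_eq_int_iff hm).1 hf
  refine ⟨fun w => n + (w - p) * (deriv g w / g w), ?_, by simp, ?_⟩
  · have := hg.deriv
    fun_prop (disch := assumption)
  · have h' : f =ᶠ[𝓝[≠] p] fun w => (w - p) ^ n • g w := h
    filter_upwards [logDeriv_congr_nhdsNE h', self_mem_nhdsWithin,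
      hg.eventually_analyticAt.filter_mono nhdsWithin_le_nhds,
      (hg.continuousAt.eventually_ne hg0).filter_mono nhdsWithin_le_nhds] with w h1 h2 h3 h4
    have hw : w - p ≠ 0 := sub_ne_zero.2 h2
    have hd : HasDerivAt (fun w => (w - p) ^ n • g w)
        (n * (w - p) ^ (n - 1) * g w + (w - p) ^ n * deriv g w) w := by
      have h5 := (hasDerivAt_zpow n (w - p) (Or.inl hw)).comp_sub_const w p
      exact h5.mul h3.differentiableAt.hasDerivAt
    rw [h1, logDeriv_apply, hd.deriv, smul_eq_mul, zpow_sub_one₀ hw]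
    have := zpow_ne_zero n hw
    field_simp

/-! ### The lattice -/

theorem one_mem_lattice (τ : UpperHalfPlane) : (1 : ℂ) ∈ lattice τ := (periods τ).ω₁_mem_lattice

theorem tau_mem_lattice (τ : UpperHalfPlane) : (τ : ℂ) ∈ lattice τ := (periods τ).ω₂_mem_lattice

theorem mem_of_mem_lattice {τ : UpperHalfPlane} (S : AddSubgroup ℂ) (h1 : (1 : ℂ) ∈ S)
    (hτ : (τ : ℂ) ∈ S) {l : ℂ} (hl : l ∈ lattice τ) : l ∈ S := by
  have : lattice τ ≤ AddSubgroup.toIntSubmodule S := by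
    rw [lattice, PeriodPair.lattice, Submodule.span_le]
    rintro x (rfl | rfl)
    · exact h1
    · exact hτ
  exact this hl

theorem periodic_of_one_of_tau {τ : UpperHalfPlane} {f : ℂ → ℂ} (h1 : ∀ w, f (w + 1) = f w)
    (hτ : ∀ w, f (w + τ) = f w) : ∀ l ∈ lattice τ, ∀ w, f (w + l) = f w := by
  intro l hl
  refine mem_of_mem_lattice (τ := τ)
    { carrier := {l | ∀ w, f (w + l) = f w}
      zero_mem' := by simp
      add_mem' := fun {a b} ha hb w => by rw [← add_assoc, hb, ha]
      neg_mem' := fun {a} ha w => by rw [← ha (w + -a)]; simp } h1 hτ hl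

theorem isClosed_lattice (τ : UpperHalfPlane) : IsClosed (lattice τ : Set ℂ) :=
  (periods τ).isClosed_lattice

theorem isClosed_halfLattice (τ : UpperHalfPlane) : IsClosed (halfLattice τ) :=
  (isClosed_lattice τ).preimage (continuous_const.mul continuous_id)

theorem lattice_subset_halfLattice {τ : UpperHalfPlane} {l : ℂ} (hl : l ∈ lattice τ) :
    l ∈ halfLattice τ := by
  change 2 * l ∈ lattice τ
  rw [two_mul]
  exact add_mem hl hl

theorem eventually_notMem_lattice (τ : UpperHalfPlane) (p : ℂ) :
    ∀ᶠ w in 𝓝[≠] p, w ∉ lattice τ := by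
  filter_upwards [self_mem_nhdsWithin, mem_nhdsWithin_of_mem_nhds
    ((periods τ).compl_lattice_sdiff_singleton_mem_nhds p)] with w hw hw' h
  exact hw' ⟨h, hw⟩

theorem eventually_notMem_halfLattice (τ : UpperHalfPlane) (p : ℂ) :
    ∀ᶠ w in 𝓝[≠] p, w ∉ halfLattice τ := by
  have h : Tendsto (fun w : ℂ => 2 * w) (𝓝[≠] p) (𝓝[≠] (2 * p)) := by
    refine tendsto_nhdsWithin_iff.2 ⟨?_, ?_⟩
    · exact ((continuous_const.mul continuous_id).tendsto p).mono_left nhdsWithin_le_nhds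
    · filter_upwards [self_mem_nhdsWithin] with w hw
      simpa using hw
  exact h.eventually (eventually_notMem_lattice τ (2 * p))

theorem wp_add (τ : UpperHalfPlane) {l : ℂ} (hl : l ∈ lattice τ) (w : ℂ) :
    wp τ (w + l) = wp τ w :=
  (periods τ).weierstrassP_add_coe w ⟨l, hl⟩

theorem wp_neg (τ : UpperHalfPlane) (w : ℂ) : wp τ (-w) = wp τ w :=
  (periods τ).weierstrassP_neg w

theorem analyticAt_wp {τ : UpperHalfPlane} {p : ℂ} (hp : p ∉ lattice τ) :
    AnalyticAt ℂ (wp τ) p :=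
  (periods τ).analyticOnNhd_weierstrassP p hp

theorem deriv_wp (τ : UpperHalfPlane) : deriv (wp τ) = (periods τ).derivWeierstrassP :=
  (periods τ).deriv_weierstrassP

theorem meromorphicOrderAt_wp {τ : UpperHalfPlane} {p : ℂ} (hp : p ∈ lattice τ) :
    meromorphicOrderAt (wp τ) p = (-2 : ℤ) :=
  (periods τ).order_weierstrassP p hp

theorem meromorphicOrderAt_deriv_wp {τ : UpperHalfPlane} {p : ℂ} (hp : p ∈ lattice τ) :
    meromorphicOrderAt (deriv (wp τ)) p = (-3 : ℤ) :=
  meromorphicOrderAt_deriv_eq_sub_one (by norm_num) (meromorphicOrderAt_wp hp)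

theorem exists_wp_eq {τ : UpperHalfPlane} {p : ℂ} (hp : p ∈ lattice τ) :
    ∃ g, AnalyticAt ℂ g p ∧ g p ≠ 0 ∧ ∀ᶠ w in 𝓝[≠] p, wp τ w = (w - p) ^ (-2 : ℤ) * g w :=
  (meromorphicOrderAt_eq_int_iff ((periods τ).meromorphic_weierstrassP p)).1
    (meromorphicOrderAt_wp hp)

theorem exists_deriv_wp_eq {τ : UpperHalfPlane} {p : ℂ} (hp : p ∈ lattice τ) :
    ∃ g, AnalyticAt ℂ g p ∧ g p ≠ 0 ∧
      ∀ᶠ w in 𝓝[≠] p, deriv (wp τ) w = (w - p) ^ (-3 : ℤ) * g w :=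
  (meromorphicOrderAt_eq_int_iff
    (((periods τ).meromorphic_weierstrassP.deriv) p)).1 (meromorphicOrderAt_deriv_wp hp)

/-- `1` and `℘` are linearly independent. -/
theorem eq_zero_of_add_mul_wp {τ : UpperHalfPlane} {a b : ℂ}
    (h : ∀ᶠ w in 𝓝[≠] (0 : ℂ), a + b * wp τ w = 0) : a = 0 ∧ b = 0 := by
  obtain ⟨g, hg, hg0, hgw⟩ := exists_wp_eq (zero_mem (lattice τ))
  have hb : b = 0 := by
    have := eq_of_eventuallyEq_punctured (p := 0) (F := fun w => a * w ^ 2 + b * g w)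
      (G := fun _ => 0) (by have := hg.continuousAt; fun_prop) continuousAt_const ?_
    · simpa [hg0] using this
    · filter_upwards [h, hgw, self_mem_nhdsWithin] with w h1 h2 (h3 : w ≠ 0)
      rw [h2, sub_zero] at h1
      have : (w ^ (-2 : ℤ)) * w ^ 2 = 1 := by
        rw [zpow_neg]
        norm_cast
        field_simp
      linear_combination w ^ 2 * h1 - b * g w * this
  refine ⟨?_, hb⟩
  obtain ⟨w, hw⟩ := h.exists
  simpa [hb] using hw

/-! ### The zeros of the shifted theta function -/

namespace IsShiftedTheta

variable {τ : UpperHalfPlane} {ϑ : ℂ → ℂ}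

theorem analyticAt (hϑ : IsShiftedTheta τ ϑ) (p : ℂ) : AnalyticAt ℂ ϑ p :=
  hϑ.differentiable.analyticAt p

theorem eventually_ne_zero (hϑ : IsShiftedTheta τ ϑ) (p : ℂ) : ∀ᶠ w in 𝓝[≠] p, ϑ w ≠ 0 := by
  refine (hϑ.analyticAt p).eventually_eq_zero_or_eventually_ne_zero.resolve_left fun h => ?_
  obtain ⟨w, hw⟩ := hϑ.ne_zero
  have han : AnalyticOnNhd ℂ ϑ Set.univ := fun q _ => hϑ.analyticAt q
  exact hw (han.eqOn_zero_of_preconnected_of_eventuallyEq_zero isPreconnected_univ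
    (Set.mem_univ p) h (Set.mem_univ w))

/-- The multipliers of `ϑ` are exponentials of affine functions. -/
theorem exists_multiplier (hϑ : IsShiftedTheta τ ϑ) {l : ℂ} (hl : l ∈ lattice τ) :
    ∃ a b, ∀ w, ϑ (w + l) = Complex.exp (a + b * w) * ϑ w := by
  refine mem_of_mem_lattice (τ := τ)
    { carrier := {l | ∃ a b, ∀ w, ϑ (w + l) = Complex.exp (a + b * w) * ϑ w}
      zero_mem' := ⟨0, 0, by simp⟩
      add_mem' := ?_
      neg_mem' := ?_ } ?_ ?_ hl
  · rintro l m ⟨a, b, h⟩ ⟨c, d, h'⟩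
    refine ⟨a + c + d * l, b + d, fun w => ?_⟩
    rw [← add_assoc, h', h, ← mul_assoc, ← Complex.exp_add]
    congr 2
    ring
  · rintro l ⟨a, b, h⟩
    refine ⟨-a + b * l, -b, fun w => ?_⟩
    have := h (w + -l)
    rw [neg_add_cancel_right] at this
    rw [this, ← mul_assoc, ← Complex.exp_add,
      show -a + b * l + -b * w + (a + b * (w + -l)) = 0 by ring, Complex.exp_zero, one_mul]
  · exact ⟨0, 0, by simp [hϑ.add_one]⟩
  · refine ⟨Real.pi * Complex.I, -(2 * Real.pi * Complex.I), fun w => ?_⟩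
    rw [hϑ.add_tau, Complex.exp_add, Complex.exp_pi_mul_I, ← neg_mul (2 * Real.pi * Complex.I)]
    ring

theorem eq_zero_of_mem (hϑ : IsShiftedTheta τ ϑ) {l : ℂ} (hl : l ∈ lattice τ) : ϑ l = 0 := by
  obtain ⟨a, b, h⟩ := hϑ.exists_multiplier hl
  have := h 0
  rwa [zero_add, hϑ.zero, mul_zero] at this

theorem exists_deriv_eq (hϑ : IsShiftedTheta τ ϑ) {l : ℂ} (hl : l ∈ lattice τ) :
    ∃ c, c ≠ 0 ∧ deriv ϑ l = c * deriv ϑ 0 := by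
  obtain ⟨a, b, h⟩ := hϑ.exists_multiplier hl
  refine ⟨Complex.exp a, Complex.exp_ne_zero _, ?_⟩
  have h1 : HasDerivAt (fun w => ϑ (w + l)) (deriv ϑ l) 0 := by
    refine HasDerivAt.comp_add_const 0 l ?_
    rw [zero_add]
    exact (hϑ.differentiable l).hasDerivAt
  have h2 : HasDerivAt (fun w => Complex.exp (a + b * w) * ϑ w)
      (Complex.exp (a + b * 0) * b * ϑ 0 + Complex.exp (a + b * 0) * deriv ϑ 0) 0 := by
    have h3 : HasDerivAt (fun w => Complex.exp (a + b * w)) (Complex.exp (a + b * 0) * b) 0 := by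
      have := ((hasDerivAt_id (0 : ℂ)).const_mul b).const_add a
      simpa using this.cexp
    exact h3.mul (hϑ.differentiable 0).hasDerivAt
  have h4 : (fun w => ϑ (w + l)) = fun w => Complex.exp (a + b * w) * ϑ w := funext h
  rw [h4] at h1
  rw [h1.unique h2, hϑ.zero]
  simp

/-- An elliptic function whose poles are cancelled by `ϑ²` is linearly dependent on `1` and `℘`. -/
theorem exists_relation (hϑ : IsShiftedTheta τ ϑ) {h : ℂ → ℂ}
    (hper : ∀ l ∈ lattice τ, ∀ w, h (w + l) = h w)
    (hrem : ∀ p, ∃ g, AnalyticAt ℂ g p ∧ (fun w => ϑ w ^ 2 * h w) =ᶠ[𝓝[≠] p] g) :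
    ∃ a b c, (a ≠ 0 ∨ b ≠ 0 ∨ c ≠ 0) ∧ ∀ p, ∀ᶠ w in 𝓝[≠] p, a + b * wp τ w + c * h w = 0 := by
  have key : ∀ h : ℂ → ℂ, (∀ l ∈ lattice τ, ∀ w, h (w + l) = h w) →
      (∀ p, ∃ g, AnalyticAt ℂ g p ∧ (fun w => ϑ w ^ 2 * h w) =ᶠ[𝓝[≠] p] g) →
      ∃ F, IsThetaDegreeTwo τ F ∧ ∀ p, (fun w => ϑ w ^ 2 * h w) =ᶠ[𝓝[≠] p] F := by
    intro h hper hrem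
    obtain ⟨F, hF, hhF⟩ := exists_entire_of_removable hrem
    have hc := hF.continuous
    refine ⟨F, ⟨hF, fun w => ?_, fun w => ?_⟩, hhF⟩
    · refine eq_of_eventuallyEq_punctured (p := w) (F := fun w => F (w + 1)) (by fun_prop)
        hc.continuousAt ?_
      filter_upwards [hhF w, (tendsto_add_const_punctured w 1).eventually (hhF (w + 1))]
        with u h1 h2
      rw [← h1, ← h2, hϑ.add_one, hper _ (one_mem_lattice τ)]
    · refine eq_of_eventuallyEq_punctured (p := w) (F := fun w => F (w + τ))
        (G := fun w => F w * Complex.exp (-(4 * Real.pi * Complex.I * w))) (by fun_prop)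
        (by fun_prop) ?_
      filter_upwards [hhF w, (tendsto_add_const_punctured w τ).eventually (hhF (w + τ))]
        with u h1 h2
      rw [← h1, ← h2, hϑ.add_tau, hper _ (tau_mem_lattice τ), mul_pow, ← Complex.exp_nat_mul,
        show ((2 : ℕ) : ℂ) * -(2 * Real.pi * Complex.I * u) = -(4 * Real.pi * Complex.I * u) by
          push_cast; ring]
      ring
  have hone : IsThetaDegreeTwo τ fun w => ϑ w ^ 2 := by
    refine ⟨hϑ.differentiable.pow 2, fun w => by rw [hϑ.add_one], fun w => ?_⟩
    rw [hϑ.add_tau, mul_pow, ← Complex.exp_nat_mul,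
      show ((2 : ℕ) : ℂ) * -(2 * Real.pi * Complex.I * w) = -(4 * Real.pi * Complex.I * w) by
        push_cast; ring]
    ring
  obtain ⟨P, hP, hPw⟩ := key (wp τ) (fun l hl w => wp_add τ hl w) (fun p => by
    by_cases hp : p ∈ lattice τ
    · obtain ⟨g, hg, -, hgw⟩ := exists_wp_eq hp
      obtain ⟨k, hk, -, hkw⟩ :=
        exists_analyticAt_eq_sub_mul (hϑ.analyticAt p) (hϑ.eq_zero_of_mem hp)
      refine ⟨fun w => k w ^ 2 * g w, by fun_prop, ?_⟩
      filter_upwards [hgw, self_mem_nhdsWithin] with w h1 h2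
      have h3 : w - p ≠ 0 := sub_ne_zero.2 h2
      rw [h1, hkw, zpow_neg]
      norm_cast
      field_simp
    · exact ⟨_, ((hϑ.analyticAt p).pow 2).mul (analyticAt_wp hp), EventuallyEq.rfl⟩)
  obtain ⟨H, hH, hHw⟩ := key h hper hrem
  obtain ⟨a, ha, hsum⟩ := exists_linear_relation (τ := τ)
    (f := ![fun w => ϑ w ^ 2, P, H]) (by intro i; fin_cases i <;> assumption)
  refine ⟨a 0, a 1, a 2, ?_, fun p => ?_⟩
  · by_contra! hcon
    apply ha
    funext i
    fin_cases i
    exacts [hcon.1, hcon.2.1, hcon.2.2]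
  · filter_upwards [hPw p, hHw p, hϑ.eventually_ne_zero p] with w h1 h2 h3
    have := hsum w
    simp only [Fin.sum_univ_three, Matrix.cons_val_zero, Matrix.cons_val_one,
      Matrix.cons_val_two, Matrix.head_cons, Matrix.tail_cons] at this
    rw [← h1, ← h2] at this
    have h4 : ϑ w ^ 2 * (a 0 + a 1 * wp τ w + a 2 * h w) = 0 := by linear_combination this
    exact (mul_eq_zero.1 h4).resolve_left (pow_ne_zero 2 h3)

/-- A zero `y` of `ϑ` outside the lattice would make `1`, `℘` and `℘(· - y)` linearly dependent. -/
theorem eq_zero_iff (hϑ : IsShiftedTheta τ ϑ) {y : ℂ} : ϑ y = 0 ↔ y ∈ lattice τ := by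
  refine ⟨fun hy => ?_, hϑ.eq_zero_of_mem⟩
  by_contra hmem
  obtain ⟨a, b, c, hne, hrel⟩ := hϑ.exists_relation (h := fun w => wp τ (w - y))
    (fun l hl w => by rw [add_sub_right_comm, wp_add τ hl]) (fun p => by
      by_cases hp : p - y ∈ lattice τ
      · obtain ⟨g, hg, -, hgw⟩ := exists_wp_eq hp
        have hϑp : ϑ p = 0 := by
          obtain ⟨u, v, huv⟩ := hϑ.exists_multiplier hp
          have := huv y
          rwa [add_sub_cancel, hy, mul_zero] at this
        obtain ⟨k, hk, -, hkw⟩ := exists_analyticAt_eq_sub_mul (hϑ.analyticAt p) hϑp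
        refine ⟨fun w => k w ^ 2 * g (w - y), ?_, ?_⟩
        · have : AnalyticAt ℂ (fun w => g (w - y)) p := hg.comp (f := fun w => w - y) (by fun_prop)
          fun_prop
        · have htend := tendsto_add_const_punctured p (-y)
          simp only [← sub_eq_add_neg] at htend
          filter_upwards [htend.eventually hgw, self_mem_nhdsWithin] with w h1 h2
          have h3 : w - p ≠ 0 := sub_ne_zero.2 h2
          rw [h1, hkw, zpow_neg, sub_sub_sub_cancel_right]
          norm_cast
          field_simp
      · refine ⟨_, ((hϑ.analyticAt p).pow 2).mul ?_, EventuallyEq.rfl⟩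
        exact (analyticAt_wp hp).comp (f := fun w => w - y) (by fun_prop))
  have hc : c = 0 := by
    obtain ⟨g, hg, hg0, hgw⟩ := exists_wp_eq (zero_mem (lattice τ))
    have hcont : ContinuousAt (fun w => g (w - y)) y :=
      ContinuousAt.comp (f := fun w => w - y) (by simpa using hg.continuousAt) (by fun_prop)
    have hcont2 := (analyticAt_wp hmem).continuousAt
    have := eq_of_eventuallyEq_punctured (p := y)
      (F := fun w => (w - y) ^ 2 * (a + b * wp τ w) + c * g (w - y))
      (G := fun _ => 0)
      (((by fun_prop : ContinuousAt (fun w => (w - y) ^ 2) y).mul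
        (continuousAt_const.add (continuousAt_const.mul hcont2))).add
        (continuousAt_const.mul hcont)) continuousAt_const ?_
    · simpa [hg0] using this
    · have htend := tendsto_add_const_punctured y (-y)
      simp only [← sub_eq_add_neg, sub_self] at htend
      filter_upwards [hrel y, htend.eventually hgw, self_mem_nhdsWithin] with w h1 h2 h3
      have h4 : w - y ≠ 0 := sub_ne_zero.2 h3
      rw [h2, sub_zero] at h1
      have : ((w - y) ^ (-2 : ℤ)) * (w - y) ^ 2 = 1 := by
        rw [zpow_neg]
        norm_cast
        field_simp
      linear_combination (w - y) ^ 2 * h1 - c * g (w - y) * this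
  have hab := eq_zero_of_add_mul_wp (τ := τ) (a := a) (b := b) (by simpa [hc] using hrel 0)
  rcases hne with h | h | h
  exacts [h hab.1, h hab.2, h hc]

/-- If `ϑ` vanished to second order, then `1`, `℘` and `℘'` would be linearly dependent. -/
theorem deriv_zero_ne_zero (hϑ : IsShiftedTheta τ ϑ) : deriv ϑ 0 ≠ 0 := by
  intro hd
  obtain ⟨a, b, c, hne, hrel⟩ := hϑ.exists_relation (h := deriv (wp τ))
    (fun l hl w => by
      rw [deriv_wp]
      exact (periods τ).derivWeierstrassP_add_coe w ⟨l, hl⟩) (fun p => by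
      by_cases hp : p ∈ lattice τ
      · obtain ⟨g, hg, -, hgw⟩ := exists_deriv_wp_eq hp
        obtain ⟨k, hk, hkp, hkw⟩ :=
          exists_analyticAt_eq_sub_mul (hϑ.analyticAt p) (hϑ.eq_zero_of_mem hp)
        obtain ⟨e, -, he⟩ := hϑ.exists_deriv_eq hp
        obtain ⟨k', hk', -, hkw'⟩ := exists_analyticAt_eq_sub_mul hk (by rw [hkp, he, hd, mul_zero])
        refine ⟨fun w => (w - p) * k' w ^ 2 * g w, by fun_prop, ?_⟩
        filter_upwards [hgw, self_mem_nhdsWithin] with w h1 h2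
        have h3 : w - p ≠ 0 := sub_ne_zero.2 h2
        rw [h1, hkw, hkw', zpow_neg]
        norm_cast
        field_simp
      · exact ⟨_, ((hϑ.analyticAt p).pow 2).mul (analyticAt_wp hp).deriv, EventuallyEq.rfl⟩)
  have hc : c = 0 := by
    obtain ⟨g, hg, hg0, hgw⟩ := exists_wp_eq (zero_mem (lattice τ))
    obtain ⟨g', hg', hg0', hgw'⟩ := exists_deriv_wp_eq (zero_mem (lattice τ))
    have hcont := hg.continuousAt
    have hcont' := hg'.continuousAt
    have := eq_of_eventuallyEq_punctured (p := 0)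
      (F := fun w => a * w ^ 3 + b * w * g w + c * g' w)
      (G := fun _ => 0) (by fun_prop) continuousAt_const ?_
    · simpa [hg0'] using this
    · filter_upwards [hrel 0, hgw, hgw', self_mem_nhdsWithin] with w h1 h2 h3 (h4 : w ≠ 0)
      rw [h2, h3, sub_zero] at h1
      have e1 : w ^ (-2 : ℤ) * w ^ 2 = 1 := by
        rw [zpow_neg]
        norm_cast
        field_simp
      have e2 : w ^ (-3 : ℤ) * w ^ 3 = 1 := by
        rw [zpow_neg]
        norm_cast
        field_simp
      linear_combination w ^ 3 * h1 - b * g w * w * e1 - c * g' w * e2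
  have hab := eq_zero_of_add_mul_wp (τ := τ) (a := a) (b := b) (by simpa [hc] using hrel 0)
  rcases hne with h | h | h
  exacts [h hab.1, h hab.2, h hc]

theorem deriv_ne_zero (hϑ : IsShiftedTheta τ ϑ) {l : ℂ} (hl : l ∈ lattice τ) : deriv ϑ l ≠ 0 := by
  obtain ⟨c, hc, h⟩ := hϑ.exists_deriv_eq hl
  rw [h]
  exact mul_ne_zero hc hϑ.deriv_zero_ne_zero

end IsShiftedTheta

/-! ### Half periods -/

theorem mem_lattice_iff {τ : UpperHalfPlane} {l : ℂ} :
    l ∈ lattice τ ↔ ∃ m n : ℤ, (m : ℂ) + n * τ = l := by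
  rw [lattice, PeriodPair.mem_lattice]
  simp [periods]

theorem int_add_int_mul_tau_eq_zero {τ : UpperHalfPlane} {m n : ℤ} (h : (m : ℂ) + n * τ = 0) :
    m = 0 ∧ n = 0 := by
  have him := congrArg Complex.im h
  have hn : n = 0 := by
    simpa [τ.im_ne_zero] using him
  subst hn
  simpa using h

theorem two_mul_halfPeriod_mem (τ : UpperHalfPlane) (i : Fin 4) :
    2 * halfPeriod τ i ∈ lattice τ :=
  halfPeriod_mem τ i

theorem mem_halfLattice_of_sub_halfPeriod_mem {τ : UpperHalfPlane} {i : Fin 4} {p : ℂ}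
    (hp : p - halfPeriod τ i ∈ lattice τ) : p ∈ halfLattice τ := by
  change 2 * p ∈ lattice τ
  rw [show 2 * p = 2 * (p - halfPeriod τ i) + 2 * halfPeriod τ i by ring]
  exact add_mem (lattice_subset_halfLattice hp) (two_mul_halfPeriod_mem τ i)

theorem two_mul_halfPeriod (τ : UpperHalfPlane) (i : Fin 4) :
    2 * halfPeriod τ i = (![0, 1, 1, 0] i : ℤ) + (![0, 0, 1, 1] i : ℤ) * τ := by
  fin_cases i <;> simp [halfPeriod] <;> ring

theorem halfPeriod_sub_notMem {τ : UpperHalfPlane} {i j : Fin 4} (hij : i ≠ j) :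
    halfPeriod τ i - halfPeriod τ j ∉ lattice τ := by
  intro h
  obtain ⟨m, n, hmn⟩ := mem_lattice_iff.1 h
  have hi := two_mul_halfPeriod τ i
  have hj := two_mul_halfPeriod τ j
  obtain ⟨h1, h2⟩ := int_add_int_mul_tau_eq_zero (τ := τ)
    (m := 2 * m - (![0, 1, 1, 0] i - ![0, 1, 1, 0] j))
    (n := 2 * n - (![0, 0, 1, 1] i - ![0, 0, 1, 1] j))
    (by push_cast; linear_combination 2 * hmn + hi - hj)
  clear h hmn hi hj
  fin_cases i <;> fin_cases j <;> simp at h1 h2 hij <;> omega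

theorem halfPeriod_zero (τ : UpperHalfPlane) : halfPeriod τ 0 = 0 := rfl

theorem halfPeriod_notMem {τ : UpperHalfPlane} {i : Fin 4} (hi : i ≠ 0) :
    halfPeriod τ i ∉ lattice τ := by
  simpa [halfPeriod_zero] using halfPeriod_sub_notMem (τ := τ) hi

theorem exists_sub_halfPeriod_mem {τ : UpperHalfPlane} {p : ℂ} (hp : p ∈ halfLattice τ) :
    ∃ i, p - halfPeriod τ i ∈ lattice τ := by
  obtain ⟨m, n, hmn⟩ := mem_lattice_iff.1 (show 2 * p ∈ lattice τ from hp)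
  have hpe : p = (m + n * τ) / 2 := by rw [hmn]; ring
  rcases Int.even_or_odd' m with ⟨a, rfl | rfl⟩ <;> rcases Int.even_or_odd' n with ⟨b, rfl | rfl⟩
  · exact ⟨0, mem_lattice_iff.2 ⟨a, b, by rw [hpe]; simp [halfPeriod]; ring⟩⟩
  · exact ⟨3, mem_lattice_iff.2 ⟨a, b, by rw [hpe]; simp [halfPeriod]; ring⟩⟩
  · exact ⟨1, mem_lattice_iff.2 ⟨a, b, by rw [hpe]; simp [halfPeriod]; ring⟩⟩
  · exact ⟨2, mem_lattice_iff.2 ⟨a, b, by rw [hpe]; simp [halfPeriod]; ring⟩⟩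

/-! ### The Weierstrass function in terms of theta functions -/

namespace IsShiftedTheta

variable {τ : UpperHalfPlane} {ϑ : ℂ → ℂ}

/-- The factorization of `℘ - ℘(q)`, which exhibits its zeros. -/
theorem exists_wp_sub (hϑ : IsShiftedTheta τ ϑ) {q : ℂ} (hq : q ∉ lattice τ) :
    ∃ C, C ≠ 0 ∧ ∀ w ∉ lattice τ, ϑ (w - q) * ϑ (w + q) = C * ϑ w ^ 2 * (wp τ w - wp τ q) := by
  have hqθ : ϑ q ≠ 0 := fun h => hq (hϑ.eq_zero_iff.1 h)
  have hqθ' : ϑ (-q) ≠ 0 := fun h => hq (by simpa using neg_mem (hϑ.eq_zero_iff.1 h))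
  have hcont := hϑ.differentiable.continuous
  obtain ⟨a, b, c, hne, hrel⟩ := hϑ.exists_relation
    (h := fun w => ϑ (w - q) * ϑ (w + q) / ϑ w ^ 2)
    (periodic_of_one_of_tau (f := fun w => ϑ (w - q) * ϑ (w + q) / ϑ w ^ 2)
      (fun w => by rw [add_sub_right_comm, add_right_comm, hϑ.add_one, hϑ.add_one, hϑ.add_one])
      (fun w => by
        rw [add_sub_right_comm, add_right_comm, hϑ.add_tau, hϑ.add_tau, hϑ.add_tau]
        have : Complex.exp (-(2 * Real.pi * Complex.I * (w - q))) *
            Complex.exp (-(2 * Real.pi * Complex.I * (w + q))) =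
            Complex.exp (-(2 * Real.pi * Complex.I * w)) ^ 2 := by
          rw [← Complex.exp_add, ← Complex.exp_nat_mul]
          congr 1
          push_cast
          ring
        rw [mul_mul_mul_comm, this, mul_pow, mul_div_mul_right _ _
          (pow_ne_zero 2 (Complex.exp_ne_zero _))]
        ring))
    (fun p => ⟨fun w => ϑ (w - q) * ϑ (w + q), by
        have h := hϑ.differentiable
        exact (h.comp (differentiable_id.sub_const q)).mul
          (h.comp (differentiable_id.add_const q)) |>.analyticAt p, by
        filter_upwards [hϑ.eventually_ne_zero p] with w hw
        field_simp⟩)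
  have hall : ∀ w ∉ lattice τ, ϑ w ^ 2 * (a + b * wp τ w) + c * (ϑ (w - q) * ϑ (w + q)) = 0 := by
    intro w hw
    have hwp := (analyticAt_wp hw).continuousAt
    refine eq_of_eventuallyEq_punctured (p := w)
      (F := fun w => ϑ w ^ 2 * (a + b * wp τ w) + c * (ϑ (w - q) * ϑ (w + q)))
      (G := fun _ => 0) ?_ continuousAt_const ?_
    · exact ((by fun_prop : ContinuousAt (fun w => ϑ w ^ 2) w).mul
        (continuousAt_const.add (continuousAt_const.mul hwp))).add (by fun_prop)
    · filter_upwards [hrel w, hϑ.eventually_ne_zero w] with u h1 h2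
      field_simp at h1
      linear_combination h1
  have hc : c ≠ 0 := by
    rintro rfl
    have := eq_zero_of_add_mul_wp (τ := τ) (a := a) (b := b) (by simpa using hrel 0)
    simp [this] at hne
  have hab : a + b * wp τ q = 0 := by
    have := hall q hq
    rw [sub_self, hϑ.zero, zero_mul, mul_zero, add_zero] at this
    exact (mul_eq_zero.1 this).resolve_left (pow_ne_zero 2 hqθ)
  have hb : b ≠ 0 := by
    rintro rfl
    have ha : a = 0 := by simpa using hab
    subst ha
    have := eq_of_eventuallyEq_punctured (p := 0) (F := fun w => ϑ (w - q) * ϑ (w + q))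
      (G := fun _ => 0) (by fun_prop) continuousAt_const ?_
    · simp [hqθ, hqθ'] at this
    · filter_upwards [eventually_notMem_lattice τ 0] with w hw
      simpa [hc] using hall w hw
  refine ⟨-b / c, div_ne_zero (neg_ne_zero.2 hb) hc, fun w hw => ?_⟩
  field_simp
  linear_combination hall w hw - ϑ w ^ 2 * hab

theorem wp_eq_iff (hϑ : IsShiftedTheta τ ϑ) {w q : ℂ} (hw : w ∉ lattice τ) (hq : q ∉ lattice τ) :
    wp τ w = wp τ q ↔ w - q ∈ lattice τ ∨ w + q ∈ lattice τ := by
  obtain ⟨C, hC, h⟩ := hϑ.exists_wp_sub hq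
  have hwθ : ϑ w ≠ 0 := fun h => hw (hϑ.eq_zero_iff.1 h)
  rw [← sub_eq_zero, ← hϑ.eq_zero_iff, ← hϑ.eq_zero_iff, ← mul_eq_zero, h w hw]
  simp [hC, hwθ]

theorem wp_halfPeriod_ne (hϑ : IsShiftedTheta τ ϑ) {i : Fin 4} (hi : i ≠ 0) {w : ℂ}
    (hw : w ∉ lattice τ) (hwi : w - halfPeriod τ i ∉ lattice τ) :
    wp τ w - wp τ (halfPeriod τ i) ≠ 0 := by
  rw [sub_ne_zero, Ne, hϑ.wp_eq_iff hw (halfPeriod_notMem hi)]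
  rintro (h | h)
  · exact hwi h
  · refine hwi ?_
    have := sub_mem h (two_mul_halfPeriod_mem τ i)
    rwa [show w + halfPeriod τ i - 2 * halfPeriod τ i = w - halfPeriod τ i by ring] at this

theorem deriv_wp_ne_zero (hϑ : IsShiftedTheta τ ϑ) {q : ℂ} (hq : q ∉ halfLattice τ) :
    deriv (wp τ) q ≠ 0 := by
  have hq' : q ∉ lattice τ := fun h => hq (lattice_subset_halfLattice h)
  obtain ⟨C, hC, h⟩ := hϑ.exists_wp_sub hq'
  have hd := hϑ.differentiable
  have h1 : HasDerivAt (fun w => ϑ (w - q) * ϑ (w + q)) (deriv ϑ 0 * ϑ (q + q)) q := by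
    have e1 : HasDerivAt (fun w => ϑ (w - q)) (deriv ϑ 0) q := by
      refine HasDerivAt.comp_sub_const q q ?_
      rw [sub_self]
      exact (hd 0).hasDerivAt
    have e2 : HasDerivAt (fun w => ϑ (w + q)) (deriv ϑ (q + q)) q :=
      HasDerivAt.comp_add_const q q (hd _).hasDerivAt
    exact (e1.mul e2).congr_deriv (by simp [hϑ.zero])
  have h2 : HasDerivAt (fun w => C * ϑ w ^ 2 * (wp τ w - wp τ q))
      (C * ϑ q ^ 2 * deriv (wp τ) q) q := by
    have e1 : HasDerivAt (fun w => C * ϑ w ^ 2) (deriv (fun w => C * ϑ w ^ 2) q) q := by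
      refine DifferentiableAt.hasDerivAt ?_
      have := hd q
      fun_prop
    have e2 := ((analyticAt_wp hq').differentiableAt.hasDerivAt).sub_const (wp τ q)
    exact (e1.mul e2).congr_deriv (by simp)
  have h3 : (fun w => ϑ (w - q) * ϑ (w + q)) =ᶠ[𝓝 q]
      fun w => C * ϑ w ^ 2 * (wp τ w - wp τ q) := by
    filter_upwards [(isClosed_lattice τ).isOpen_compl.mem_nhds hq'] with w hw using h w hw
  have h4 := h1.unique (h2.congr_of_eventuallyEq h3)
  intro h0
  rw [h0, mul_zero] at h4
  rcases mul_eq_zero.1 h4 with h5 | h5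
  · exact hϑ.deriv_zero_ne_zero h5
  · refine hq ?_
    rw [hϑ.eq_zero_iff, ← two_mul] at h5
    exact h5

/-- The order of `℘ - ℘(w_j)` over the branch points. -/
theorem meromorphicOrderAt_wp_sub (hϑ : IsShiftedTheta τ ϑ) {j : Fin 4} (hj : j ≠ 0) {i : Fin 4}
    {p : ℂ} (hp : p - halfPeriod τ i ∈ lattice τ) :
    meromorphicOrderAt (fun w => wp τ w - wp τ (halfPeriod τ j)) p =
      ((if i = j then 2 else if i = 0 then -2 else 0 : ℤ) : WithTop ℤ) := by
  have hm : MeromorphicAt (fun w => wp τ w - wp τ (halfPeriod τ j)) p :=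
    ((periods τ).meromorphic_weierstrassP p).sub (MeromorphicAt.const _ _)
  have hmem : ∀ k, k ≠ i → p - halfPeriod τ k ∉ lattice τ := by
    intro k hk h
    refine halfPeriod_sub_notMem (τ := τ) hk ?_
    have := sub_mem hp h
    rwa [sub_sub_sub_cancel_left] at this
  split_ifs with h1 h2
  · subst h1
    have hpΓ : p ∉ lattice τ := by simpa [halfPeriod_zero] using hmem 0 hj.symm
    obtain ⟨C, hC, h⟩ := hϑ.exists_wp_sub (halfPeriod_notMem (τ := τ) hj)
    have hp' : p + halfPeriod τ i ∈ lattice τ := by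
      have := add_mem hp (two_mul_halfPeriod_mem τ i)
      rwa [show p - halfPeriod τ i + 2 * halfPeriod τ i = p + halfPeriod τ i by ring] at this
    have hpθ : ϑ p ≠ 0 := fun h => hpΓ (hϑ.eq_zero_iff.1 h)
    have han : ∀ q, AnalyticAt ℂ (fun w => ϑ (w + q)) p := fun q =>
      (hϑ.differentiable.comp (differentiable_id.add_const q)).analyticAt p
    obtain ⟨k, hk, hkp, hkw⟩ := exists_analyticAt_eq_sub_mul (han (halfPeriod τ i))
      (hϑ.eq_zero_of_mem hp')
    obtain ⟨k', hk', hkp', hkw'⟩ := exists_analyticAt_eq_sub_mul (han (-halfPeriod τ i))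
      (hϑ.eq_zero_of_mem (by simpa [sub_eq_add_neg] using hp))
    have hθan := hϑ.analyticAt p
    refine (meromorphicOrderAt_eq_int_iff hm).2
      ⟨fun w => k w * k' w / (C * ϑ w ^ 2), ?_, ?_, ?_⟩
    · refine (hk.mul hk').div (analyticAt_const.mul (hθan.pow 2)) ?_
      exact mul_ne_zero hC (pow_ne_zero 2 hpθ)
    · refine div_ne_zero (mul_ne_zero ?_ ?_) (mul_ne_zero hC (pow_ne_zero 2 hpθ))
      · rw [hkp, deriv_comp_add_const]
        exact hϑ.deriv_ne_zero hp'
      · rw [hkp', deriv_comp_add_const, ← sub_eq_add_neg]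
        exact hϑ.deriv_ne_zero hp
    · filter_upwards [eventually_notMem_lattice τ p, hϑ.eventually_ne_zero p] with w h1 h2
      have h3 := h w h1
      rw [sub_eq_add_neg, hkw, hkw'] at h3
      rw [smul_eq_mul, zpow_ofNat]
      field_simp
      linear_combination -h3
  · subst h2
    rw [halfPeriod_zero, sub_zero] at hp
    have h3 := meromorphicOrderAt_wp hp
    have h4 : MeromorphicAt (fun _ : ℂ => -wp τ (halfPeriod τ j)) p := MeromorphicAt.const _ _
    have h5 := meromorphicOrderAt_add_eq_left_of_lt (f₁ := wp τ) h4 (by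
      refine lt_of_lt_of_le ?_ analyticAt_const.meromorphicOrderAt_nonneg
      rw [h3]
      exact_mod_cast (by norm_num : (-2 : ℤ) < 0))
    rw [← h3, ← h5]
    rfl
  · have hpΓ : p ∉ lattice τ := by simpa [halfPeriod_zero] using hmem 0 (Ne.symm h2)
    refine (meromorphicOrderAt_eq_int_iff hm).2
      ⟨_, (analyticAt_wp hpΓ).sub analyticAt_const,
        hϑ.wp_halfPeriod_ne hj hpΓ (hmem j (Ne.symm h1)), ?_⟩
    simp

/-- The order of `℘'` over the branch points. -/
theorem meromorphicOrderAt_deriv_wp_of_mem (hϑ : IsShiftedTheta τ ϑ) {i : Fin 4} {p : ℂ}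
    (hp : p - halfPeriod τ i ∈ lattice τ) :
    meromorphicOrderAt (deriv (wp τ)) p = ((if i = 0 then -3 else 1 : ℤ) : WithTop ℤ) := by
  split_ifs with h
  · subst h
    rw [halfPeriod_zero, sub_zero] at hp
    exact meromorphicOrderAt_deriv_wp hp
  · have h1 := hϑ.meromorphicOrderAt_wp_sub h hp
    rw [if_pos rfl] at h1
    have h2 := meromorphicOrderAt_deriv_eq_sub_one (by norm_num) h1
    have h3 : deriv (fun w => wp τ w - wp τ (halfPeriod τ i)) = deriv (wp τ) := by
      funext w
      simp
    rw [h3] at h2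
    simpa using h2

end IsShiftedTheta

/-! ### Reflection of the theta function and the residues of the explicit forms -/

namespace IsShiftedTheta

variable {τ : UpperHalfPlane} {ϑ : ℂ → ℂ}

open Classical in
theorem exists_factorization (hϑ : IsShiftedTheta τ ϑ) (p : ℂ) :
    ∃ k, AnalyticAt ℂ k p ∧ k p ≠ 0 ∧
      ∀ w, ϑ w = (w - p) ^ (if p ∈ lattice τ then 1 else 0 : ℤ) * k w := by
  split_ifs with hp
  · obtain ⟨k, hk, hkp, hkw⟩ :=
      exists_analyticAt_eq_sub_mul (hϑ.analyticAt p) (hϑ.eq_zero_of_mem hp)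
    exact ⟨k, hk, by rw [hkp]; exact hϑ.deriv_ne_zero hp, by simpa using hkw⟩
  · exact ⟨ϑ, hϑ.analyticAt p, fun h => hp (hϑ.eq_zero_iff.1 h), by simp⟩

theorem apply_neg (hϑ : IsShiftedTheta τ ϑ) (w : ℂ) :
    ϑ (-w) = -Complex.exp (-(2 * Real.pi * Complex.I * w)) * ϑ w := by
  have hd := hϑ.differentiable
  have hc := hd.continuous
  have hneg : Differentiable ℂ fun w => ϑ (-w) := hd.comp differentiable_neg
  -- The quotient of both sides is an elliptic function without poles.
  obtain ⟨c, hcw⟩ := eventuallyEq_const_of_norm_periodic τ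
    (f := fun w => ϑ (-w) * Complex.exp (2 * Real.pi * Complex.I * w) / ϑ w)
    (fun l hl w => congrArg norm (periodic_of_one_of_tau
      (f := fun w => ϑ (-w) * Complex.exp (2 * Real.pi * Complex.I * w) / ϑ w)
      (fun w => by
        have h1 : ϑ (-(w + 1)) = ϑ (-w) := by
          rw [← hϑ.add_one]
          congr 1
          ring
        have h2 : Complex.exp (2 * Real.pi * Complex.I * (w + 1)) =
            Complex.exp (2 * Real.pi * Complex.I * w) := by
          rw [mul_add, mul_one, Complex.exp_add, Complex.exp_two_pi_mul_I, mul_one]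
        simp only [h1, h2, hϑ.add_one])
      (fun w => by
        have h1 : ϑ (-w) = -ϑ (-(w + τ)) * Complex.exp (2 * Real.pi * Complex.I * (w + τ)) := by
          have := hϑ.add_tau (-(w + τ))
          rw [show -(w + (τ : ℂ)) + τ = -w by ring] at this
          rw [this]
          congr 2
          ring
        have h2 : Complex.exp (2 * Real.pi * Complex.I * w) *
            Complex.exp (-(2 * Real.pi * Complex.I * w)) = 1 := by
          rw [← Complex.exp_add, add_neg_cancel, Complex.exp_zero]
        have h3 := Complex.exp_ne_zero (-(2 * Real.pi * Complex.I * w))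
        rw [h1, hϑ.add_tau]
        by_cases h4 : ϑ w = 0
        · simp [h4]
        · rw [div_eq_div_iff (mul_ne_zero (neg_ne_zero.2 h4) h3) h4]
          linear_combination -ϑ (-(w + τ)) * Complex.exp (2 * Real.pi * Complex.I * (w + τ)) * ϑ w
            * h2) l hl w))
    (fun p => by
      by_cases hp : p ∈ lattice τ
      · obtain ⟨k, hk, hkp, hkw⟩ :=
          exists_analyticAt_eq_sub_mul (hϑ.analyticAt p) (hϑ.eq_zero_of_mem hp)
        obtain ⟨k', hk', -, hkw'⟩ :=
          exists_analyticAt_eq_sub_mul (hneg.analyticAt p) (hϑ.eq_zero_of_mem (neg_mem hp))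
        have hkp0 : k p ≠ 0 := by
          rw [hkp]
          exact hϑ.deriv_ne_zero hp
        refine ⟨fun w => k' w * Complex.exp (2 * Real.pi * Complex.I * w) / k w, ?_, ?_⟩
        · fun_prop (disch := assumption)
        · filter_upwards [self_mem_nhdsWithin] with w hw
          have : w - p ≠ 0 := sub_ne_zero.2 hw
          rw [hkw', hkw w, mul_assoc, mul_div_mul_left _ _ this]
      · refine ⟨_, ?_, EventuallyEq.rfl⟩
        have h0 : ϑ p ≠ 0 := fun h => hp (hϑ.eq_zero_iff.1 h)
        have h1 := hneg.analyticAt p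
        have h2 := hϑ.analyticAt p
        exact (h1.mul (by fun_prop)).div h2 h0)
  have hall : ∀ w, ϑ (-w) * Complex.exp (2 * Real.pi * Complex.I * w) = c * ϑ w := by
    intro w
    refine eq_of_eventuallyEq_punctured (p := w)
      (F := fun w => ϑ (-w) * Complex.exp (2 * Real.pi * Complex.I * w)) (G := fun w => c * ϑ w)
      (by fun_prop) (by fun_prop) ?_
    filter_upwards [hcw w, hϑ.eventually_ne_zero w] with u h1 h2
    rwa [div_eq_iff h2] at h1
  have hc1 : c = -1 := by
    have e1 : HasDerivAt (fun w => ϑ (-w)) (-deriv ϑ 0) 0 := by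
      have := (hd (-0)).hasDerivAt.comp (0 : ℂ) (hasDerivAt_neg (0 : ℂ))
      rwa [neg_zero, mul_neg_one] at this
    have e2 : HasDerivAt (fun w => Complex.exp (2 * Real.pi * Complex.I * w))
        (2 * Real.pi * Complex.I) 0 := by
      have := ((hasDerivAt_id (0 : ℂ)).const_mul (2 * Real.pi * Complex.I)).cexp
      simpa using this
    have e3 := (hd 0).hasDerivAt.const_mul c
    have e4 : HasDerivAt (fun w => c * ϑ w) (-deriv ϑ 0) 0 := by
      rw [← funext hall]
      exact (e1.mul e2).congr_deriv (by simp [hϑ.zero])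
    have := e3.unique e4
    refine mul_right_cancel₀ hϑ.deriv_zero_ne_zero ?_
    rw [this]
    ring
  have h := hall w
  rw [hc1] at h
  have h2 : Complex.exp (2 * Real.pi * Complex.I * w) *
      Complex.exp (-(2 * Real.pi * Complex.I * w)) = 1 := by
    rw [← Complex.exp_add, add_neg_cancel, Complex.exp_zero]
  linear_combination Complex.exp (-(2 * Real.pi * Complex.I * w)) * h - ϑ (-w) * h2

theorem halfPeriod_add_ne_zero (hϑ : IsShiftedTheta τ ϑ) {x : ℂ} (hx : 2 * x ∉ lattice τ)
    (i : Fin 4) : ϑ (halfPeriod τ i + x) ≠ 0 := by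
  rw [Ne, hϑ.eq_zero_iff]
  intro h
  have h1 := sub_mem (add_mem h h) (two_mul_halfPeriod_mem τ i)
  rw [show halfPeriod τ i + x + (halfPeriod τ i + x) - 2 * halfPeriod τ i = 2 * x by ring] at h1
  exact hx h1

end IsShiftedTheta

theorem tau_sub_conj_ne_zero (τ : UpperHalfPlane) : (τ : ℂ) - starRingEnd ℂ (τ : ℂ) ≠ 0 := by
  intro h
  have := congrArg Complex.im h
  simp at this
  exact τ.im_ne_zero (by linarith)

/-- The value of the theta quotients of the explicit residues does not depend on the half period. -/
theorem IsShiftedTheta.halfPeriod_quotient {τ : UpperHalfPlane} {ϑ : ℂ → ℂ}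
    (hϑ : IsShiftedTheta τ ϑ) {x : ℂ} (hx : 2 * x ∉ lattice τ) (i : Fin 4) :
    branchSign i * Complex.exp (-(4 * Real.pi * Complex.I / (starRingEnd ℂ (τ : ℂ) - τ) * x *
      (halfPeriod τ i - starRingEnd ℂ (halfPeriod τ i)))) *
      (ϑ (halfPeriod τ i + x) / ϑ (halfPeriod τ i - x)) =
    Complex.exp (2 * Real.pi * Complex.I * x) := by
  have hne : ϑ (halfPeriod τ i - x) ≠ 0 := by
    rw [sub_eq_add_neg]
    refine hϑ.halfPeriod_add_ne_zero ?_ i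
    rwa [mul_neg, neg_mem_iff]
  have hττ : starRingEnd ℂ (τ : ℂ) - τ ≠ 0 := by
    rw [← neg_sub, neg_ne_zero]
    exact tau_sub_conj_ne_zero τ
  have hrefl : ϑ (halfPeriod τ i - x) =
      -Complex.exp (-(2 * Real.pi * Complex.I * (x - halfPeriod τ i))) *
        ϑ (x - halfPeriod τ i) := by
    rw [← hϑ.apply_neg, neg_sub]
  have hconj : starRingEnd ℂ (2 : ℂ) = 2 := map_ofNat _ 2
  rw [← mul_div_assoc, div_eq_iff hne, hrefl]
  -- In each case both sides are explicit multiples of `ϑ (x - w_i)`.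
  fin_cases i
  · simp [halfPeriod, branchSign]
    rw [← mul_assoc, ← Complex.exp_add]
    simp
  · have h1 : ϑ (1 / 2 + x) = ϑ (x - 1 / 2) := by
      rw [← hϑ.add_one (x - 1 / 2)]
      congr 1
      ring
    have h2 : Complex.exp (2 * Real.pi * Complex.I * x) *
        Complex.exp (-(2 * Real.pi * Complex.I * (x - 1 / 2))) = -1 := by
      rw [← Complex.exp_add, ← Complex.exp_pi_mul_I]
      congr 1
      ring
    have h3 : starRingEnd ℂ (1 / 2 : ℂ) = 1 / 2 := by simp [hconj]
    simp only [halfPeriod, branchSign, Fin.mk_one, Matrix.cons_val_one, Matrix.cons_val_zero, h1,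
      h3, sub_self, mul_zero, neg_zero, Complex.exp_zero, one_mul]
    linear_combination ϑ (x - 1 / 2) * h2
  · have h1 : ϑ ((1 + τ) / 2 + x) = -ϑ (x - (1 + τ) / 2) *
        Complex.exp (-(2 * Real.pi * Complex.I * (x - (1 + τ) / 2))) := by
      rw [← hϑ.add_tau, ← hϑ.add_one (x - (1 + τ) / 2 + τ)]
      congr 1
      ring
    have h3 : starRingEnd ℂ ((1 + τ) / 2 : ℂ) = (1 + starRingEnd ℂ (τ : ℂ)) / 2 := by simp [hconj]
    have h4 : Complex.exp (-(4 * Real.pi * Complex.I / (starRingEnd ℂ (τ : ℂ) - τ) * x *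
        ((1 + τ) / 2 - (1 + starRingEnd ℂ (τ : ℂ)) / 2))) =
        Complex.exp (2 * Real.pi * Complex.I * x) := by
      congr 1
      field_simp
      ring
    simp only [halfPeriod, branchSign, Fin.reduceFinMk, Matrix.cons_val, h1, h3, h4]
    ring
  · have h1 : ϑ (τ / 2 + x) = -ϑ (x - τ / 2) *
        Complex.exp (-(2 * Real.pi * Complex.I * (x - τ / 2))) := by
      rw [← hϑ.add_tau]
      congr 1
      ring
    have h3 : starRingEnd ℂ (τ / 2 : ℂ) = starRingEnd ℂ (τ : ℂ) / 2 := by simp [hconj]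
    have h4 : Complex.exp (-(4 * Real.pi * Complex.I / (starRingEnd ℂ (τ : ℂ) - τ) * x *
        (τ / 2 - starRingEnd ℂ (τ : ℂ) / 2))) =
        Complex.exp (2 * Real.pi * Complex.I * x) := by
      congr 1
      field_simp
      ring
    simp only [halfPeriod, branchSign, Fin.reduceFinMk, Matrix.cons_val, h1, h3, h4]
    ring

theorem alphaCoeff_eq (τ : UpperHalfPlane) (ϑ : ℂ → ℂ) (ρ : Fin 4 → ℝ) (σ : ℤˣ) (x : ℂ)
    (i : Fin 4) : alphaCoeff τ ϑ ρ σ x i = alphaCoeff τ ϑ ρ 1 ((σ : ℤ) * x) i := by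
  simp only [alphaCoeff, Units.val_one, Int.cast_one, one_mul]
  rw [show (-1 : ℂ) * (4 * Real.pi * Complex.I / (starRingEnd ℂ (τ : ℂ) - τ) * ((σ : ℤ) * x) *
      (halfPeriod τ i - starRingEnd ℂ (halfPeriod τ i))) =
      -(σ : ℤ) * (4 * Real.pi * Complex.I / (starRingEnd ℂ (τ : ℂ) - τ) * x *
      (halfPeriod τ i - starRingEnd ℂ (halfPeriod τ i))) by ring,
    show 2 * (((σ : ℤ) : ℂ) * x) = (σ : ℤ) * (2 * x) by ring]

theorem units_mul_mem_lattice {τ : UpperHalfPlane} (σ : ℤˣ) {y : ℂ} :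
    ((σ : ℤ) : ℂ) * y ∈ lattice τ ↔ y ∈ lattice τ := by
  rcases Int.units_eq_one_or σ with rfl | rfl <;> simp

/-- The residues of the explicit forms, in which `ϑ(±2x) / ϑ'(0)` is the residue of `t_{∓2x}`. -/
theorem IsShiftedTheta.alphaCoeff_mul {τ : UpperHalfPlane} {ϑ : ℂ → ℂ} (hϑ : IsShiftedTheta τ ϑ)
    (ρ : Fin 4 → ℝ) (σ : ℤˣ) {x : ℂ} (hx : 2 * x ∉ lattice τ) (i : Fin 4) :
    alphaCoeff τ ϑ ρ σ x i * (ϑ ((σ : ℤ) * (2 * x)) / deriv ϑ 0) =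
      Complex.exp ((σ : ℤ) * (2 * Real.pi * Complex.I * x)) * (2 * (ρ i : ℂ) - 1 / 2) := by
  have hx' : 2 * (((σ : ℤ) : ℂ) * x) ∉ lattice τ := by
    rwa [mul_left_comm, units_mul_mem_lattice]
  have h1 : ϑ (2 * (((σ : ℤ) : ℂ) * x)) ≠ 0 := fun h => hx' (hϑ.eq_zero_iff.1 h)
  have h2 := hϑ.deriv_zero_ne_zero
  have h3 := hϑ.halfPeriod_quotient hx' i
  have h4 : ϑ (2 * (((σ : ℤ) : ℂ) * x)) / deriv ϑ 0 * (deriv ϑ 0 / ϑ (2 * (((σ : ℤ) : ℂ) * x))) =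
      1 := by
    rw [div_mul_div_cancel₀ h2, div_self h1]
  rw [alphaCoeff_eq]
  rw [show ((σ : ℤ) : ℂ) * (2 * Real.pi * Complex.I * x) =
    2 * Real.pi * Complex.I * ((σ : ℤ) * x) by ring, ← h3, mul_left_comm ((σ : ℤ) : ℂ) 2 x]
  simp only [alphaCoeff, Units.val_one, Int.cast_one, one_mul, neg_one_mul]
  set A := ϑ (2 * (((σ : ℤ) : ℂ) * x)) / deriv ϑ 0
  set B := deriv ϑ 0 / ϑ (2 * (((σ : ℤ) : ℂ) * x))
  rw [mul_right_comm _ _ A, mul_assoc _ B A, mul_comm B A, h4, mul_one]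

/-! ### Exponentials of real-linear functions and the Wirtinger derivative -/

/-- The function `exp (a w + b w̄)`. -/
def expConj (a b w : ℂ) : ℂ := Complex.exp (a * w + b * starRingEnd ℂ w)

theorem expConj_ne_zero (a b w : ℂ) : expConj a b w ≠ 0 := Complex.exp_ne_zero _

theorem expConj_add (a b w l : ℂ) : expConj a b (w + l) = expConj a b w * expConj a b l := by
  rw [expConj, expConj, expConj, ← Complex.exp_add, map_add]
  congr 1
  ring

theorem expConj_zero (a b : ℂ) : expConj a b 0 = 1 := by simp [expConj]

theorem expConj_neg_mul (a b w : ℂ) : expConj a b (-w) * expConj a b w = 1 := by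
  rw [← expConj_add, neg_add_cancel, expConj_zero]

theorem expConj_neg_neg (a b w : ℂ) : expConj (-a) (-b) w = expConj a b (-w) := by
  simp [expConj]

theorem norm_expConj (s w : ℂ) : ‖expConj (-(starRingEnd ℂ s)) s w‖ = 1 := by
  rw [expConj, Complex.norm_exp]
  simp

theorem contDiff_expConj (a b : ℂ) : ContDiff ℝ ∞ (expConj a b) := by
  have h : ContDiff ℝ ∞ (fun w : ℂ => a * w + b * Complex.conjCLE w) :=
    (contDiff_const.mul contDiff_id).add (contDiff_const.mul Complex.conjCLE.contDiff)
  exact Complex.contDiff_exp.comp h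

theorem continuous_expConj (a b : ℂ) : Continuous (expConj a b) := (contDiff_expConj a b).continuous

theorem hasFDerivAt_expConj (a b w : ℂ) :
    HasFDerivAt (expConj a b) (expConj a b w •
      (a • (ContinuousLinearMap.id ℝ ℂ) + b • (Complex.conjCLE : ℂ →L[ℝ] ℂ))) w := by
  have h : HasFDerivAt (fun w : ℂ => a * w + b * Complex.conjCLE w)
      (a • (ContinuousLinearMap.id ℝ ℂ) + b • (Complex.conjCLE : ℂ →L[ℝ] ℂ)) w :=
    ((hasFDerivAt_id w).const_mul a).add (Complex.conjCLE.hasFDerivAt.const_mul b)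
  exact h.cexp

theorem fderiv_expConj_mul (a b : ℂ) {f : ℂ → ℂ} {w : ℂ} (hf : DifferentiableAt ℝ f w) (h : ℂ) :
    fderiv ℝ (fun w => expConj a b w * f w) w h =
      expConj a b w * (fderiv ℝ f w h + (a * h + b * starRingEnd ℂ h) * f w) := by
  rw [fderiv_fun_mul (hasFDerivAt_expConj a b w).differentiableAt hf,
    (hasFDerivAt_expConj a b w).fderiv]
  simp
  ring

theorem dbar_expConj_mul (a b : ℂ) {f : ℂ → ℂ} {w : ℂ} (hf : DifferentiableAt ℝ f w) :
    dbar (fun w => expConj a b w * f w) w = expConj a b w * (dbar f w + b * f w) := by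
  simp only [dbar, fderiv_expConj_mul a b hf, smul_eq_mul, map_one, Complex.conj_I]
  linear_combination (a - b) / 2 * expConj a b w * f w * Complex.I_mul_I

theorem fderiv_real_apply {f : ℂ → ℂ} {w : ℂ} (hf : DifferentiableAt ℂ f w) (h : ℂ) :
    fderiv ℝ f w h = h * deriv f w := by
  rw [hf.fderiv_restrictScalars ℝ]
  simp [fderiv_eq_smul_deriv]

theorem dbar_eq_zero {f : ℂ → ℂ} {w : ℂ} (hf : DifferentiableAt ℂ f w) : dbar f w = 0 := by
  simp only [dbar, fderiv_real_apply hf, smul_eq_mul]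
  linear_combination 1 / 2 * deriv f w * Complex.I_mul_I

theorem differentiableAt_of_dbar_eq_zero {f : ℂ → ℂ} {w : ℂ} (hf : DifferentiableAt ℝ f w)
    (h : dbar f w = 0) : DifferentiableAt ℂ f w := by
  refine differentiableAt_complex_iff_differentiableAt_real.2 ⟨hf, ?_⟩
  simp only [dbar, smul_eq_mul] at h ⊢
  linear_combination -2 * Complex.I * h + fderiv ℝ f w Complex.I * Complex.I_mul_I

theorem dbar_congr {f g : ℂ → ℂ} {w : ℂ} (h : f =ᶠ[𝓝 w] g) : dbar f w = dbar g w := by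
  rw [dbar, dbar, h.fderiv_eq]

/-- A solution of `∂̄f + s f = 0` becomes holomorphic after multiplication by `exp (a w + s w̄)`. -/
theorem analyticAt_expConj_mul (a : ℂ) {s : ℂ} {f : ℂ → ℂ} {p : ℂ}
    (hf : ∀ᶠ w in 𝓝 p, ContDiffAt ℝ ∞ f w ∧ dbar f w + s * f w = 0) :
    AnalyticAt ℂ (fun w => expConj a s w * f w) p := by
  rw [Complex.analyticAt_iff_eventually_differentiableAt]
  filter_upwards [hf] with w hw
  have hd : DifferentiableAt ℝ f w := hw.1.differentiableAt (by simp)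
  refine differentiableAt_of_dbar_eq_zero
    ((hasFDerivAt_expConj a s w).differentiableAt.mul hd) ?_
  rw [dbar_expConj_mul a s hd, hw.2, mul_zero]

/-! ### Meromorphic sections with simple poles over the branch points -/

theorem add_mem_halfLattice_iff {τ : UpperHalfPlane} {l w : ℂ} (hl : l ∈ lattice τ) :
    w + l ∈ halfLattice τ ↔ w ∈ halfLattice τ := by
  change 2 * (w + l) ∈ lattice τ ↔ 2 * w ∈ lattice τ
  rw [mul_add]
  exact Submodule.add_mem_iff_left _ (by rw [two_mul]; exact add_mem hl hl)

theorem contDiffAt_real_of_analyticAt {f : ℂ → ℂ} {p : ℂ} (hf : AnalyticAt ℂ f p) :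
    ContDiffAt ℝ ∞ f p :=
  (hf.contDiffAt (n := ∞)).restrict_scalars ℝ

/-- A periodic function `exp (a w - s w̄) B`, with `B` holomorphic up to simple poles over the
branch points, is a section of `L(∂̄ + s dw̄) ⊗ K`. -/
theorem indicator_mem_meroSections {τ : UpperHalfPlane} {a s : ℂ} {f B : ℂ → ℂ}
    (hper : ∀ l ∈ lattice τ, ∀ w ∉ halfLattice τ, f (w + l) = f w)
    (hf : ∀ w ∉ halfLattice τ, f w = expConj a (-s) w * B w)
    (hB : ∀ p ∉ halfLattice τ, AnalyticAt ℂ B p)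
    (hpole : ∀ p ∈ halfLattice τ, ∃ k, AnalyticAt ℂ k p ∧ ∀ᶠ w in 𝓝[≠] p, (w - p) * B w = k w) :
    Set.indicator (halfLattice τ)ᶜ f ∈ meroSections τ s := by
  have heq : ∀ w ∉ halfLattice τ, Set.indicator (halfLattice τ)ᶜ f w = expConj a (-s) w * B w :=
    fun w hw => by rw [Set.indicator_of_mem hw, hf w hw]
  refine ⟨fun l hl w => ?_, fun p hp => ?_, fun p hp => ?_, fun p hp => ?_⟩
  · by_cases hw : w ∈ halfLattice τ
    · rw [Set.indicator_of_notMem (by simpa [add_mem_halfLattice_iff hl] using hw),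
        Set.indicator_of_notMem (by simpa using hw)]
    · rw [Set.indicator_of_mem (by simpa [add_mem_halfLattice_iff hl] using hw),
        Set.indicator_of_mem (by simpa using hw), hper l hl w hw]
  · rw [Set.indicator_of_notMem (by simpa using hp)]
  · have hloc : Set.indicator (halfLattice τ)ᶜ f =ᶠ[𝓝 p] fun w => expConj a (-s) w * B w := by
      filter_upwards [(isClosed_halfLattice τ).isOpen_compl.mem_nhds hp] with w hw using heq w hw
    have hd := (hB p hp).differentiableAt
    refine ⟨((contDiff_expConj a (-s)).contDiffAt.mul
      (contDiffAt_real_of_analyticAt (hB p hp))).congr_of_eventuallyEq hloc, ?_⟩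
    rw [dbar_congr hloc, dbar_expConj_mul _ _ (hd.restrictScalars ℝ), dbar_eq_zero hd, heq p hp]
    ring
  · obtain ⟨k, hk, hkw⟩ := hpole p hp
    refine ⟨fun w => expConj a (-s) w * k w,
      (contDiff_expConj a (-s)).contDiffAt.mul (contDiffAt_real_of_analyticAt hk), ?_⟩
    filter_upwards [hkw, eventually_notMem_halfLattice τ p] with w h1 h2
    rw [heq w h2, ← h1]
    ring

theorem residueMap_eq {τ : UpperHalfPlane} {s : ℂ} (b : meroSections τ s) {i : Fin 4} {r : ℂ}
    (h : Tendsto (fun w => (w - halfPeriod τ i) * b.1 w) (𝓝[≠] (halfPeriod τ i)) (𝓝 r)) :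
    residueMap τ s b i = r :=
  h.limUnder_eq

theorem tendsto_residueMap {τ : UpperHalfPlane} {s : ℂ} (b : meroSections τ s) (i : Fin 4) :
    Tendsto (fun w => (w - halfPeriod τ i) * b.1 w) (𝓝[≠] (halfPeriod τ i))
      (𝓝 (residueMap τ s b i)) := by
  obtain ⟨r, hr⟩ := exists_tendsto_residue b.2 (halfPeriod_mem τ i)
  rwa [residueMap_eq b hr]

/-- `L(∂̄ + s dw̄)` is trivial if the unitary multiplier system of its sections is. -/
theorem isHolTrivial_of_expConj_eq_one {τ : UpperHalfPlane} {s : ℂ}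
    (h : ∀ l ∈ lattice τ, expConj (-(starRingEnd ℂ s)) s l = 1) : IsHolTrivial τ (-s) := by
  refine ⟨expConj (-(starRingEnd ℂ s)) s, contDiff_expConj _ _, fun l hl w => ?_,
    expConj_ne_zero _ _, fun w => ?_⟩
  · rw [expConj_add, h l hl, mul_one]
  · have := dbar_expConj_mul (-(starRingEnd ℂ s)) s (f := fun _ => 1) (w := w)
      (differentiableAt_const _)
    simp only [mul_one] at this
    rw [this, dbar_eq_zero (differentiableAt_const _)]
    ring

theorem expConj_eq_one_iff_neg {τ : UpperHalfPlane} {s : ℂ}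
    (h : ∀ l ∈ lattice τ, expConj (-(starRingEnd ℂ s)) s l = 1) :
    ∀ l ∈ lattice τ, expConj (-(starRingEnd ℂ (-s))) (-s) l = 1 := by
  intro l hl
  rw [map_neg, expConj_neg_neg, h _ (neg_mem hl)]

/-- A section without residues is zero, unless the multiplier system is trivial. -/
theorem residueMap_injective {τ : UpperHalfPlane} {s : ℂ}
    (hs : ¬ ∀ l ∈ lattice τ, expConj (-(starRingEnd ℂ s)) s l = 1) :
    Function.Injective (residueMap τ s) := by
  rw [injective_iff_map_eq_zero]
  intro b hb
  obtain ⟨hper, hzero, hsm, hpole⟩ := b.2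
  set χ := expConj (-(starRingEnd ℂ s)) s with hχ
  have hlocal : ∀ p ∉ halfLattice τ, AnalyticAt ℂ (fun w => χ w * b.1 w) p := by
    intro p hp
    refine analyticAt_expConj_mul _ ?_
    filter_upwards [(isClosed_halfLattice τ).isOpen_compl.mem_nhds hp] with w hw using hsm w hw
  have hres : ∀ p ∈ halfLattice τ, Tendsto (fun w => (w - p) * b.1 w) (𝓝[≠] p) (𝓝 0) := by
    intro p hp
    obtain ⟨i, hi⟩ := exists_sub_halfPeriod_mem hp
    have h1 := tendsto_residueMap b i
    rw [hb] at h1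
    have h2 := tendsto_add_const_punctured p (-(p - halfPeriod τ i))
    rw [show p + -(p - halfPeriod τ i) = halfPeriod τ i by ring] at h2
    refine (h1.comp h2).congr fun w => ?_
    simp only [Function.comp]
    rw [hper _ (neg_mem hi)]
    ring
  obtain ⟨c, hc⟩ := eventuallyEq_const_of_norm_periodic τ (f := fun w => χ w * b.1 w)
    (fun l hl w => by
      rw [norm_mul, norm_mul, norm_expConj, norm_expConj, hper l hl]) (fun p => by
      by_cases hp : p ∈ halfLattice τ
      · obtain ⟨g, hg, hgw⟩ := hpole p hp
        have hgp : g p = 0 := by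
          refine tendsto_nhds_unique (l := 𝓝[≠] p)
            (hg.continuousAt.tendsto.mono_left nhdsWithin_le_nhds) ?_
          exact (hres p hp).congr' hgw
        have han : AnalyticAt ℂ (fun w => χ w * g w) p := by
          refine Complex.analyticAt_of_differentiable_on_punctured_nhds_of_continuousAt ?_ ?_
          · filter_upwards [eventually_eventually_nhdsWithin.2 hgw,
              eventually_notMem_halfLattice τ p, self_mem_nhdsWithin] with w h1 h2 h3
            have h4 : DifferentiableAt ℂ (fun w => (w - p) * (χ w * b.1 w)) w :=
              (differentiableAt_id.sub_const p).mul (hlocal w h2).differentiableAt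
            refine h4.congr_of_eventuallyEq ?_
            rw [isOpen_compl_singleton.nhdsWithin_eq h3] at h1
            filter_upwards [h1] with u hu
            rw [← hu]
            ring
          · exact (continuous_expConj _ _).continuousAt.mul hg.continuousAt
        obtain ⟨k, hk, -, hkw⟩ := exists_analyticAt_eq_sub_mul han (by simp [hgp])
        refine ⟨k, hk, ?_⟩
        filter_upwards [hgw, self_mem_nhdsWithin] with w h1 h2
        have h3 : w - p ≠ 0 := sub_ne_zero.2 h2
        refine mul_left_cancel₀ h3 ?_
        rw [← hkw, ← h1]
        ring
      · exact ⟨_, hlocal p hp, EventuallyEq.rfl⟩)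
  have hall : ∀ w ∉ halfLattice τ, χ w * b.1 w = c := fun w hw =>
    eq_of_eventuallyEq_punctured (hlocal w hw).continuousAt continuousAt_const (hc w)
  have hc0 : c = 0 := by
    by_contra hne
    refine hs fun l hl => ?_
    obtain ⟨w, hw⟩ := (eventually_notMem_halfLattice τ 0).exists
    have h1 := hall w hw
    have h2 := hall (w + l) (by rwa [add_mem_halfLattice_iff hl])
    rw [hper l hl, hχ, expConj_add, ← hχ] at h2
    refine mul_left_cancel₀ hne ?_
    calc c * χ l = χ w * b.1 w * χ l := by rw [h1]
      _ = χ w * χ l * b.1 w := by ring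
      _ = c * 1 := by rw [h2, mul_one]
  ext w
  by_cases hw : w ∈ halfLattice τ
  · exact hzero w hw
  · have := hall w hw
    rw [hc0] at this
    exact (mul_eq_zero.1 this).resolve_left (expConj_ne_zero _ _ _)

/-! ### The sections `t_y` -/

theorem tFun_eq (τ : UpperHalfPlane) (ϑ : ℂ → ℂ) (y w : ℂ) :
    tFun τ ϑ y w =
      expConj (2 * Real.pi * Complex.I / (starRingEnd ℂ (τ : ℂ) - τ) * y)
        (-(2 * Real.pi * Complex.I / (starRingEnd ℂ (τ : ℂ) - τ) * y)) w *
        (ϑ (w - y) / ϑ w) := by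
  rw [tFun, expConj, mul_comm]
  congr 2
  ring

namespace IsShiftedTheta

variable {τ : UpperHalfPlane} {ϑ : ℂ → ℂ}

theorem tFun_add (hϑ : IsShiftedTheta τ ϑ) (y : ℂ) :
    ∀ l ∈ lattice τ, ∀ w, tFun τ ϑ y (w + l) = tFun τ ϑ y w := by
  have hττ : starRingEnd ℂ (τ : ℂ) - τ ≠ 0 := by
    rw [← neg_sub, neg_ne_zero]
    exact tau_sub_conj_ne_zero τ
  refine periodic_of_one_of_tau (fun w => ?_) (fun w => ?_)
  · rw [tFun, tFun, add_sub_right_comm, hϑ.add_one, hϑ.add_one, map_add, map_one,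
      add_sub_add_right_eq_sub]
  · have h1 : Complex.exp (-(2 * Real.pi * Complex.I * (w - y))) =
        Complex.exp (2 * Real.pi * Complex.I * y) *
          Complex.exp (-(2 * Real.pi * Complex.I * w)) := by
      rw [← Complex.exp_add]
      congr 1
      ring
    have h2 : Complex.exp (2 * Real.pi * Complex.I * y) *
        Complex.exp (2 * Real.pi * Complex.I / (starRingEnd ℂ (τ : ℂ) - τ) * y *
          (w + τ - (starRingEnd ℂ w + starRingEnd ℂ (τ : ℂ)))) =
        Complex.exp (2 * Real.pi * Complex.I / (starRingEnd ℂ (τ : ℂ) - τ) * y *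
          (w - starRingEnd ℂ w)) := by
      rw [← Complex.exp_add]
      congr 1
      field_simp
      ring
    rw [tFun, tFun, add_sub_right_comm, hϑ.add_tau, hϑ.add_tau, map_add, h1, ← h2, ← mul_assoc,
      mul_div_mul_right _ _ (Complex.exp_ne_zero _)]
    ring

theorem analyticAt_quotient (hϑ : IsShiftedTheta τ ϑ) (y : ℂ) {p : ℂ} (hp : p ∉ lattice τ) :
    AnalyticAt ℂ (fun w => ϑ (w - y) / ϑ w) p :=
  ((hϑ.differentiable.comp (differentiable_id.sub_const y)).analyticAt p).div (hϑ.analyticAt p)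
    fun h => hp (hϑ.eq_zero_iff.1 h)

theorem dbar_tFun (hϑ : IsShiftedTheta τ ϑ) (y : ℂ) {p : ℂ} (hp : p ∉ lattice τ) :
    dbar (tFun τ ϑ y) p +
      2 * Real.pi * Complex.I / (starRingEnd ℂ (τ : ℂ) - τ) * y * tFun τ ϑ y p = 0 := by
  have hd := (hϑ.analyticAt_quotient y hp).differentiableAt
  rw [funext (tFun_eq τ ϑ y), dbar_expConj_mul _ _ (hd.restrictScalars ℝ), dbar_eq_zero hd]
  ring

/-- `t_y` is a section of `L([y] - [0])`. -/
theorem isPointBundle (hϑ : IsShiftedTheta τ ϑ) (y : ℂ) :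
    IsPointBundle τ (2 * Real.pi * Complex.I / (starRingEnd ℂ (τ : ℂ) - τ) * y) y := by
  refine ⟨tFun τ ϑ y, hϑ.tFun_add y, fun p => ?_⟩
  obtain ⟨k, hk, hkp, hkw⟩ := hϑ.exists_factorization p
  obtain ⟨k', hk', hkp', hkw'⟩ := hϑ.exists_factorization (p - y)
  have hk'' : AnalyticAt ℂ (fun w => k' (w - y)) p := hk'.comp (f := fun w => w - y) (by fun_prop)
  refine ⟨fun w => expConj (2 * Real.pi * Complex.I / (starRingEnd ℂ (τ : ℂ) - τ) * y)
        (-(2 * Real.pi * Complex.I / (starRingEnd ℂ (τ : ℂ) - τ) * y)) w *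
        (k' (w - y) / k w), ?_, ?_, ?_⟩
  · exact (contDiff_expConj _ _).contDiffAt.mul (contDiffAt_real_of_analyticAt (hk''.div hk hkp))
  · exact mul_ne_zero (expConj_ne_zero _ _ _) (div_ne_zero hkp' hkp)
  · filter_upwards [eventually_notMem_lattice τ p, self_mem_nhdsWithin] with w h1 h2
    refine ⟨?_, hϑ.dbar_tFun y h1⟩
    have h3 : w - p ≠ 0 := sub_ne_zero.2 h2
    rw [tFun_eq, hkw w, hkw' (w - y), sub_sub_sub_cancel_right, pointDivisor, zpow_sub₀ h3]
    ring

theorem tendsto_mul_tFun (hϑ : IsShiftedTheta τ ϑ) (y : ℂ) :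
    Tendsto (fun w => w * tFun τ ϑ y w) (𝓝[≠] 0) (𝓝 (ϑ (-y) / deriv ϑ 0)) := by
  obtain ⟨k, hk, hkp, hkw⟩ := exists_analyticAt_eq_sub_mul (hϑ.analyticAt 0) hϑ.zero
  have hc := hϑ.differentiable.continuous
  have hcont : ContinuousAt (fun w =>
      expConj (2 * Real.pi * Complex.I / (starRingEnd ℂ (τ : ℂ) - τ) * y)
        (-(2 * Real.pi * Complex.I / (starRingEnd ℂ (τ : ℂ) - τ) * y)) w *
        (ϑ (w - y) / k w)) 0 := by
    refine (continuous_expConj _ _).continuousAt.mul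
      (ContinuousAt.div (by fun_prop) hk.continuousAt ?_)
    rw [hkp]
    exact hϑ.deriv_zero_ne_zero
  have h := hcont.tendsto.mono_left (nhdsWithin_le_nhds (s := {0}ᶜ))
  rw [expConj_zero, one_mul, zero_sub, hkp] at h
  refine h.congr' ?_
  filter_upwards [self_mem_nhdsWithin] with w (hw : w ≠ 0)
  rw [tFun_eq, hkw w, sub_zero]
  field_simp

/-- A combination of translates of `t_y` is a section with simple poles over the branch points. -/
theorem sum_tFun_mem (hϑ : IsShiftedTheta τ ϑ) (y : ℂ) (c : Fin 4 → ℂ) :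
    Set.indicator (halfLattice τ)ᶜ (fun w => ∑ i, c i * tFun τ ϑ y (w - halfPeriod τ i)) ∈
      meroSections τ (2 * Real.pi * Complex.I / (starRingEnd ℂ (τ : ℂ) - τ) * y) := by
  set s := 2 * Real.pi * Complex.I / (starRingEnd ℂ (τ : ℂ) - τ) * y with hs
  have hsub : ∀ i, ∀ w ∉ halfLattice τ, w - halfPeriod τ i ∉ lattice τ := by
    exact fun i w hw h => hw (mem_halfLattice_of_sub_halfPeriod_mem h)
  have han : ∀ i p, p - halfPeriod τ i ∉ lattice τ →
      AnalyticAt ℂ (fun w => ϑ (w - halfPeriod τ i - y) / ϑ (w - halfPeriod τ i)) p :=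
    fun i p hp => (hϑ.analyticAt_quotient y hp).comp (f := fun w => w - halfPeriod τ i)
      (by fun_prop)
  refine indicator_mem_meroSections (a := s)
    (B := fun w => ∑ i, c i * (expConj s (-s) (-halfPeriod τ i) *
      (ϑ (w - halfPeriod τ i - y) / ϑ (w - halfPeriod τ i)))) ?_ ?_ ?_ ?_
  · intro l hl w _
    simp only [add_sub_right_comm w l, hϑ.tFun_add y l hl]
  · intro w _
    rw [Finset.mul_sum]
    refine Finset.sum_congr rfl fun i _ => ?_
    rw [tFun_eq, sub_eq_add_neg w, expConj_add, ← hs]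
    ring
  · intro p hp
    refine Finset.univ.analyticAt_fun_sum fun i _ => ?_
    exact analyticAt_const.mul (analyticAt_const.mul (han i p (hsub i p hp)))
  · intro p hp
    have hi : ∀ i, ∃ k, AnalyticAt ℂ k p ∧ ∀ᶠ w in 𝓝[≠] p,
        (w - p) * (ϑ (w - halfPeriod τ i - y) / ϑ (w - halfPeriod τ i)) = k w := by
      intro i
      by_cases h : p - halfPeriod τ i ∈ lattice τ
      · have hshift : ∀ q, Differentiable ℂ fun w => ϑ (w - q) := fun q =>
          hϑ.differentiable.comp (differentiable_id.sub_const q)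
        obtain ⟨k, hk, hkp, hkw⟩ := exists_analyticAt_eq_sub_mul
          ((hshift (halfPeriod τ i)).analyticAt p) (hϑ.eq_zero_of_mem h)
        have hkp0 : k p ≠ 0 := by
          rw [hkp, deriv_comp_sub_const]
          exact hϑ.deriv_ne_zero h
        refine ⟨fun w => ϑ (w - halfPeriod τ i - y) / k w, ?_, ?_⟩
        · refine AnalyticAt.div ?_ hk hkp0
          simp only [sub_sub]
          exact (hshift _).analyticAt p
        · filter_upwards [self_mem_nhdsWithin] with w hw
          have : w - p ≠ 0 := sub_ne_zero.2 hw
          rw [hkw]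
          field_simp
      · refine ⟨_, AnalyticAt.mul ?_ (han i p h), Eventually.of_forall fun w => rfl⟩
        fun_prop
    choose k hk hkw using hi
    refine ⟨fun w => ∑ i, c i * (expConj s (-s) (-halfPeriod τ i) * k i w), ?_, ?_⟩
    · refine Finset.univ.analyticAt_fun_sum fun i _ => ?_
      exact analyticAt_const.mul (analyticAt_const.mul (hk i))
    · filter_upwards [eventually_all.2 hkw] with w hw
      rw [Finset.mul_sum]
      refine Finset.sum_congr rfl fun i _ => ?_
      rw [← hw]
      ring

theorem tendsto_sum_tFun (hϑ : IsShiftedTheta τ ϑ) (y : ℂ) (c : Fin 4 → ℂ) (i : Fin 4) :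
    Tendsto (fun w => (w - halfPeriod τ i) *
      Set.indicator (halfLattice τ)ᶜ (fun w => ∑ i, c i * tFun τ ϑ y (w - halfPeriod τ i)) w)
      (𝓝[≠] (halfPeriod τ i)) (𝓝 (c i * (ϑ (-y) / deriv ϑ 0))) := by
  have hterm : ∀ j, Tendsto (fun w => c j * ((w - halfPeriod τ i) *
      tFun τ ϑ y (w - halfPeriod τ j))) (𝓝[≠] (halfPeriod τ i))
      (𝓝 (if j = i then c j * (ϑ (-y) / deriv ϑ 0) else 0)) := by
    intro j
    have htend := tendsto_add_const_punctured (halfPeriod τ i) (-halfPeriod τ j)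
    simp only [← sub_eq_add_neg] at htend
    split_ifs with h
    · subst h
      rw [sub_self] at htend
      exact ((hϑ.tendsto_mul_tFun y).comp htend).const_mul _
    · rw [← mul_zero (c j)]
      refine Tendsto.const_mul _ ?_
      have hcont : ContinuousAt (fun w => (w - halfPeriod τ i) *
          tFun τ ϑ y (w - halfPeriod τ j)) (halfPeriod τ i) := by
        refine ContinuousAt.mul (by fun_prop) ?_
        have h1 : ContinuousAt (tFun τ ϑ y) (halfPeriod τ i - halfPeriod τ j) := by
          rw [funext (tFun_eq τ ϑ y)]
          exact (continuous_expConj _ _).continuousAt.mul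
            (hϑ.analyticAt_quotient y (halfPeriod_sub_notMem (Ne.symm h))).continuousAt
        exact ContinuousAt.comp (f := fun w => w - halfPeriod τ j) h1 (by fun_prop)
      have h2 := hcont.tendsto.mono_left (nhdsWithin_le_nhds (s := {halfPeriod τ i}ᶜ))
      rwa [sub_self, zero_mul] at h2
  have hsum := tendsto_finsetSum Finset.univ fun j _ => hterm j
  rw [Finset.sum_ite_eq' Finset.univ i, if_pos (Finset.mem_univ i)] at hsum
  refine hsum.congr' ?_
  filter_upwards [eventually_notMem_halfLattice τ (halfPeriod τ i)] with w hw
  rw [Set.indicator_of_mem hw, Finset.mul_sum]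
  exact Finset.sum_congr rfl fun j _ => by ring

theorem residueMap_surjective (hϑ : IsShiftedTheta τ ϑ) {y : ℂ} (hy : y ∉ lattice τ) :
    Function.Surjective
      (residueMap τ (2 * Real.pi * Complex.I / (starRingEnd ℂ (τ : ℂ) - τ) * y)) := by
  intro r
  have h0 : ϑ (-y) / deriv ϑ 0 ≠ 0 := by
    refine div_ne_zero (fun h => hy ?_) hϑ.deriv_zero_ne_zero
    simpa using hϑ.eq_zero_iff.1 h
  refine ⟨⟨_, hϑ.sum_tFun_mem y fun i => r i / (ϑ (-y) / deriv ϑ 0)⟩, funext fun i => ?_⟩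
  have h := hϑ.tendsto_sum_tFun y (fun i => r i / (ϑ (-y) / deriv ϑ 0)) i
  rw [div_mul_cancel₀ _ h0] at h
  exact residueMap_eq _ h

end IsShiftedTheta

/-! ### Residues of Fuchsian systems and Higgs fields -/

namespace FuchsianSystem

variable {ρ : Fin 4 → ℝ} (F : FuchsianSystem ρ)

theorem coeffs_charpoly (i : Fin 4) :
    (F.res i).trace = 0 ∧ (F.res i).det = -(ρ i : ℂ) ^ 2 := by
  have h := F.charpoly_res i
  rw [Matrix.charpoly_fin_two] at h
  have h0 := congrArg (Polynomial.eval 0) h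
  have h1 := congrArg (Polynomial.eval 1) h
  simp at h0 h1
  refine ⟨?_, ?_⟩
  · linear_combination h0 - h1
  · linear_combination h0

theorem exists_eigenvector (i : Fin 4) : ∃ v, v ≠ 0 ∧ F.res i *ᵥ v = (ρ i : ℂ) • v := by
  obtain ⟨htr, hdet⟩ := F.coeffs_charpoly i
  have h : (F.res i - (ρ i : ℂ) • (1 : Matrix (Fin 2) (Fin 2) ℂ)).det = 0 := by
    rw [Matrix.trace_fin_two] at htr
    rw [Matrix.det_fin_two] at hdet ⊢
    simp
    linear_combination hdet - (ρ i : ℂ) * htr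
  obtain ⟨v, hv, hv0⟩ := Matrix.exists_mulVec_eq_zero_iff.2 h
  refine ⟨v, hv, ?_⟩
  rw [Matrix.sub_mulVec, Matrix.smul_mulVec, Matrix.one_mulVec, sub_eq_zero] at hv0
  exact hv0

end FuchsianSystem

/-- The determinant of two vectors of `ℂ²`. -/
def det2 (u v : Fin 2 → ℂ) : ℂ := u 0 * v 1 - u 1 * v 0

theorem det2_smul_smul (z t : ℂ) (u v : Fin 2 → ℂ) : det2 (z • u) (t • v) = z * t * det2 u v := by
  simp [det2]
  ring

theorem exists_smul_of_det2_eq_zero {u v : Fin 2 → ℂ} (hu : u ≠ 0) (h : det2 u v = 0) :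
    ∃ t : ℂ, v = t • u := by
  rw [det2] at h
  by_cases h0 : u 0 = 0
  · have h1 : u 1 ≠ 0 := by
      intro h1
      apply hu
      funext j
      fin_cases j
      exacts [h0, h1]
    refine ⟨v 1 / u 1, funext fun j => ?_⟩
    have hv0 : v 0 = 0 := by simpa [h0, h1] using h
    fin_cases j
    · simp [h0, hv0]
    · simp [h1]
  · refine ⟨v 0 / u 0, funext fun j => ?_⟩
    fin_cases j
    · simp [h0]
    · simp
      field_simp
      linear_combination h

theorem det2_eq_zero_of_mulVec {M : Matrix (Fin 2) (Fin 2) ℂ} (hM : M ≠ 0) {u v : Fin 2 → ℂ}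
    (hu : M *ᵥ u = 0) (hv : M *ᵥ v = 0) : det2 u v = 0 := by
  have hu0 := congrFun hu 0
  have hu1 := congrFun hu 1
  have hv0 := congrFun hv 0
  have hv1 := congrFun hv 1
  simp [Matrix.mulVec, dotProduct, Fin.sum_univ_two] at hu0 hu1 hv0 hv1
  by_contra hd
  apply hM
  rw [det2] at hd
  ext i j
  fin_cases i <;> fin_cases j <;> simp <;> refine (mul_eq_zero.1 ?_).resolve_right hd
  · linear_combination v 1 * hu0 - u 1 * hv0
  · linear_combination u 0 * hv0 - v 0 * hu0
  · linear_combination v 1 * hu1 - u 1 * hv1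
  · linear_combination u 0 * hv1 - v 0 * hu1

/-- Twice the polarization of the determinant of `2 × 2` matrices. -/
def polarDet (M N : Matrix (Fin 2) (Fin 2) ℂ) : ℂ := (M + N).det - M.det - N.det

/-- The quadratic differential `det` of a one-form with nilpotent residues has simple poles, so that
it is a multiple of `dz² / (z (z - 1) (z - m))`. -/
theorem det_formCoeff {R : Fin 4 → Matrix (Fin 2) (Fin 2) ℂ} (hsum : ∑ i, R i = 0)
    (hdet : ∀ i, (R i).det = 0) {m z : ℂ} (h0 : z ≠ 0) (h1 : z ≠ 1) (hm : z ≠ m) :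
    (formCoeff m R z).det * (z * (z - 1) * (z - m)) =
      -(polarDet (R 1) (R 2) * m + polarDet (R 2) (R 3)) := by
  have e1 := hdet 1
  have e2 := hdet 2
  have e3 := hdet 3
  have e0 := hdet 0
  rw [Fin.sum_univ_four] at hsum
  rw [show R 0 = -(R 1 + R 2 + R 3) by
    rw [eq_neg_iff_add_eq_zero, ← hsum]; abel] at e0
  have h1' : z - 1 ≠ 0 := sub_ne_zero.2 h1
  have hm' : z - m ≠ 0 := sub_ne_zero.2 hm
  have hD : (formCoeff m R z).det = (z - 1)⁻¹ * z⁻¹ * polarDet (R 1) (R 2) +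
      (z - 1)⁻¹ * (z - m)⁻¹ * polarDet (R 1) (R 3) + z⁻¹ * (z - m)⁻¹ * polarDet (R 2) (R 3) := by
    simp only [polarDet, formCoeff, Matrix.det_fin_two, Matrix.add_apply,
      Matrix.smul_apply, smul_eq_mul] at e1 e2 e3 ⊢
    linear_combination ((z - 1)⁻¹) ^ 2 * e1 + (z⁻¹) ^ 2 * e2 + ((z - m)⁻¹) ^ 2 * e3
  have hpolar : polarDet (R 1) (R 2) + polarDet (R 1) (R 3) + polarDet (R 2) (R 3) = 0 := by
    simp only [polarDet, Matrix.det_fin_two, Matrix.add_apply, Matrix.neg_apply] at e0 e1 e2 e3 ⊢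
    linear_combination e0 - e1 - e2 - e3
  rw [hD]
  field_simp
  linear_combination z * hpolar

theorem polarDet_eq_zero {R : Fin 4 → Matrix (Fin 2) (Fin 2) ℂ} (hsum : ∑ i, R i = 0)
    (hdet : ∀ i, (R i).det = 0) {i : Fin 4} (hi : R i = 0) :
    polarDet (R 1) (R 2) = 0 ∧ polarDet (R 2) (R 3) = 0 := by
  have e1 := hdet 1
  have e2 := hdet 2
  have e3 := hdet 3
  have e0 := hdet 0
  rw [Fin.sum_univ_four] at hsum
  have hneg : ∀ M : Matrix (Fin 2) (Fin 2) ℂ, (-M).det = M.det := fun M => by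
    simp [Matrix.det_fin_two]
  simp only [polarDet, e1, e2, e3, sub_zero]
  fin_cases i <;> simp at hi <;> simp [hi] at hsum ⊢
  · constructor
    · rw [eq_neg_of_add_eq_zero_left hsum, hneg, e3]
    · rw [add_assoc] at hsum
      rw [eq_neg_of_add_eq_zero_right hsum, hneg, e1]
  · refine ⟨e2, ?_⟩
    rw [add_assoc] at hsum
    rw [eq_neg_of_add_eq_zero_right hsum, hneg, e0]
  · exact ⟨e1, e3⟩
  · refine ⟨?_, e2⟩
    rw [add_assoc] at hsum
    rw [eq_neg_of_add_eq_zero_right hsum, hneg, e0]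

namespace ParabolicHiggsField

variable {ρ : Fin 4 → ℝ} {F : FuchsianSystem ρ} (Ψ : ParabolicHiggsField F)

theorem det_res (i : Fin 4) : (Ψ.res i).det = 0 := by
  obtain ⟨v, hv, h⟩ := F.exists_eigenvector i
  exact Matrix.exists_mulVec_eq_zero_iff.1 ⟨v, hv, Ψ.ker_res i v h⟩

theorem res_ne_zero {Ψ : ParabolicHiggsField F} {m : ℂ} (h : Ψ.DetNeZero m) (i : Fin 4) :
    Ψ.res i ≠ 0 := by
  intro hi
  obtain ⟨z, h0, h1, hm, hz⟩ := h
  have e := det_formCoeff Ψ.sum_res Ψ.det_res h0 h1 hm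
  obtain ⟨p1, p2⟩ := polarDet_eq_zero Ψ.sum_res Ψ.det_res hi
  rw [p1, p2] at e
  simp [h0, sub_ne_zero.2 h1, sub_ne_zero.2 hm, hz] at e

theorem det_formCoeff_ne_zero {Ψ : ParabolicHiggsField F} {m : ℂ} (h : Ψ.DetNeZero m) {z : ℂ}
    (h0 : z ≠ 0) (h1 : z ≠ 1) (hm : z ≠ m) : (formCoeff m Ψ.res z).det ≠ 0 := by
  intro hz
  obtain ⟨z', h0', h1', hm', hz'⟩ := h
  have e := det_formCoeff Ψ.sum_res Ψ.det_res h0 h1 hm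
  have e' := det_formCoeff Ψ.sum_res Ψ.det_res h0' h1' hm'
  rw [hz, zero_mul] at e
  rw [← e] at e'
  simp [h0', sub_ne_zero.2 h1', sub_ne_zero.2 hm', hz'] at e'

/-- The kernel of the residue of the Higgs field is the eigenline of the residue of the system. -/
theorem mulVec_eq_of_ker {Ψ : ParabolicHiggsField F} {m : ℂ} (h : Ψ.DetNeZero m) {i : Fin 4}
    {v : Fin 2 → ℂ} (hv : Ψ.res i *ᵥ v = 0) : F.res i *ᵥ v = (ρ i : ℂ) • v := by
  obtain ⟨u, hu, huF⟩ := F.exists_eigenvector i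
  obtain ⟨t, rfl⟩ := exists_smul_of_det2_eq_zero hu
    (det2_eq_zero_of_mulVec (res_ne_zero h i) (Ψ.ker_res i u huF) hv)
  rw [Matrix.mulVec_smul, huF, smul_comm]

end ParabolicHiggsField

/-! ### Pull-back to the torus -/

/-- The `dw`-coefficient of the pull-back of `dz / (z - z(w_j))`. -/
def pullbackCoeff (τ : UpperHalfPlane) (j : Fin 4) : ℂ → ℂ :=
  logDeriv fun w => wp τ w - wp τ (halfPeriod τ j)

theorem pullbackCoeff_eq (τ : UpperHalfPlane) (j : Fin 4) (w : ℂ) :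
    pullbackCoeff τ j w = deriv (wp τ) w / (wp τ w - wp τ (halfPeriod τ j)) := by
  rw [pullbackCoeff, logDeriv_apply, deriv_sub_const]

theorem deriv_wp_add (τ : UpperHalfPlane) {l : ℂ} (hl : l ∈ lattice τ) (w : ℂ) :
    deriv (wp τ) (w + l) = deriv (wp τ) w := by
  rw [deriv_wp]
  exact (periods τ).derivWeierstrassP_add_coe w ⟨l, hl⟩

theorem deriv_wp_neg (τ : UpperHalfPlane) (w : ℂ) : deriv (wp τ) (-w) = -deriv (wp τ) w := by
  rw [deriv_wp, (periods τ).derivWeierstrassP_neg]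

theorem pullbackCoeff_add (τ : UpperHalfPlane) (j : Fin 4) {l : ℂ} (hl : l ∈ lattice τ) (w : ℂ) :
    pullbackCoeff τ j (w + l) = pullbackCoeff τ j w := by
  rw [pullbackCoeff_eq, pullbackCoeff_eq, deriv_wp_add τ hl, wp_add τ hl]

theorem pullbackCoeff_neg (τ : UpperHalfPlane) (j : Fin 4) (w : ℂ) :
    pullbackCoeff τ j (-w) = -pullbackCoeff τ j w := by
  rw [pullbackCoeff_eq, pullbackCoeff_eq, deriv_wp_neg τ, wp_neg τ, neg_div]

namespace IsShiftedTheta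

variable {τ : UpperHalfPlane} {ϑ : ℂ → ℂ}

theorem wp_one_sub_wp_two_ne_zero (hϑ : IsShiftedTheta τ ϑ) :
    wp τ (halfPeriod τ 1) - wp τ (halfPeriod τ 2) ≠ 0 :=
  hϑ.wp_halfPeriod_ne (by decide) (halfPeriod_notMem (by decide))
    (halfPeriod_sub_notMem (by decide))

theorem pullback_eq (hϑ : IsShiftedTheta τ ϑ) (R : Fin 4 → Matrix (Fin 2) (Fin 2) ℂ) (w : ℂ) :
    pullback τ R w =
      pullbackCoeff τ 1 w • R 1 + pullbackCoeff τ 2 w • R 2 + pullbackCoeff τ 3 w • R 3 := by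
  have hne := hϑ.wp_one_sub_wp_two_ne_zero
  have hd : deriv (cover τ) w =
      deriv (wp τ) w / (wp τ (halfPeriod τ 1) - wp τ (halfPeriod τ 2)) := by
    have : cover τ = fun w => (wp τ w - wp τ (halfPeriod τ 2)) /
      (wp τ (halfPeriod τ 1) - wp τ (halfPeriod τ 2)) := rfl
    rw [this, deriv_div_const, deriv_sub_const]
  have h1 : cover τ w - 1 = (wp τ w - wp τ (halfPeriod τ 1)) /
      (wp τ (halfPeriod τ 1) - wp τ (halfPeriod τ 2)) := by
    rw [cover]
    field_simp
    ring
  have h2 : cover τ w = (wp τ w - wp τ (halfPeriod τ 2)) /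
      (wp τ (halfPeriod τ 1) - wp τ (halfPeriod τ 2)) := rfl
  have h3 : cover τ w - branchPoint τ = (wp τ w - wp τ (halfPeriod τ 3)) /
      (wp τ (halfPeriod τ 1) - wp τ (halfPeriod τ 2)) := by
    rw [branchPoint, cover, cover]
    field_simp
    ring
  have key : ∀ u : ℂ, deriv (wp τ) w / (wp τ (halfPeriod τ 1) - wp τ (halfPeriod τ 2)) *
      (u / (wp τ (halfPeriod τ 1) - wp τ (halfPeriod τ 2)))⁻¹ = deriv (wp τ) w / u := by
    intro u
    rw [inv_div, div_mul_div_cancel₀ hne]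
  rw [pullback, formCoeff, h1, h3, h2, hd, smul_add, smul_add, smul_smul, smul_smul, smul_smul,
    key, key, key, pullbackCoeff_eq, pullbackCoeff_eq, pullbackCoeff_eq]

theorem pullback_add (hϑ : IsShiftedTheta τ ϑ) (R : Fin 4 → Matrix (Fin 2) (Fin 2) ℂ) {l : ℂ}
    (hl : l ∈ lattice τ) (w : ℂ) : pullback τ R (w + l) = pullback τ R w := by
  simp only [hϑ.pullback_eq, pullbackCoeff_add τ _ hl]

theorem pullback_neg (hϑ : IsShiftedTheta τ ϑ) (R : Fin 4 → Matrix (Fin 2) (Fin 2) ℂ) (w : ℂ) :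
    pullback τ R (-w) = -pullback τ R w := by
  simp only [hϑ.pullback_eq, pullbackCoeff_neg, neg_smul]
  abel

theorem analyticAt_pullbackCoeff (hϑ : IsShiftedTheta τ ϑ) {j : Fin 4} (hj : j ≠ 0) {p : ℂ}
    (hp : p ∉ halfLattice τ) : AnalyticAt ℂ (pullbackCoeff τ j) p := by
  have hpΓ : p ∉ lattice τ := fun h => hp (lattice_subset_halfLattice h)
  rw [funext (pullbackCoeff_eq τ j)]
  refine (analyticAt_wp hpΓ).deriv.div ((analyticAt_wp hpΓ).sub analyticAt_const) ?_
  refine hϑ.wp_halfPeriod_ne hj hpΓ fun h =>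
    hp (mem_halfLattice_of_sub_halfPeriod_mem h)

theorem analyticAt_pullback (hϑ : IsShiftedTheta τ ϑ) (R : Fin 4 → Matrix (Fin 2) (Fin 2) ℂ)
    {p : ℂ} (hp : p ∉ halfLattice τ) (a b : Fin 2) :
    AnalyticAt ℂ (fun w => pullback τ R w a b) p := by
  have h1 := hϑ.analyticAt_pullbackCoeff (j := 1) (by decide) hp
  have h2 := hϑ.analyticAt_pullbackCoeff (j := 2) (by decide) hp
  have h3 := hϑ.analyticAt_pullbackCoeff (j := 3) (by decide) hp
  simp only [hϑ.pullback_eq, Matrix.add_apply, Matrix.smul_apply, smul_eq_mul]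
  exact ((h1.mul analyticAt_const).add (h2.mul analyticAt_const)).add (h3.mul analyticAt_const)

/-- Over a branch point the pull-back has a simple pole with twice the residue, because the cover is
branched of order two. -/
theorem exists_sub_mul_pullback (hϑ : IsShiftedTheta τ ϑ) {R : Fin 4 → Matrix (Fin 2) (Fin 2) ℂ}
    (hR : ∑ i, R i = 0) {i : Fin 4} {p : ℂ} (hp : p - halfPeriod τ i ∈ lattice τ) :
    ∃ K : ℂ → Matrix (Fin 2) (Fin 2) ℂ, (∀ a b, AnalyticAt ℂ (fun w => K w a b) p) ∧
      K p = (2 : ℂ) • R i ∧ ∀ᶠ w in 𝓝[≠] p, (w - p) • pullback τ R w = K w := by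
  have hloc : ∀ j : Fin 4, j ≠ 0 → ∃ k : ℂ → ℂ, AnalyticAt ℂ k p ∧
      k p = (if i = j then 2 else if i = 0 then -2 else 0 : ℤ) ∧
      ∀ᶠ w in 𝓝[≠] p, (w - p) * pullbackCoeff τ j w = k w := fun j hj =>
    exists_sub_mul_logDeriv
      (((periods τ).meromorphic_weierstrassP p).sub (MeromorphicAt.const _ _))
      (hϑ.meromorphicOrderAt_wp_sub hj hp)
  obtain ⟨k₁, h1, h1p, h1w⟩ := hloc 1 (by decide)
  obtain ⟨k₂, h2, h2p, h2w⟩ := hloc 2 (by decide)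
  obtain ⟨k₃, h3, h3p, h3w⟩ := hloc 3 (by decide)
  refine ⟨fun w => k₁ w • R 1 + k₂ w • R 2 + k₃ w • R 3, fun a b => ?_, ?_, ?_⟩
  · simp only [Matrix.add_apply, Matrix.smul_apply, smul_eq_mul]
    exact ((h1.mul analyticAt_const).add (h2.mul analyticAt_const)).add (h3.mul analyticAt_const)
  · simp only [h1p, h2p, h3p]
    rw [Fin.sum_univ_four] at hR
    fin_cases i <;> simp
    rw [show R 0 = -(R 1 + R 2 + R 3) by
      rw [eq_neg_iff_add_eq_zero, ← hR]; abel]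
    module
  · filter_upwards [h1w, h2w, h3w] with w e1 e2 e3
    rw [hϑ.pullback_eq, smul_add, smul_add, smul_smul, smul_smul, smul_smul, e1, e2, e3]

/-- The pull-back of a generically non-degenerate Higgs field is non-degenerate away from the branch
points. -/
theorem det_pullback_ne_zero (hϑ : IsShiftedTheta τ ϑ) {ρ : Fin 4 → ℝ} {F : FuchsianSystem ρ}
    {Ψ : ParabolicHiggsField F} (hΨ : Ψ.DetNeZero (branchPoint τ)) {w : ℂ}
    (hw : w ∉ halfLattice τ) : (pullback τ Ψ.res w).det ≠ 0 := by
  have hne := hϑ.wp_one_sub_wp_two_ne_zero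
  have hwΓ : w ∉ lattice τ := fun h => hw (lattice_subset_halfLattice h)
  have hcover : ∀ j : Fin 4, j ≠ 0 → cover τ w ≠ cover τ (halfPeriod τ j) := by
    intro j hj h
    rw [cover, cover, div_left_inj' hne, sub_left_inj, ← sub_eq_zero] at h
    refine hϑ.wp_halfPeriod_ne hj hwΓ (fun h => hw (mem_halfLattice_of_sub_halfPeriod_mem h)) h
  have h1 : cover τ (halfPeriod τ 1) = 1 := by rw [cover, div_self hne]
  have h2 : cover τ (halfPeriod τ 2) = 0 := by rw [cover, sub_self, zero_div]
  have hd : deriv (cover τ) w ≠ 0 := by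
    have : cover τ = fun w => (wp τ w - wp τ (halfPeriod τ 2)) /
      (wp τ (halfPeriod τ 1) - wp τ (halfPeriod τ 2)) := rfl
    rw [this, deriv_div_const, deriv_sub_const]
    exact div_ne_zero (hϑ.deriv_wp_ne_zero hw) hne
  rw [pullback, Matrix.det_smul]
  refine mul_ne_zero (pow_ne_zero _ hd)
    (ParabolicHiggsField.det_formCoeff_ne_zero hΨ ?_ ?_ (hcover 3 (by decide)))
  · rw [← h2]
    exact hcover 2 (by decide)
  · rw [← h1]
    exact hcover 1 (by decide)

end IsShiftedTheta

/-! ### Local computations at a branch point -/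

/-- The componentwise complex derivative. -/
def vderiv (G : ℂ → Fin 2 → ℂ) (w : ℂ) : Fin 2 → ℂ := fun j => deriv (fun w => G w j) w

theorem analyticAt_det2 {u v : ℂ → Fin 2 → ℂ} {p : ℂ} (hu : ∀ j, AnalyticAt ℂ (fun w => u w j) p)
    (hv : ∀ j, AnalyticAt ℂ (fun w => v w j) p) : AnalyticAt ℂ (fun w => det2 (u w) (v w)) p :=
  ((hu 0).mul (hv 1)).sub ((hu 1).mul (hv 0))

theorem analyticAt_mulVec {Q : ℂ → Matrix (Fin 2) (Fin 2) ℂ} {G : ℂ → Fin 2 → ℂ} {p : ℂ}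
    (hQ : ∀ a b, AnalyticAt ℂ (fun w => Q w a b) p) (hG : ∀ j, AnalyticAt ℂ (fun w => G w j) p)
    (a : Fin 2) : AnalyticAt ℂ (fun w => (Q w *ᵥ G w) a) p := by
  simp only [Matrix.mulVec, dotProduct, Fin.sum_univ_two]
  exact ((hQ a 0).mul (hG 0)).add ((hQ a 1).mul (hG 1))

theorem deriv_eq_zero_of_symmetric {f : ℂ → ℂ} {p : ℂ} (hf : AnalyticAt ℂ f p)
    (h : ∀ᶠ w in 𝓝[≠] p, f (2 * p - w) = f w) : deriv f p = 0 := by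
  have h1 : (fun w => f (2 * p - w)) =ᶠ[𝓝 p] f := by
    filter_upwards [eventually_nhdsWithin_iff.1 h] with w hw
    by_cases hwp : w = p
    · rw [hwp, two_mul, add_sub_cancel_right]
    · exact hw hwp
  have h2 : HasDerivAt f (deriv f p) (2 * p - p) := by
    rw [two_mul, add_sub_cancel_right]
    exact hf.differentiableAt.hasDerivAt
  have h3 := h2.comp_const_sub (2 * p) p
  have h4 := h3.unique (hf.differentiableAt.hasDerivAt.congr_of_eventuallyEq h1)
  have h5 : (2 : ℂ) * deriv f p = 0 := by linear_combination -h4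
  simpa using h5

theorem analyticAt_reflect {f : ℂ → ℂ} {p : ℂ} (hf : AnalyticAt ℂ f p) :
    AnalyticAt ℂ (fun w => f (2 * p - w)) p := by
  refine AnalyticAt.comp (f := fun w => 2 * p - w) ?_ (by fun_prop)
  rwa [two_mul, add_sub_cancel_right]

theorem deriv_det2_reflect {G : ℂ → Fin 2 → ℂ} {p : ℂ}
    (hG : ∀ j, AnalyticAt ℂ (fun w => G w j) p) (c : ℂ) :
    deriv (fun w => det2 (G w) (c • G (2 * p - w))) p = -2 * c * det2 (G p) (vderiv G p) := by
  have h1 := fun j => (hG j).differentiableAt.hasDerivAt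
  have h2 : ∀ j, HasDerivAt (fun w => c * G (2 * p - w) j) (c * -vderiv G p j) p := by
    intro j
    have h3 : HasDerivAt (fun w => G w j) (vderiv G p j) (2 * p - p) := by
      rw [two_mul, add_sub_cancel_right]
      exact h1 j
    exact (h3.comp_const_sub (2 * p) p).const_mul c
  have h := ((h1 0).mul (h2 1)).sub ((h1 1).mul (h2 0))
  refine (h.congr_deriv ?_).deriv
  simp only [det2, two_mul p, add_sub_cancel_right]
  change vderiv G p 0 * _ + _ - (vderiv G p 1 * _ + _) = _
  ring

/-- The second fundamental form at a branch point, up to normalization: here `r` is the eigenvalue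
of the residue `Q p` on the eigenline, and `-1 - r` is the other eigenvalue. -/
theorem deriv_det2_connection {G : ℂ → Fin 2 → ℂ} {Q : ℂ → Matrix (Fin 2) (Fin 2) ℂ} {p r : ℂ}
    (hG : ∀ j, AnalyticAt ℂ (fun w => G w j) p) (hQ : ∀ a b, AnalyticAt ℂ (fun w => Q w a b) p)
    (hQ' : ∀ a b, deriv (fun w => Q w a b) p = 0) (hr : Q p *ᵥ G p = r • G p)
    (htr : (Q p).trace = -1) :
    deriv (fun w => det2 (G w) ((w - p) • vderiv G w + Q w *ᵥ G w)) p =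
      -2 * r * det2 (G p) (vderiv G p) := by
  have h1 := fun j => (hG j).differentiableAt.hasDerivAt
  have h2 : ∀ a b, HasDerivAt (fun w => Q w a b) 0 p := by
    intro a b
    rw [← hQ' a b]
    exact (hQ a b).differentiableAt.hasDerivAt
  have h3 : ∀ j, HasDerivAt (fun w => vderiv G w j) (deriv (fun w => vderiv G w j) p) p :=
    fun j => ((hG j).deriv.differentiableAt).hasDerivAt
  have h4 : ∀ j, HasDerivAt (fun w => (w - p) * vderiv G w j + (Q w j 0 * G w 0 + Q w j 1 * G w 1))
      (vderiv G p j + (Q p j 0 * vderiv G p 0 + Q p j 1 * vderiv G p 1)) p := by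
    intro j
    have := (((hasDerivAt_id p).sub_const p).mul (h3 j)).add
      (((h2 j 0).mul (h1 0)).add ((h2 j 1).mul (h1 1)))
    refine this.congr_deriv ?_
    simp [vderiv]
  have h := ((h1 0).mul (h4 1)).sub ((h1 1).mul (h4 0))
  have heq : (fun w => det2 (G w) ((w - p) • vderiv G w + Q w *ᵥ G w)) = fun w =>
      G w 0 * ((w - p) * vderiv G w 1 + (Q w 1 0 * G w 0 + Q w 1 1 * G w 1)) -
      G w 1 * ((w - p) * vderiv G w 0 + (Q w 0 0 * G w 0 + Q w 0 1 * G w 1)) := by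
    funext w
    simp [det2]
  rw [heq]
  refine (h.congr_deriv ?_).deriv
  have r0 := congrFun hr 0
  have r1 := congrFun hr 1
  simp only [Matrix.mulVec, dotProduct, Fin.sum_univ_two, Pi.smul_apply, smul_eq_mul] at r0 r1
  rw [Matrix.trace_fin_two] at htr
  change vderiv G p 0 * _ + _ - (vderiv G p 1 * _ + _) = _
  simp only [det2, sub_self, zero_mul, zero_add]
  linear_combination (2 * vderiv G p 0) * r1 - (2 * vderiv G p 1) * r0 +
    (G p 0 * vderiv G p 1 - G p 1 * vderiv G p 0) * htr

/-! ### Holomorphic frames of the eigenline bundles -/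

/-- The unitary character `exp (s w̄ - s̄ w)`. Multiplication by it turns sections of
`L(∂̄ + s dw̄)`, which are solutions of `∂f/∂w̄ + s f = 0`, into holomorphic functions
with unitary multipliers. -/
def unitaryChar (s w : ℂ) : ℂ := expConj (-(starRingEnd ℂ s)) s w

theorem unitaryChar_add (s w l : ℂ) :
    unitaryChar s (w + l) = unitaryChar s w * unitaryChar s l :=
  expConj_add _ _ _ _

theorem unitaryChar_ne_zero (s w : ℂ) : unitaryChar s w ≠ 0 := expConj_ne_zero _ _ _

theorem unitaryChar_neg_mul (s w : ℂ) : unitaryChar s (-w) * unitaryChar s w = 1 :=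
  expConj_neg_mul _ _ _

theorem unitaryChar_neg_left (s w : ℂ) : unitaryChar (-s) w = unitaryChar s (-w) := by
  rw [unitaryChar, unitaryChar, map_neg, expConj_neg_neg]

theorem norm_unitaryChar (s w : ℂ) : ‖unitaryChar s w‖ = 1 := norm_expConj s w

open Classical in
/-- The order of the frames `φ^±`: the twist by `S^* = L(2 w₀)` gives a double pole over `w₀`. -/
def leadOrder (τ : UpperHalfPlane) (p : ℂ) : ℤ := if p ∈ lattice τ then -2 else 0

theorem even_leadOrder (τ : UpperHalfPlane) (p : ℂ) : Even (leadOrder τ p) := by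
  rw [leadOrder]
  split_ifs
  exacts [by decide, by decide]

theorem leadOrder_neg (τ : UpperHalfPlane) (p : ℂ) : leadOrder τ (-p) = leadOrder τ p := by
  rw [leadOrder, leadOrder, neg_mem_iff]

/-- The holomorphic counterpart `Φ = exp (ξ w̄ - ξ̄ w) φ` of a twisted frame `φ`. -/
structure IsHolFrame (τ : UpperHalfPlane) (ξ : ℂ) (Φ : ℂ → Fin 2 → ℂ) : Prop where
  add : ∀ l ∈ lattice τ, ∀ w, Φ (w + l) = unitaryChar ξ l • Φ w
  analytic : ∀ p ∉ lattice τ, ∀ j, AnalyticAt ℂ (fun w => Φ w j) p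
  factor : ∀ p, ∃ G : ℂ → Fin 2 → ℂ, (∀ j, AnalyticAt ℂ (fun w => G w j) p) ∧ G p ≠ 0 ∧
    ∀ᶠ w in 𝓝[≠] p, Φ w = (w - p) ^ leadOrder τ p • G w

/-- The frame consists of eigenvectors of the pulled back Higgs field. -/
def IsEigenframe (τ : UpperHalfPlane) {ρ : Fin 4 → ℝ} {F : FuchsianSystem ρ}
    (Ψ : ParabolicHiggsField F) (μ : ℂ) (Φ : ℂ → Fin 2 → ℂ) : Prop :=
  ∀ w ∉ halfLattice τ, pullback τ Ψ.res w *ᵥ Φ w = μ • Φ w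

theorem neg_mem_halfLattice_iff {τ : UpperHalfPlane} {w : ℂ} :
    -w ∈ halfLattice τ ↔ w ∈ halfLattice τ := by
  change 2 * -w ∈ lattice τ ↔ 2 * w ∈ lattice τ
  rw [mul_neg, neg_mem_iff]

variable {τ : UpperHalfPlane}

theorem IsHolFrame.reflect {ξ : ℂ} {Φ : ℂ → Fin 2 → ℂ} (h : IsHolFrame τ ξ Φ) :
    IsHolFrame τ (-ξ) fun w => Φ (-w) := by
  refine ⟨fun l hl w => ?_, fun p hp j => ?_, fun p => ?_⟩
  · rw [neg_add, h.add _ (neg_mem hl), unitaryChar_neg_left]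
  · have := h.analytic (-p) (by simpa using hp) j
    exact this.comp (f := fun w => -w) (by fun_prop)
  · obtain ⟨G, hG, hG0, hGw⟩ := h.factor (-p)
    refine ⟨fun w => G (-w), fun j => (hG j).comp (f := fun w => -w) (by fun_prop), hG0, ?_⟩
    have htend := tendsto_const_sub_punctured p 0
    simp only [zero_sub] at htend
    filter_upwards [htend.eventually hGw] with w hw
    rw [hw, leadOrder_neg, show -w - -p = -(w - p) by ring, (even_leadOrder τ p).neg_zpow]

theorem IsShiftedTheta.isEigenframe_reflect {ϑ : ℂ → ℂ} (hϑ : IsShiftedTheta τ ϑ)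
    {ρ : Fin 4 → ℝ} {F : FuchsianSystem ρ} {Ψ : ParabolicHiggsField F} {μ : ℂ}
    {Φ : ℂ → Fin 2 → ℂ} (h : IsEigenframe τ Ψ μ Φ) :
    IsEigenframe τ Ψ (-μ) fun w => Φ (-w) := by
  intro w hw
  have := h (-w) (by rwa [neg_mem_halfLattice_iff])
  rw [hϑ.pullback_neg, Matrix.neg_mulVec] at this
  rw [neg_smul, ← this, neg_neg]

theorem leadOrder_eq {i : Fin 4} {p : ℂ} (hp : p - halfPeriod τ i ∈ lattice τ) :
    leadOrder τ p = if i = 0 then -2 else 0 := by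
  rw [leadOrder]
  by_cases h : i = 0
  · subst h
    rw [halfPeriod_zero, sub_zero] at hp
    simp [hp]
  · rw [if_neg h, if_neg]
    intro h1
    have := sub_mem h1 hp
    rw [sub_sub_cancel] at this
    exact halfPeriod_notMem h this

namespace IsShiftedTheta

variable {ϑ : ℂ → ℂ} {ρ : Fin 4 → ℝ} {F : FuchsianSystem ρ} {Ψ : ParabolicHiggsField F}

theorem exists_deriv_wp_factor (hϑ : IsShiftedTheta τ ϑ) {p : ℂ} (hp : p ∈ halfLattice τ) :
    ∃ g, AnalyticAt ℂ g p ∧ g p ≠ 0 ∧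
      ∀ᶠ w in 𝓝[≠] p, deriv (wp τ) w = (w - p) ^ (2 * leadOrder τ p + 1) * g w := by
  obtain ⟨i, hi⟩ := exists_sub_halfPeriod_mem hp
  have h := (meromorphicOrderAt_eq_int_iff ((periods τ).meromorphic_weierstrassP.deriv p)).1
    (hϑ.meromorphicOrderAt_deriv_wp_of_mem hi)
  rw [leadOrder_eq hi]
  have : (2 * (if i = 0 then -2 else 0) + 1 : ℤ) = if i = 0 then -3 else 1 := by
    split_ifs <;> norm_num
  rw [this]
  exact h

/-- The leading coefficient of an eigenframe at a branch point spans the kernel of the residue. -/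
theorem mulVec_lead_eq_zero (hϑ : IsShiftedTheta τ ϑ) {μ : ℂ} {Φ G : ℂ → Fin 2 → ℂ}
    (hΦ : IsEigenframe τ Ψ μ Φ) {i : Fin 4} {p : ℂ} (hp : p - halfPeriod τ i ∈ lattice τ)
    (hG : ∀ j, AnalyticAt ℂ (fun w => G w j) p)
    (hGw : ∀ᶠ w in 𝓝[≠] p, Φ w = (w - p) ^ leadOrder τ p • G w) : Ψ.res i *ᵥ G p = 0 := by
  obtain ⟨K, hK, hKp, hKw⟩ := hϑ.exists_sub_mul_pullback Ψ.sum_res hp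
  have h : ∀ a, (K p *ᵥ G p) a = 0 := by
    intro a
    have := eq_of_eventuallyEq_punctured (p := p) (F := fun w => (K w *ᵥ G w) a)
      (G := fun w => (w - p) * (μ * G w a)) (analyticAt_mulVec hK hG a).continuousAt
      (((by fun_prop : ContinuousAt (fun w => w - p) p)).mul
        (continuousAt_const.mul (hG a).continuousAt)) ?_
    · simpa using this
    · filter_upwards [hGw, hKw, eventually_notMem_halfLattice τ p, self_mem_nhdsWithin]
        with w h1 h2 h3 h4
      have h5 : (w - p) ^ leadOrder τ p ≠ 0 := zpow_ne_zero _ (sub_ne_zero.2 h4)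
      have h6 := hΦ w h3
      rw [h1, Matrix.mulVec_smul, smul_comm] at h6
      have h7 := congrFun (smul_right_injective _ h5 h6) a
      rw [← h2, Matrix.smul_mulVec, Pi.smul_apply, h7]
      simp
  have h2 : (2 : ℂ) • (Ψ.res i *ᵥ G p) = 0 := by
    rw [← Matrix.smul_mulVec, ← hKp]
    exact funext h
  simpa using h2

/-- The determinant of two eigenframes with inverse multipliers is a multiple of `℘'`. -/
theorem exists_det2_eq (hϑ : IsShiftedTheta τ ϑ) (hΨ : Ψ.DetNeZero (branchPoint τ))
    {ξ μ μ' : ℂ} {Φ Φ' : ℂ → Fin 2 → ℂ} (h : IsHolFrame τ ξ Φ) (h' : IsHolFrame τ (-ξ) Φ')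
    (he : IsEigenframe τ Ψ μ Φ) (he' : IsEigenframe τ Ψ μ' Φ') :
    ∃ d, ∀ w ∉ halfLattice τ, det2 (Φ w) (Φ' w) = d * deriv (wp τ) w := by
  have hloc : ∀ p ∉ halfLattice τ,
      AnalyticAt ℂ (fun w => det2 (Φ w) (Φ' w) / deriv (wp τ) w) p := by
    intro p hp
    have hpΓ : p ∉ lattice τ := fun h => hp (lattice_subset_halfLattice h)
    exact (analyticAt_det2 (h.analytic p hpΓ) (h'.analytic p hpΓ)).div (analyticAt_wp hpΓ).deriv
      (hϑ.deriv_wp_ne_zero hp)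
  obtain ⟨d, hd⟩ := eventuallyEq_const_of_norm_periodic τ
    (f := fun w => det2 (Φ w) (Φ' w) / deriv (wp τ) w)
    (fun l hl w => by
      rw [h.add l hl, h'.add l hl, deriv_wp_add τ hl, norm_div, norm_div]
      congr 1
      rw [show det2 (unitaryChar ξ l • Φ w) (unitaryChar (-ξ) l • Φ' w) =
        unitaryChar ξ l * unitaryChar (-ξ) l * det2 (Φ w) (Φ' w) by simp [det2]; ring,
        norm_mul, norm_mul, norm_unitaryChar, norm_unitaryChar]
      simp)
    (fun p => by
      by_cases hp : p ∈ halfLattice τ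
      · obtain ⟨i, hi⟩ := exists_sub_halfPeriod_mem hp
        obtain ⟨G, hG, hG0, hGw⟩ := h.factor p
        obtain ⟨G', hG', hG0', hGw'⟩ := h'.factor p
        obtain ⟨g, hg, hg0, hgw⟩ := hϑ.exists_deriv_wp_factor hp
        have hdet : det2 (G p) (G' p) = 0 :=
          det2_eq_zero_of_mulVec (ParabolicHiggsField.res_ne_zero hΨ i)
            (hϑ.mulVec_lead_eq_zero he hi hG hGw) (hϑ.mulVec_lead_eq_zero he' hi hG' hGw')
        obtain ⟨k, hk, -, hkw⟩ := exists_analyticAt_eq_sub_mul (analyticAt_det2 hG hG') hdet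
        refine ⟨fun w => k w / g w, hk.div hg hg0, ?_⟩
        filter_upwards [hGw, hGw', hgw, self_mem_nhdsWithin] with w h1 h2 h3 h4
        have h5 : w - p ≠ 0 := sub_ne_zero.2 h4
        have h6 : (w - p) ^ leadOrder τ p ≠ 0 := zpow_ne_zero _ h5
        have h7 : det2 (Φ w) (Φ' w) = (w - p) ^ (2 * leadOrder τ p + 1) * k w := by
          have := hkw w
          rw [det2] at this
          rw [h1, h2, zpow_add_one₀ h5, two_mul, zpow_add₀ h5]
          simp only [det2, Pi.smul_apply, smul_eq_mul]
          linear_combination (w - p) ^ leadOrder τ p * (w - p) ^ leadOrder τ p * this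
        rw [h7, h3, mul_div_mul_left _ _ (zpow_ne_zero _ h5)]
      · exact ⟨_, hloc p hp, EventuallyEq.rfl⟩)
  refine ⟨d, fun w hw => ?_⟩
  rw [← div_eq_iff (hϑ.deriv_wp_ne_zero hw)]
  exact eq_of_eventuallyEq_punctured (hloc w hw).continuousAt continuousAt_const (hd w)

end IsShiftedTheta

/-! ### The connection in a holomorphic frame -/

/-- The `dw`-coefficient of `∇̂ (Φ ⊗ s)` for the holomorphic counterpart `Φ` of a twisted frame; the
last summand is the contribution of `∇^s`. -/
def holNabla (τ : UpperHalfPlane) {ρ : Fin 4 → ℝ} (F : FuchsianSystem ρ) (Φ : ℂ → Fin 2 → ℂ)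
    (w : ℂ) : Fin 2 → ℂ :=
  vderiv Φ w + pullback τ F.res w *ᵥ Φ w - (1 / 2 * logDeriv (deriv (wp τ)) w) • Φ w

theorem logDeriv_deriv_wp_add (τ : UpperHalfPlane) {l : ℂ} (hl : l ∈ lattice τ) (w : ℂ) :
    logDeriv (deriv (wp τ)) (w + l) = logDeriv (deriv (wp τ)) w := by
  rw [logDeriv_apply, logDeriv_apply, deriv_wp_add τ hl, ← deriv_comp_add_const]
  simp only [deriv_wp_add τ hl]

theorem logDeriv_deriv_wp_neg (τ : UpperHalfPlane) (w : ℂ) :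
    logDeriv (deriv (wp τ)) (-w) = -logDeriv (deriv (wp τ)) w := by
  have h := deriv_comp_neg (deriv (wp τ)) w
  simp only [deriv_wp_neg τ, deriv.fun_neg] at h
  rw [logDeriv_apply, logDeriv_apply, deriv_wp_neg τ, div_neg, ← neg_inj.1 h]

theorem vderiv_neg (Φ : ℂ → Fin 2 → ℂ) (w : ℂ) :
    vderiv (fun w => Φ (-w)) w = -vderiv Φ (-w) :=
  funext fun j => deriv_comp_neg (fun w => Φ w j) w

theorem IsHolFrame.apply_ne_zero {ξ : ℂ} {Φ : ℂ → Fin 2 → ℂ} (h : IsHolFrame τ ξ Φ) {p : ℂ}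
    (hp : p ∉ lattice τ) : Φ p ≠ 0 := by
  obtain ⟨G, hG, hG0, hGw⟩ := h.factor p
  rw [leadOrder, if_neg hp] at hGw
  convert hG0 using 1
  funext j
  refine eq_of_eventuallyEq_punctured (h.analytic p hp j).continuousAt (hG j).continuousAt ?_
  filter_upwards [hGw] with w hw
  rw [hw, zpow_zero, one_smul]

namespace IsShiftedTheta

variable {ϑ : ℂ → ℂ} {ρ : Fin 4 → ℝ} {F : FuchsianSystem ρ} {Ψ : ParabolicHiggsField F}

theorem holNabla_add (hϑ : IsShiftedTheta τ ϑ) {ξ : ℂ} {Φ : ℂ → Fin 2 → ℂ}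
    (h : IsHolFrame τ ξ Φ) {l : ℂ} (hl : l ∈ lattice τ) (w : ℂ) :
    holNabla τ F Φ (w + l) = unitaryChar ξ l • holNabla τ F Φ w := by
  have hv : vderiv Φ (w + l) = unitaryChar ξ l • vderiv Φ w := by
    funext j
    rw [vderiv, ← deriv_comp_add_const]
    simp only [h.add l hl, Pi.smul_apply, smul_eq_mul, vderiv]
    rw [deriv_const_mul_field]
  rw [holNabla, holNabla, hv, hϑ.pullback_add _ hl, logDeriv_deriv_wp_add τ hl, h.add l hl,
    Matrix.mulVec_smul]
  module

theorem holNabla_reflect (hϑ : IsShiftedTheta τ ϑ) (Φ : ℂ → Fin 2 → ℂ) (w : ℂ) :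
    holNabla τ F (fun w => Φ (-w)) w = -holNabla τ F Φ (-w) := by
  rw [holNabla, holNabla, vderiv_neg, hϑ.pullback_neg, logDeriv_deriv_wp_neg, Matrix.neg_mulVec]
  module

theorem analyticAt_holNabla (hϑ : IsShiftedTheta τ ϑ) {ξ : ℂ} {Φ : ℂ → Fin 2 → ℂ}
    (h : IsHolFrame τ ξ Φ) {p : ℂ} (hp : p ∉ halfLattice τ) (j : Fin 2) :
    AnalyticAt ℂ (fun w => holNabla τ F Φ w j) p := by
  have hpΓ : p ∉ lattice τ := fun h => hp (lattice_subset_halfLattice h)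
  have hwp := (analyticAt_wp hpΓ).deriv
  exact ((h.analytic p hpΓ j).deriv.add
    (analyticAt_mulVec (hϑ.analyticAt_pullback F.res hp) (h.analytic p hpΓ) j)).sub
    ((analyticAt_const.mul (hwp.deriv.div hwp (hϑ.deriv_wp_ne_zero hp))).mul
      (h.analytic p hpΓ j))

theorem eigenvalue_ne_zero (hϑ : IsShiftedTheta τ ϑ) (hΨ : Ψ.DetNeZero (branchPoint τ))
    {ξ μ : ℂ} {Φ : ℂ → Fin 2 → ℂ} (h : IsHolFrame τ ξ Φ) (he : IsEigenframe τ Ψ μ Φ) : μ ≠ 0 := by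
  rintro rfl
  obtain ⟨w, hw⟩ := (eventually_notMem_halfLattice τ 0).exists
  have h1 := he w hw
  rw [zero_smul] at h1
  exact hϑ.det_pullback_ne_zero hΨ hw (Matrix.exists_mulVec_eq_zero_iff.1
    ⟨_, h.apply_ne_zero fun h => hw (lattice_subset_halfLattice h), h1⟩)

/-- The two eigenlines are transversal away from the branch points. -/
theorem det2_ne_zero (hϑ : IsShiftedTheta τ ϑ) (hΨ : Ψ.DetNeZero (branchPoint τ))
    {ξ ξ' μ : ℂ} {Φ Φ' : ℂ → Fin 2 → ℂ} (h : IsHolFrame τ ξ Φ) (h' : IsHolFrame τ ξ' Φ')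
    (he : IsEigenframe τ Ψ μ Φ) (he' : IsEigenframe τ Ψ (-μ) Φ') {w : ℂ}
    (hw : w ∉ halfLattice τ) : det2 (Φ w) (Φ' w) ≠ 0 := by
  have hwΓ : w ∉ lattice τ := fun h => hw (lattice_subset_halfLattice h)
  intro hd
  have hne := h.apply_ne_zero hwΓ
  obtain ⟨t, ht⟩ := exists_smul_of_det2_eq_zero hne hd
  have h1 := he' w hw
  rw [ht, Matrix.mulVec_smul, he w hw, ← sub_eq_zero] at h1
  have h2 : (2 * t * μ) • Φ w = 0 := by
    rw [← h1]
    module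
  have ht0 : t ≠ 0 := by
    rintro rfl
    exact h'.apply_ne_zero hwΓ (by rw [ht, zero_smul])
  exact hϑ.eigenvalue_ne_zero hΨ h he (by simpa [hne, ht0] using h2)

theorem exists_det2_eq_ne_zero (hϑ : IsShiftedTheta τ ϑ) (hΨ : Ψ.DetNeZero (branchPoint τ))
    {ξ μ : ℂ} {Φ Φ' : ℂ → Fin 2 → ℂ} (h : IsHolFrame τ ξ Φ) (h' : IsHolFrame τ (-ξ) Φ')
    (he : IsEigenframe τ Ψ μ Φ) (he' : IsEigenframe τ Ψ (-μ) Φ') :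
    ∃ d, d ≠ 0 ∧ ∀ w ∉ halfLattice τ, det2 (Φ w) (Φ' w) = d * deriv (wp τ) w := by
  obtain ⟨d, hd⟩ := hϑ.exists_det2_eq hΨ h h' he he'
  refine ⟨d, ?_, hd⟩
  rintro rfl
  obtain ⟨w, hw⟩ := (eventually_notMem_halfLattice τ 0).exists
  exact hϑ.det2_ne_zero hΨ h h' he he' hw (by rw [hd w hw, zero_mul])

/-- The connection `∇̂` induces on `Λ² (E ⊕ E^*)`, in which `det2 (Φ w) (Φ (-w))` is a multiple of
`℘'`, the connection that annihilates `℘'`. Hence the two diagonal entries are opposite. -/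
theorem det2_holNabla_neg (hϑ : IsShiftedTheta τ ϑ) {ξ d : ℂ} {Φ : ℂ → Fin 2 → ℂ}
    (h : IsHolFrame τ ξ Φ)
    (hd : ∀ w ∉ halfLattice τ, det2 (Φ w) (Φ (-w)) = d * deriv (wp τ) w) {w : ℂ}
    (hw : w ∉ halfLattice τ) :
    det2 (holNabla τ F Φ (-w)) (Φ w) = -det2 (holNabla τ F Φ w) (Φ (-w)) := by
  have hwΓ : w ∉ lattice τ := fun h => hw (lattice_subset_halfLattice h)
  have hne := hϑ.deriv_wp_ne_zero hw
  have h1 := fun j => (h.analytic w hwΓ j).differentiableAt.hasDerivAt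
  have h2 := fun j => (h.reflect.analytic w hwΓ j).differentiableAt.hasDerivAt
  have h3 := ((h1 0).mul (h2 1)).sub ((h1 1).mul (h2 0))
  have h4 : (fun w => det2 (Φ w) (Φ (-w))) =ᶠ[𝓝 w] fun w => d * deriv (wp τ) w := by
    filter_upwards [(isClosed_halfLattice τ).isOpen_compl.mem_nhds hw] with u hu using hd u hu
  have h5 := h3.unique
    (((analyticAt_wp hwΓ).deriv.differentiableAt.hasDerivAt.const_mul d).congr_of_eventuallyEq h4)
  have htr : (pullback τ F.res w).trace = 0 := by
    simp only [hϑ.pullback_eq, Matrix.trace_add, Matrix.trace_smul, (F.coeffs_charpoly _).1,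
      smul_zero, add_zero]
  rw [Matrix.trace_fin_two] at htr
  have h6 : logDeriv (deriv (wp τ)) w * (d * deriv (wp τ) w) =
      d * deriv (deriv (wp τ)) w := by
    rw [logDeriv_apply]
    field_simp
  rw [← hd w hw] at h6
  rw [← neg_neg (holNabla τ F Φ (-w)), ← hϑ.holNabla_reflect]
  simp only [det2, holNabla, Pi.add_apply, Pi.sub_apply, Pi.smul_apply, Pi.neg_apply, smul_eq_mul,
    Matrix.mulVec, dotProduct, Fin.sum_univ_two, vderiv] at h5 h6 ⊢
  linear_combination h5 - h6 + (Φ w 0 * Φ (-w) 1 - Φ w 1 * Φ (-w) 0) * htr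

/-- Near a branch point, with respect to `G = (w - p) ^ (-n) Φ`, the connection is
`(w - p)⁻¹ Q` where `Q` is symmetric about `p`, its residue has trace `-1`, and the leading
coefficient of `Φ` is an eigenvector of the residue. -/
theorem exists_connection_lead (hϑ : IsShiftedTheta τ ϑ) (hΨ : Ψ.DetNeZero (branchPoint τ))
    {μ : ℂ} {Φ G : ℂ → Fin 2 → ℂ} (he : IsEigenframe τ Ψ μ Φ) {i : Fin 4} {p : ℂ}
    (hp : p - halfPeriod τ i ∈ lattice τ) (hG : ∀ j, AnalyticAt ℂ (fun w => G w j) p)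
    (hGw : ∀ᶠ w in 𝓝[≠] p, Φ w = (w - p) ^ leadOrder τ p • G w) :
    ∃ Q : ℂ → Matrix (Fin 2) (Fin 2) ℂ, (∀ a b, AnalyticAt ℂ (fun w => Q w a b) p) ∧
      (∀ a b, deriv (fun w => Q w a b) p = 0) ∧
      Q p *ᵥ G p = (2 * (ρ i : ℂ) - 1 / 2) • G p ∧ (Q p).trace = -1 ∧
      ∀ᶠ w in 𝓝[≠] p, (w - p) • holNabla τ F Φ w =
        (w - p) ^ leadOrder τ p • ((w - p) • vderiv G w + Q w *ᵥ G w) := by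
  have h2p : 2 * p ∈ lattice τ := mem_halfLattice_of_sub_halfPeriod_mem hp
  obtain ⟨K, hK, hKp, hKw⟩ := hϑ.exists_sub_mul_pullback F.sum_res hp
  obtain ⟨k, hk, hkp, hkw⟩ := exists_sub_mul_logDeriv
    ((periods τ).meromorphic_weierstrassP.deriv p) (hϑ.meromorphicOrderAt_deriv_wp_of_mem hp)
  have hkp' : k p = 2 * (leadOrder τ p : ℂ) + 1 := by
    rw [hkp, leadOrder_eq hp]
    split_ifs <;> norm_num
  have hrefl : Tendsto (fun w => 2 * p - w) (𝓝[≠] p) (𝓝[≠] p) := by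
    have := tendsto_const_sub_punctured p (2 * p)
    rwa [show 2 * p - p = p by ring] at this
  have hker := hϑ.mulVec_lead_eq_zero he hp hG hGw
  refine ⟨fun w => K w + ((leadOrder τ p : ℂ) - 1 / 2 * k w) • 1, fun a b => ?_, fun a b => ?_,
    ?_, ?_, ?_⟩
  · exact (hK a b).add ((analyticAt_const.sub (analyticAt_const.mul hk)).mul analyticAt_const)
  · refine deriv_eq_zero_of_symmetric
      ((hK a b).add ((analyticAt_const.sub (analyticAt_const.mul hk)).mul analyticAt_const)) ?_
    filter_upwards [hKw, hkw, hrefl.eventually hKw, hrefl.eventually hkw] with w h1 h2 h3 h4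
    have e1 : K (2 * p - w) = K w := by
      rw [← h3, ← h1, show 2 * p - w = -w + 2 * p by ring, hϑ.pullback_add _ h2p,
        hϑ.pullback_neg]
      module
    have e2 : k (2 * p - w) = k w := by
      rw [← h4, ← h2, show 2 * p - w = -w + 2 * p by ring]
      change (-w + 2 * p - p) * logDeriv (deriv (wp τ)) (-w + 2 * p) =
        (w - p) * logDeriv (deriv (wp τ)) w
      rw [logDeriv_deriv_wp_add τ h2p, logDeriv_deriv_wp_neg]
      ring
    rw [e1, e2]
  · rw [Matrix.add_mulVec, Matrix.smul_mulVec, Matrix.one_mulVec, hKp, Matrix.smul_mulVec,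
      ParabolicHiggsField.mulVec_eq_of_ker hΨ hker, hkp']
    module
  · rw [Matrix.trace_add, Matrix.trace_smul, hKp, Matrix.trace_smul, (F.coeffs_charpoly i).1,
      Matrix.trace_one, hkp']
    simp
    ring
  · filter_upwards [hKw, hkw, eventually_eventually_nhdsWithin.2 hGw, self_mem_nhdsWithin,
      eventually_all.2 fun j => (hG j).eventually_analyticAt.filter_mono nhdsWithin_le_nhds]
      with w h1 h2 h3 h4 h5
    have h6 : w - p ≠ 0 := sub_ne_zero.2 h4
    have hv : (w - p) • vderiv Φ w = (w - p) ^ leadOrder τ p •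
        ((leadOrder τ p : ℂ) • G w + (w - p) • vderiv G w) := by
      rw [isOpen_compl_singleton.nhdsWithin_eq h4] at h3
      funext j
      have e1 : HasDerivAt (fun w => (w - p) ^ leadOrder τ p)
          (leadOrder τ p * (w - p) ^ (leadOrder τ p - 1)) w :=
        (hasDerivAt_zpow (leadOrder τ p) (w - p) (Or.inl h6)).comp_sub_const w p
      have e2 := (e1.mul (h5 j).differentiableAt.hasDerivAt).congr_of_eventuallyEq
        (f₁ := fun w => Φ w j) (by
          filter_upwards [h3] with u hu
          simp [hu])
      simp only [Pi.smul_apply, Pi.add_apply, smul_eq_mul, vderiv, e2.deriv]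
      rw [zpow_sub_one₀ h6]
      field_simp
    rw [holNabla, smul_sub, smul_add, hv, ← Matrix.smul_mulVec, h1, smul_smul, mul_left_comm]
    rw [show (w - p) * logDeriv (deriv (wp τ)) w = k w from h2, h3.self_of_nhdsWithin h4,
      Matrix.add_mulVec, Matrix.smul_mulVec, Matrix.one_mulVec, Matrix.mulVec_smul]
    module

/-- The matrix entries of the connection in the frame `(Φ, w ↦ Φ (-w))` have at most simple poles
over the branch points, and the residues of the second fundamental form are determined by the
eigenvalues of the residues of the connection. -/
theorem exists_sub_mul_entries (hϑ : IsShiftedTheta τ ϑ) (hΨ : Ψ.DetNeZero (branchPoint τ))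
    {ξ μ : ℂ} {Φ : ℂ → Fin 2 → ℂ} (h : IsHolFrame τ ξ Φ) (he : IsEigenframe τ Ψ μ Φ)
    {i : Fin 4} {p : ℂ} (hp : p - halfPeriod τ i ∈ lattice τ) :
    ∃ a b : ℂ → ℂ, AnalyticAt ℂ a p ∧ AnalyticAt ℂ b p ∧
      b p = (2 * (ρ i : ℂ) - 1 / 2) * unitaryChar ξ (2 * p) ∧ ∀ᶠ w in 𝓝[≠] p,
      (w - p) * (det2 (holNabla τ F Φ w) (Φ (-w)) / det2 (Φ w) (Φ (-w))) = a w ∧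
      (w - p) * (det2 (Φ w) (holNabla τ F Φ w) / det2 (Φ w) (Φ (-w))) = b w := by
  have h2p : 2 * p ∈ lattice τ := mem_halfLattice_of_sub_halfPeriod_mem hp
  obtain ⟨d, hd0, hd⟩ := hϑ.exists_det2_eq_ne_zero hΨ h h.reflect he (hϑ.isEigenframe_reflect he)
  obtain ⟨g, hg, hg0, hgw⟩ := hϑ.exists_deriv_wp_factor (p := p) h2p
  obtain ⟨G, hG, hG0, hGw⟩ := h.factor p
  obtain ⟨Q, hQ, hQ', hQp, htr, hW⟩ := hϑ.exists_connection_lead hΨ he hp hG hGw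
  set c := unitaryChar ξ (-(2 * p)) with hc
  set X : ℂ → Fin 2 → ℂ := fun w => (w - p) • vderiv G w + Q w *ᵥ G w with hX
  set H : ℂ → Fin 2 → ℂ := fun w => c • G (2 * p - w) with hH
  have hrefl : Tendsto (fun w => 2 * p - w) (𝓝[≠] p) (𝓝[≠] p) := by
    have := tendsto_const_sub_punctured p (2 * p)
    rwa [show 2 * p - p = p by ring] at this
  have hXan : ∀ j, AnalyticAt ℂ (fun w => X w j) p := fun j =>
    ((by fun_prop : AnalyticAt ℂ (fun w => w - p) p).mul (hG j).deriv).add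
      (analyticAt_mulVec hQ hG j)
  have hHan : ∀ j, AnalyticAt ℂ (fun w => H w j) p := fun j =>
    analyticAt_const.mul (analyticAt_reflect (hG j))
  have hXp : X p = (2 * (ρ i : ℂ) - 1 / 2) • G p := by
    simp only [hX, sub_self, zero_smul, zero_add, hQp]
  have hHp : H p = c • G p := by simp only [hH, two_mul, add_sub_cancel_right]
  -- At `p` the vectors `G`, `X` and `H` are proportional, so that all determinants vanish there,
  -- and the entries are governed by the quotients of the first derivatives.
  obtain ⟨D, hD, hDp, hDw⟩ := exists_analyticAt_eq_sub_mul (analyticAt_det2 hG hHan)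
    (by rw [hHp]; simp [det2]; ring)
  obtain ⟨A, hA, -, hAw⟩ := exists_analyticAt_eq_sub_mul (analyticAt_det2 hXan hHan)
    (by rw [hHp, hXp]; simp [det2]; ring)
  obtain ⟨N, hN, hNp, hNw⟩ := exists_analyticAt_eq_sub_mul (analyticAt_det2 hG hXan)
    (by rw [hXp]; simp [det2]; ring)
  rw [deriv_det2_reflect hG c] at hDp
  rw [deriv_det2_connection hG hQ hQ' hQp htr] at hNp
  have hlead : ∀ᶠ w in 𝓝[≠] p, w - p ≠ 0 ∧ Φ w = (w - p) ^ leadOrder τ p • G w ∧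
      Φ (-w) = (w - p) ^ leadOrder τ p • H w := by
    filter_upwards [hGw, hrefl.eventually hGw, self_mem_nhdsWithin] with w h1 h2 h3
    refine ⟨sub_ne_zero.2 h3, h1, ?_⟩
    rw [show -w = (2 * p - w) + -(2 * p) by ring, h.add _ (neg_mem h2p), h2,
      show 2 * p - w - p = -(w - p) by ring, (even_leadOrder τ p).neg_zpow, smul_comm]
  have hdet : ∀ᶠ w in 𝓝[≠] p, det2 (Φ w) (Φ (-w)) = (w - p) ^ (2 * leadOrder τ p + 1) * D w := by
    filter_upwards [hlead] with w ⟨h1, h2, h3⟩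
    rw [zpow_add_one₀ h1, two_mul, zpow_add₀ h1, mul_assoc, ← hDw, h2, h3]
    simp only [det2, Pi.smul_apply, smul_eq_mul]
    ring
  have hDne : D p ≠ 0 := by
    have : D p = d * g p := by
      refine eq_of_eventuallyEq_punctured (G := fun w => d * g w) hD.continuousAt
        (continuousAt_const.mul hg.continuousAt) ?_
      filter_upwards [hdet, hgw, eventually_notMem_halfLattice τ p, hlead] with w h1 h2 h3 h4
      refine mul_left_cancel₀ (zpow_ne_zero (2 * leadOrder τ p + 1) h4.1) ?_
      rw [← h1, hd w h3, h2]
      ring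
    rw [this]
    exact mul_ne_zero hd0 hg0
  refine ⟨fun w => A w / D w, fun w => N w / D w, hA.div hD hDne, hN.div hD hDne, ?_, ?_⟩
  · have hcχ : c * unitaryChar ξ (2 * p) = 1 := unitaryChar_neg_mul _ _
    rw [div_eq_iff hDne, hNp, hDp]
    linear_combination 2 * (2 * (ρ i : ℂ) - 1 / 2) * det2 (G p) (vderiv G p) * hcχ
  · filter_upwards [hlead, hdet, hW, hD.continuousAt.eventually_ne hDne |>.filter_mono
      nhdsWithin_le_nhds] with w ⟨h1, h2, h3⟩ h4 h5 h6
    have hpow : (w - p) ^ (2 * leadOrder τ p + 1) =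
        (w - p) ^ leadOrder τ p * (w - p) ^ leadOrder τ p * (w - p) := by
      rw [zpow_add_one₀ h1, two_mul, zpow_add₀ h1]
    have e1 : (w - p) * det2 (holNabla τ F Φ w) (Φ (-w)) =
        (w - p) ^ (2 * leadOrder τ p + 1) * A w := by
      have := det2_smul_smul (w - p) ((w - p) ^ leadOrder τ p) (holNabla τ F Φ w) (H w)
      rw [h5, det2_smul_smul, hAw w] at this
      rw [h3, hpow, ← one_smul ℂ (holNabla τ F Φ w), det2_smul_smul]
      linear_combination -this
    have e2 : (w - p) * det2 (Φ w) (holNabla τ F Φ w) =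
        (w - p) ^ (2 * leadOrder τ p + 1) * N w := by
      have := det2_smul_smul ((w - p) ^ leadOrder τ p) (w - p) (G w) (holNabla τ F Φ w)
      rw [h5, det2_smul_smul, hNw w] at this
      rw [h2, hpow, ← one_smul ℂ (holNabla τ F Φ w), det2_smul_smul]
      linear_combination -this
    have hz := zpow_ne_zero (2 * leadOrder τ p + 1) h1
    rw [h4, ← mul_div_assoc, ← mul_div_assoc, e1, e2, mul_div_mul_left _ _ hz,
      mul_div_mul_left _ _ hz]
    exact ⟨rfl, rfl⟩

/-- In the frame `(Φ, w ↦ Φ (-w))` the diagonal entry of the connection is a constant: it is an even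
elliptic function with at most simple poles, at fixed points of `w ↦ -w`. -/
theorem exists_holNabla_eq (hϑ : IsShiftedTheta τ ϑ) (hΨ : Ψ.DetNeZero (branchPoint τ))
    {ξ μ : ℂ} {Φ : ℂ → Fin 2 → ℂ} (h : IsHolFrame τ ξ Φ) (he : IsEigenframe τ Ψ μ Φ) :
    ∃ (α : ℂ) (B : ℂ → ℂ), (∀ p ∉ halfLattice τ, AnalyticAt ℂ B p) ∧
      (∀ l ∈ lattice τ, ∀ w, B (w + l) = unitaryChar ξ l ^ 2 * B w) ∧
      (∀ i p, p - halfPeriod τ i ∈ lattice τ → ∃ k, AnalyticAt ℂ k p ∧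
        k p = (2 * (ρ i : ℂ) - 1 / 2) * unitaryChar ξ (2 * p) ∧
        ∀ᶠ w in 𝓝[≠] p, (w - p) * B w = k w) ∧
      ∀ w ∉ halfLattice τ, holNabla τ F Φ w = α • Φ w + B w • Φ (-w) := by
  have he' := hϑ.isEigenframe_reflect he
  obtain ⟨d, -, hd⟩ := hϑ.exists_det2_eq_ne_zero hΨ h h.reflect he he'
  have hne : ∀ w ∉ halfLattice τ, det2 (Φ w) (Φ (-w)) ≠ 0 := fun w hw =>
    hϑ.det2_ne_zero hΨ h h.reflect he he' hw
  set A : ℂ → ℂ := fun w => det2 (holNabla τ F Φ w) (Φ (-w)) / det2 (Φ w) (Φ (-w)) with hA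
  set B : ℂ → ℂ := fun w => det2 (Φ w) (holNabla τ F Φ w) / det2 (Φ w) (Φ (-w)) with hB
  have hnot : ∀ p ∉ halfLattice τ, p ∉ lattice τ := fun p hp h =>
    hp (lattice_subset_halfLattice h)
  have hAan : ∀ p ∉ halfLattice τ, AnalyticAt ℂ A p := fun p hp =>
    (analyticAt_det2 (hϑ.analyticAt_holNabla h hp) (h.reflect.analytic p (hnot p hp))).div
      (analyticAt_det2 (h.analytic p (hnot p hp)) (h.reflect.analytic p (hnot p hp))) (hne p hp)
  have hBan : ∀ p ∉ halfLattice τ, AnalyticAt ℂ B p := fun p hp =>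
    (analyticAt_det2 (h.analytic p (hnot p hp)) (hϑ.analyticAt_holNabla h hp)).div
      (analyticAt_det2 (h.analytic p (hnot p hp)) (h.reflect.analytic p (hnot p hp))) (hne p hp)
  have hneg : ∀ l ∈ lattice τ, ∀ w, Φ (-(w + l)) = unitaryChar ξ (-l) • Φ (-w) := by
    intro l hl w
    rw [neg_add, h.add _ (neg_mem hl)]
  have hχ : ∀ l, unitaryChar ξ l * unitaryChar ξ (-l) = 1 := fun l => by
    rw [mul_comm, unitaryChar_neg_mul]
  have hAper : ∀ l ∈ lattice τ, ∀ w, A (w + l) = A w := by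
    intro l hl w
    simp only [hA]
    rw [hneg l hl, h.add l hl, hϑ.holNabla_add h hl, det2_smul_smul, det2_smul_smul, hχ,
      one_mul, one_mul]
  have hBper : ∀ l ∈ lattice τ, ∀ w, B (w + l) = unitaryChar ξ l ^ 2 * B w := by
    intro l hl w
    simp only [hB]
    rw [hneg l hl, h.add l hl, hϑ.holNabla_add h hl, det2_smul_smul, det2_smul_smul, hχ]
    ring
  have hAeven : ∀ w ∉ halfLattice τ, A (-w) = A w := by
    intro w hw
    simp only [hA, neg_neg]
    rw [hϑ.det2_holNabla_neg h hd hw, show det2 (Φ (-w)) (Φ w) = -det2 (Φ w) (Φ (-w)) by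
      simp [det2]; ring, neg_div_neg_eq]
  obtain ⟨α, hα⟩ := eventuallyEq_const_of_norm_periodic τ (f := A)
    (fun l hl w => by rw [hAper l hl]) (fun p => by
      by_cases hp : p ∈ halfLattice τ
      · obtain ⟨i, hi⟩ := exists_sub_halfPeriod_mem hp
        obtain ⟨a, _, ha, -, -, hw⟩ := hϑ.exists_sub_mul_entries hΨ h he hi
        have hrefl := tendsto_const_sub_punctured p (2 * p)
        rw [show 2 * p - p = p by ring] at hrefl
        -- The residue of an even function at a fixed point of the involution vanishes.
        have ha0 : a p = 0 := by
          have h1 := eq_of_eventuallyEq_punctured (analyticAt_reflect ha).continuousAt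
            ha.neg.continuousAt (by
              filter_upwards [hw, hrefl.eventually hw, eventually_notMem_halfLattice τ p]
                with w h1 h2 h3
              rw [Pi.neg_apply, ← h1.1, ← h2.1]
              change (2 * p - w - p) * A (2 * p - w) = -((w - p) * A w)
              rw [show 2 * p - w = -w + 2 * p by ring, hAper _ hp, hAeven w h3]
              ring)
          rw [show 2 * p - p = p by ring, Pi.neg_apply] at h1
          exact self_eq_neg.1 h1
        obtain ⟨k, hk, -, hkw⟩ := exists_analyticAt_eq_sub_mul ha ha0
        refine ⟨k, hk, ?_⟩
        filter_upwards [hw, self_mem_nhdsWithin] with w h1 h2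
        refine mul_left_cancel₀ (sub_ne_zero.2 h2) ?_
        rw [← hkw, ← h1.1]
      · exact ⟨_, hAan p hp, EventuallyEq.rfl⟩)
  refine ⟨α, B, hBan, hBper, fun i p hp => ?_, fun w hw => ?_⟩
  · obtain ⟨_, b, -, hb, hbp, hw⟩ := hϑ.exists_sub_mul_entries hΨ h he hp
    exact ⟨b, hb, hbp, hw.mono fun w hw => hw.2⟩
  · have hAw : A w = α :=
      eq_of_eventuallyEq_punctured (hAan w hw).continuousAt continuousAt_const (hα w)
    rw [← hAw]
    have h1 := hne w hw
    -- Cramer's rule.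
    have h2 : det2 (Φ w) (Φ (-w)) • holNabla τ F Φ w =
        det2 (holNabla τ F Φ w) (Φ (-w)) • Φ w +
          det2 (Φ w) (holNabla τ F Φ w) • Φ (-w) := by
      funext j
      simp only [det2, Pi.add_apply, Pi.smul_apply, smul_eq_mul]
      fin_cases j <;> simp <;> ring
    refine smul_right_injective _ h1 ?_
    simp only [hA, hB]
    rw [h2, smul_add, smul_smul, smul_smul, mul_div_cancel₀ _ h1, mul_div_cancel₀ _ h1]

end IsShiftedTheta

/-! ### From smooth to holomorphic frames -/

theorem dbar_apply {φ : ℂ → Fin 2 → ℂ} {w : ℂ} (h : DifferentiableAt ℝ φ w) (j : Fin 2) :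
    dbar (fun w => φ w j) w = dbar φ w j := by
  have h1 : fderiv ℝ (fun w => φ w j) w = (ContinuousLinearMap.proj j).comp (fderiv ℝ φ w) :=
    fderiv_apply h j
  simp [dbar, h1]

/-- Multiplication by the unitary character makes the frame holomorphic; at the lattice points the
leading coefficient is continuous, and its singularity is removable. -/
theorem IsTwistedFrame.isHolFrame {ξ : ℂ} {φ : ℂ → Fin 2 → ℂ} (h : IsTwistedFrame τ ξ φ) :
    IsHolFrame τ ξ fun w => unitaryChar ξ w • φ w := by
  have han : ∀ p ∉ lattice τ, ∀ j, AnalyticAt ℂ (fun w => (unitaryChar ξ w • φ w) j) p := by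
    intro p hp j
    refine analyticAt_expConj_mul _ ?_
    filter_upwards [(isClosed_lattice τ).isOpen_compl.mem_nhds hp] with w hw
    have h1 := h.smooth w hw
    refine ⟨contDiffAt_pi.1 h1 j, ?_⟩
    rw [dbar_apply (h1.differentiableAt (by simp)), h.dbar_eq w hw]
    simp
  refine ⟨fun l hl w => ?_, han, fun p => ?_⟩
  · rw [unitaryChar_add, h.periodic l hl, smul_smul, mul_comm]
  · by_cases hp : p ∈ lattice τ
    · obtain ⟨g, hg, hg0, hgw⟩ := h.pole p hp
      refine ⟨fun w => unitaryChar ξ w • g w, fun j => ?_,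
        smul_ne_zero (unitaryChar_ne_zero _ _) hg0, ?_⟩
      · refine Complex.analyticAt_of_differentiable_on_punctured_nhds_of_continuousAt ?_ ?_
        · filter_upwards [eventually_eventually_nhdsWithin.2 hgw, eventually_notMem_lattice τ p,
            self_mem_nhdsWithin] with w h1 h2 h3
          have h4 : DifferentiableAt ℂ (fun w => (w - p) ^ 2 * (unitaryChar ξ w • φ w) j) w :=
            ((differentiableAt_id.sub_const p).pow 2).mul (han w h2 j).differentiableAt
          refine h4.congr_of_eventuallyEq ?_
          rw [isOpen_compl_singleton.nhdsWithin_eq h3] at h1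
          filter_upwards [h1] with u hu
          rw [← hu]
          simp only [Pi.smul_apply, smul_eq_mul]
          ring
        · exact (continuous_expConj _ _).continuousAt.mul
            (contDiffAt_pi.1 hg j).continuousAt
      · rw [leadOrder, if_pos hp]
        filter_upwards [hgw, self_mem_nhdsWithin] with w h1 h2
        have h3 : w - p ≠ 0 := sub_ne_zero.2 h2
        rw [← h1, smul_comm (unitaryChar ξ w), smul_smul, zpow_neg]
        norm_cast
        rw [inv_mul_cancel₀ (pow_ne_zero _ h3), one_smul]
    · refine ⟨_, han p hp, smul_ne_zero (unitaryChar_ne_zero _ _) (h.ne_zero p hp), ?_⟩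
      rw [leadOrder, if_neg hp]
      simp

/-- The connection `∇̂` in terms of the holomorphic counterpart of the frame. -/
theorem IsTwistedFrame.hatNabla_eq {ξ : ℂ} {φ : ℂ → Fin 2 → ℂ} (h : IsTwistedFrame τ ξ φ)
    {ρ : Fin 4 → ℝ} (F : FuchsianSystem ρ) {w : ℂ} (hw : w ∉ lattice τ) (v : ℂ) :
    hatNabla τ F φ w v =
      unitaryChar ξ (-w) • v • holNabla τ F (fun w => unitaryChar ξ w • φ w) w +
        (starRingEnd ℂ ξ * v - ξ * starRingEnd ℂ v) • φ w := by
  have hd := (h.smooth w hw).differentiableAt (by simp)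
  have hχ := unitaryChar_neg_mul ξ w
  have hder : unitaryChar ξ (-w) • v • vderiv (fun w => unitaryChar ξ w • φ w) w =
      fderiv ℝ φ w v + (-starRingEnd ℂ ξ * v + ξ * starRingEnd ℂ v) • φ w := by
    funext j
    have h1 := (h.isHolFrame.analytic w hw j).differentiableAt
    have h2 := fderiv_real_apply h1 v
    have h3 : fderiv ℝ (fun w => φ w j) w = (ContinuousLinearMap.proj j).comp (fderiv ℝ φ w) :=
      fderiv_apply hd j
    have h4 := fderiv_expConj_mul (-starRingEnd ℂ ξ) ξ
      (f := fun w => φ w j) (differentiableAt_pi.1 hd j) v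
    have h5 : v * deriv (fun w => (unitaryChar ξ w • φ w) j) w = unitaryChar ξ w *
        (fderiv ℝ φ w v j + (-starRingEnd ℂ ξ * v + ξ * starRingEnd ℂ v) * φ w j) := by
      rw [← h2]
      refine h4.trans ?_
      rw [h3]
      rfl
    simp only [Pi.smul_apply, Pi.add_apply, smul_eq_mul, vderiv] at h5 ⊢
    rw [h5, ← mul_assoc, hχ, one_mul]
  rw [holNabla, smul_sub, smul_add, smul_sub, smul_add, hder, hatNabla, ← deriv_wp,
    Matrix.mulVec_smul]
  funext j
  simp only [Pi.smul_apply, Pi.add_apply, Pi.sub_apply, smul_eq_mul]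
  linear_combination
    -(v * (pullback τ F.res w *ᵥ φ w) j - 1 / 2 * logDeriv (deriv (wp τ)) w * v * φ w j) * hχ

/-! ### The multiplier systems of the bundles `E^{± 2}` -/

theorem not_forall_expConj_eq_one {ξ : ℂ} (hξ : ¬ IsSpin τ ξ) (σ : ℤˣ) :
    ¬ ∀ l ∈ lattice τ,
      expConj (-(starRingEnd ℂ ((σ : ℤ) * (2 * ξ)))) ((σ : ℤ) * (2 * ξ)) l = 1 := by
  intro h
  refine hξ (isHolTrivial_of_expConj_eq_one ?_)
  rcases Int.units_eq_one_or σ with rfl | rfl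
  · simpa using h
  · simpa using expConj_eq_one_iff_neg h

/-- If `2x = m + n τ`, the multiplier of `L(∂̄ + 2ξ dw̄)` at `a + b τ` is
`exp (2πi (n a - m b)) = 1`. -/
theorem two_mul_notMem_lattice {ξ x : ℂ} (hξ : ¬ IsSpin τ ξ)
    (hx : x = ((τ : ℂ) - starRingEnd ℂ (τ : ℂ)) / (2 * Real.pi * Complex.I) * ξ) :
    2 * x ∉ lattice τ := by
  intro hmem
  refine hξ (isHolTrivial_of_expConj_eq_one fun l hl => ?_)
  obtain ⟨m, n, hmn⟩ := mem_lattice_iff.1 hmem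
  obtain ⟨a, b, rfl⟩ := mem_lattice_iff.1 hl
  have hττ := tau_sub_conj_ne_zero τ
  have hττ' : starRingEnd ℂ (τ : ℂ) - τ ≠ 0 := by rwa [← neg_sub, neg_ne_zero]
  have hπ := Complex.two_pi_I_ne_zero
  have hs : 2 * ξ = 2 * Real.pi * Complex.I * (m + n * τ) / (τ - starRingEnd ℂ (τ : ℂ)) := by
    rw [hmn, hx]
    field_simp
  have hs' : starRingEnd ℂ (2 * ξ) = 2 * Real.pi * Complex.I * (m + n * starRingEnd ℂ (τ : ℂ)) /
      (τ - starRingEnd ℂ (τ : ℂ)) := by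
    rw [hs]
    simp only [map_div₀, map_mul, map_add, map_sub, map_intCast, Complex.conj_I, Complex.conj_conj,
      map_ofNat, Complex.conj_ofReal]
    rw [div_eq_div_iff hττ' hττ]
    ring
  rw [expConj, hs', hs, Complex.exp_eq_one_iff]
  refine ⟨n * a - m * b, ?_⟩
  push_cast
  simp only [map_add, map_mul, map_intCast]
  field_simp
  ring

/-- The parameter of the bundle of `t_y` for `y = ∓2x` is `±2ξ`. -/
theorem two_pi_I_div_mul {ξ x : ℂ}
    (hx : x = ((τ : ℂ) - starRingEnd ℂ (τ : ℂ)) / (2 * Real.pi * Complex.I) * ξ) (σ : ℂ) :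
    2 * Real.pi * Complex.I / (starRingEnd ℂ (τ : ℂ) - τ) * (-σ * (2 * x)) = σ * (2 * ξ) := by
  have hττ : starRingEnd ℂ (τ : ℂ) - τ ≠ 0 := by
    rw [← neg_sub, neg_ne_zero]
    exact tau_sub_conj_ne_zero τ
  have hπ := Complex.two_pi_I_ne_zero
  rw [hx, ← neg_sub (starRingEnd ℂ (τ : ℂ))]
  field_simp

namespace IsShiftedTheta

variable {ϑ : ℂ → ℂ} {ρ : Fin 4 → ℝ} {F : FuchsianSystem ρ} {Ψ : ParabolicHiggsField F}

theorem betaForm_mem (hϑ : IsShiftedTheta τ ϑ) (ρ : Fin 4 → ℝ) {ξ x : ℂ}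
    (hx : x = ((τ : ℂ) - starRingEnd ℂ (τ : ℂ)) / (2 * Real.pi * Complex.I) * ξ) (σ : ℤˣ) :
    Set.indicator (halfLattice τ)ᶜ (betaForm τ ϑ ρ σ x) ∈ meroSections τ ((σ : ℤ) * (2 * ξ)) := by
  rw [← two_pi_I_div_mul hx]
  exact hϑ.sum_tFun_mem _ _

/-- A section of `E^{± 2} ⊗ K` with the residues of `β^±` is equal to `β^±`. -/
theorem eq_betaForm (hϑ : IsShiftedTheta τ ϑ) {ξ x a : ℂ} (hξ : ¬ IsSpin τ ξ)
    (hx : x = ((τ : ℂ) - starRingEnd ℂ (τ : ℂ)) / (2 * Real.pi * Complex.I) * ξ) (σ : ℤˣ)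
    {f B : ℂ → ℂ} (hper : ∀ l ∈ lattice τ, ∀ w ∉ halfLattice τ, f (w + l) = f w)
    (hf : ∀ w ∉ halfLattice τ, f w = expConj a (-((σ : ℤ) * (2 * ξ))) w * B w)
    (hB : ∀ p ∉ halfLattice τ, AnalyticAt ℂ B p)
    (hpole : ∀ i p, p - halfPeriod τ i ∈ lattice τ → ∃ k, AnalyticAt ℂ k p ∧
      expConj a (-((σ : ℤ) * (2 * ξ))) p * k p =
        Complex.exp ((σ : ℤ) * (2 * Real.pi * Complex.I * x)) * (2 * ρ i - 1 / 2) ∧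
      ∀ᶠ w in 𝓝[≠] p, (w - p) * B w = k w) :
    ∀ w ∉ halfLattice τ, f w = betaForm τ ϑ ρ σ x w := by
  have hmem := indicator_mem_meroSections hper hf hB fun p hp => by
    obtain ⟨i, hi⟩ := exists_sub_halfPeriod_mem hp
    obtain ⟨k, hk, -, hkw⟩ := hpole i p hi
    exact ⟨k, hk, hkw⟩
  have h2x := two_mul_notMem_lattice hξ hx
  have heq : residueMap τ ((σ : ℤ) * (2 * ξ)) ⟨_, hmem⟩ =
      residueMap τ ((σ : ℤ) * (2 * ξ)) ⟨_, hϑ.betaForm_mem ρ hx σ⟩ := by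
    funext i
    obtain ⟨k, hk, hkp, hkw⟩ := hpole i (halfPeriod τ i) (by rw [sub_self]; exact zero_mem _)
    have h1 : Tendsto (fun w => (w - halfPeriod τ i) * Set.indicator (halfLattice τ)ᶜ f w)
        (𝓝[≠] (halfPeriod τ i))
        (𝓝 (alphaCoeff τ ϑ ρ σ x i * (ϑ ((σ : ℤ) * (2 * x)) / deriv ϑ 0))) := by
      have hc := ((continuous_expConj a (-((σ : ℤ) * (2 * ξ)))).continuousAt.mul
        hk.continuousAt).tendsto.mono_left (nhdsWithin_le_nhds (s := {halfPeriod τ i}ᶜ))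
      rw [Pi.mul_apply, hkp, ← hϑ.alphaCoeff_mul ρ σ h2x i] at hc
      refine hc.congr' ?_
      filter_upwards [hkw, eventually_notMem_halfLattice τ (halfPeriod τ i)] with w h3 h4
      rw [Pi.mul_apply, ← h3, Set.indicator_of_mem (by exact h4), hf w h4]
      ring
    have h2 : Tendsto (fun w => (w - halfPeriod τ i) *
        Set.indicator (halfLattice τ)ᶜ (betaForm τ ϑ ρ σ x) w) (𝓝[≠] (halfPeriod τ i))
        (𝓝 (alphaCoeff τ ϑ ρ σ x i * (ϑ ((σ : ℤ) * (2 * x)) / deriv ϑ 0))) := by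
      have := hϑ.tendsto_sum_tFun (-(σ : ℤ) * (2 * x)) (alphaCoeff τ ϑ ρ σ x) i
      rwa [show -(-(σ : ℤ) * (2 * x)) = (σ : ℤ) * (2 * x) by ring] at this
    exact (residueMap_eq ⟨_, hmem⟩ h1).trans
      (residueMap_eq ⟨_, hϑ.betaForm_mem ρ hx σ⟩ h2).symm
  have hsec := congrArg Subtype.val
    (residueMap_injective (not_forall_expConj_eq_one hξ σ) heq)
  intro w hw
  have : Set.indicator (halfLattice τ)ᶜ f w =
      Set.indicator (halfLattice τ)ᶜ (betaForm τ ϑ ρ σ x) w := congrFun hsec w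
  rwa [Set.indicator_of_mem (by exact hw), Set.indicator_of_mem (by exact hw)] at this

/-- The involution `w ↦ -w` exchanges the eigenlines. -/
theorem exists_eq_smul_reflect (hϑ : IsShiftedTheta τ ϑ) (hΨ : Ψ.DetNeZero (branchPoint τ))
    {ξ μ : ℂ} {Φ M : ℂ → Fin 2 → ℂ} (h : IsHolFrame τ ξ Φ) (hM : IsHolFrame τ (-ξ) M)
    (he : IsEigenframe τ Ψ μ Φ) (heM : IsEigenframe τ Ψ (-μ) M) :
    ∃ κ : ℂ, κ ≠ 0 ∧ ∀ w ∉ halfLattice τ, M w = κ • Φ (-w) := by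
  have he' := hϑ.isEigenframe_reflect he
  obtain ⟨d, hd0, hd⟩ := hϑ.exists_det2_eq_ne_zero hΨ h h.reflect he he'
  obtain ⟨e, he0, hde⟩ := hϑ.exists_det2_eq_ne_zero hΨ h hM he heM
  refine ⟨e / d, div_ne_zero he0 hd0, fun w hw => ?_⟩
  have hne := h.apply_ne_zero fun h => hw (lattice_subset_halfLattice h)
  obtain ⟨t, ht⟩ := exists_smul_of_det2_eq_zero (v := M w - (e / d) • Φ (-w)) hne (by
    have h1 : det2 (Φ w) (M w - (e / d) • Φ (-w)) =
        det2 (Φ w) (M w) - e / d * det2 (Φ w) (Φ (-w)) := by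
      simp [det2]
      ring
    rw [h1, hde w hw, hd w hw]
    field_simp
    ring)
  have h2 : (2 * μ) • (t • Φ w) = 0 := by
    have h3 : pullback τ Ψ.res w *ᵥ (t • Φ w) = μ • t • Φ w := by
      rw [Matrix.mulVec_smul, he w hw, smul_comm]
    have h4 : pullback τ Ψ.res w *ᵥ (t • Φ w) = -μ • t • Φ w := by
      rw [← ht, Matrix.mulVec_sub, Matrix.mulVec_smul, heM w hw, he' w hw]
      module
    rw [h3, ← sub_eq_zero] at h4
    rw [← h4]
    module
  rw [smul_eq_zero_iff_right (mul_ne_zero two_ne_zero (hϑ.eigenvalue_ne_zero hΨ h he))] at h2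
  rw [h2] at ht
  exact sub_eq_zero.1 ht

end IsShiftedTheta

theorem unitaryChar_sq (s w : ℂ) : unitaryChar s w ^ 2 = unitaryChar s (2 * w) := by
  rw [two_mul, unitaryChar_add, sq]

theorem unitaryChar_two_mul (s w : ℂ) :
    unitaryChar s (2 * w) = expConj (-(2 * starRingEnd ℂ s)) (2 * s) w := by
  rw [unitaryChar, expConj, expConj]
  congr 1
  simp only [map_mul, Complex.conj_ofNat]
  ring

theorem hatNabla_smul {ρ : Fin 4 → ℝ} (F : FuchsianSystem ρ) (c : ℂ) (φ : ℂ → Fin 2 → ℂ)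
    (w v : ℂ) : hatNabla τ F (c • φ) w v = c • hatNabla τ F φ w v := by
  rw [hatNabla, hatNabla, fderiv_const_smul_field, Pi.smul_apply c φ w, Matrix.mulVec_smul,
    Pi.smul_apply, smul_apply]
  module

/-! ### The normal form -/

theorem holNabla_congr {ρ : Fin 4 → ℝ} (F : FuchsianSystem ρ) {Φ M : ℂ → Fin 2 → ℂ} {κ w : ℂ}
    (h : ∀ᶠ u in 𝓝 w, M u = κ • Φ u) : holNabla τ F M w = κ • holNabla τ F Φ w := by
  have hv : vderiv M w = κ • vderiv Φ w := by
    funext j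
    have h1 : (fun u => M u j) =ᶠ[𝓝 w] fun u => κ * Φ u j := by
      filter_upwards [h] with u hu
      rw [hu, Pi.smul_apply, smul_eq_mul]
    rw [vderiv, h1.deriv_eq, deriv_const_mul_field, Pi.smul_apply, smul_eq_mul, vderiv]
  rw [holNabla, holNabla, hv, h.self_of_nhds, Matrix.mulVec_smul]
  module

namespace IsShiftedTheta

variable {ϑ : ℂ → ℂ} {ρ : Fin 4 → ℝ} {F : FuchsianSystem ρ} {Ψ : ParabolicHiggsField F}

/-- The frame `Φ` of `E` and its reflection `w ↦ Φ (-w)`, a multiple of the frame of `E^*`, put the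
connection into normal form; its off-diagonal entries are identified by their residues. -/
theorem exists_hasConnectionForm (hϑ : IsShiftedTheta τ ϑ) (hΨ : Ψ.DetNeZero (branchPoint τ))
    {ξ x : ℂ} {φp φm : ℂ → Fin 2 → ℂ} (hφ : IsAbelianFrame τ Ψ ξ φp φm) (hξ : ¬ IsSpin τ ξ)
    (hx : x = ((τ : ℂ) - starRingEnd ℂ (τ : ℂ)) / (2 * Real.pi * Complex.I) * ξ) :
    ∃ α c : ℂ, c ≠ 0 ∧ HasConnectionForm τ F φp (c • φm) α ξ
      (betaForm τ ϑ ρ 1 x) (betaForm τ ϑ ρ (-1) x) := by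
  obtain ⟨μ, hμ⟩ := hφ.eigen
  set Φ : ℂ → Fin 2 → ℂ := fun w => unitaryChar ξ w • φp w with hΦ
  set M : ℂ → Fin 2 → ℂ := fun w => unitaryChar (-ξ) w • φm w with hM
  have h : IsHolFrame τ ξ Φ := hφ.plus.isHolFrame
  have hm : IsHolFrame τ (-ξ) M := hφ.minus.isHolFrame
  have he : IsEigenframe τ Ψ μ Φ := fun w hw => by
    simp only [hΦ]
    rw [Matrix.mulVec_smul, (hμ w hw).1, smul_comm]
  have hem : IsEigenframe τ Ψ (-μ) M := fun w hw => by
    simp only [hM]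
    rw [Matrix.mulVec_smul, (hμ w hw).2, smul_comm]
  obtain ⟨κ, hκ, hκM⟩ := hϑ.exists_eq_smul_reflect hΨ h hm he hem
  obtain ⟨α, B, hB, hBper, hBres, hW⟩ := hϑ.exists_holNabla_eq hΨ h he
  set γ := Complex.exp (-(2 * Real.pi * Complex.I * x)) with hγ
  have hγ0 : γ ≠ 0 := Complex.exp_ne_zero _
  have hinv : γ⁻¹ = Complex.exp (2 * Real.pi * Complex.I * x) := by
    rw [hγ, Complex.exp_neg, inv_inv]
  have hχ : ∀ w, unitaryChar ξ (-w) * unitaryChar ξ w = 1 := unitaryChar_neg_mul ξ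
  -- The constant `γ` is determined by the residues of `β⁺`, which are `γ⁻¹ (2 ρ i - 1 / 2)` up to
  -- the multiplier; the residues of `β⁻` are then correct as well.
  have hbp : ∀ w ∉ halfLattice τ,
      γ⁻¹ * unitaryChar ξ (2 * -w) * B w = betaForm τ ϑ ρ 1 x w := by
    refine hϑ.eq_betaForm (a := 2 * starRingEnd ℂ ξ) (B := fun w => γ⁻¹ * B w) hξ hx 1 ?_ ?_ ?_ ?_
    · intro l hl w _
      rw [hBper l hl, unitaryChar_sq, neg_add, mul_add, unitaryChar_add]
      have := hχ (2 * l)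
      rw [← mul_neg] at this
      linear_combination γ⁻¹ * unitaryChar ξ (2 * -w) * B w * this
    · intro w _
      rw [unitaryChar_two_mul, ← expConj_neg_neg]
      simp
      ring
    · intro p hp
      exact analyticAt_const.mul (hB p hp)
    · intro i p hp
      obtain ⟨k, hk, hkp, hkw⟩ := hBres i p hp
      refine ⟨fun w => γ⁻¹ * k w, analyticAt_const.mul hk, ?_, ?_⟩
      · have h1 := hχ (2 * p)
        rw [← mul_neg, unitaryChar_two_mul, ← expConj_neg_neg, neg_neg] at h1
        simp only [Units.val_one, Int.cast_one, one_mul]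
        rw [hkp, ← hinv]
        linear_combination γ⁻¹ * (2 * (ρ i : ℂ) - 1 / 2) * h1
      · filter_upwards [hkw] with w h1
        rw [← h1]
        ring
  have hbm : ∀ w ∉ halfLattice τ,
      -γ * unitaryChar ξ (2 * w) * B (-w) = betaForm τ ϑ ρ (-1) x w := by
    refine hϑ.eq_betaForm (a := -(2 * starRingEnd ℂ ξ)) (B := fun w => -γ * B (-w)) hξ hx (-1)
      ?_ ?_ ?_ ?_
    · intro l hl w _
      rw [neg_add, hBper _ (neg_mem hl), unitaryChar_sq, mul_add, unitaryChar_add]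
      have := hχ (2 * l)
      rw [← mul_neg] at this
      linear_combination -γ * unitaryChar ξ (2 * w) * B (-w) * this
    · intro w _
      rw [unitaryChar_two_mul]
      simp
      ring
    · intro p hp
      have := hB (-p) (by rwa [neg_mem_halfLattice_iff])
      exact analyticAt_const.mul (this.comp (f := fun w => -w) (by fun_prop))
    · intro i p hp
      obtain ⟨k, hk, hkp, hkw⟩ := hBres i (-p) (by
        have := add_mem (neg_mem hp) (neg_mem (two_mul_halfPeriod_mem τ i))
        rwa [show -(p - halfPeriod τ i) + -(2 * halfPeriod τ i) = -p - halfPeriod τ i by ring]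
          at this)
      refine ⟨fun w => γ * k (-w),
        analyticAt_const.mul (hk.comp (f := fun w => -w) (by fun_prop)), ?_, ?_⟩
      · have h1 := hχ (2 * p)
        rw [← mul_neg, unitaryChar_two_mul ξ p] at h1
        simp only [Units.val_neg, Units.val_one, Int.cast_neg, Int.cast_one, neg_mul, one_mul,
          neg_neg]
        rw [hkp, ← hγ]
        linear_combination γ * (2 * (ρ i : ℂ) - 1 / 2) * h1
      · have htend := tendsto_const_sub_punctured p 0
        simp only [zero_sub] at htend
        filter_upwards [htend.eventually hkw] with w h1
        rw [← h1]
        ring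
  refine ⟨α + starRingEnd ℂ ξ, γ / κ, div_ne_zero hγ0 hκ, fun w hw v => ?_⟩
  have hwΓ : w ∉ lattice τ := fun h => hw (lattice_subset_halfLattice h)
  have hwn : -w ∉ halfLattice τ := by rwa [neg_mem_halfLattice_iff]
  have hr : Φ (-w) = κ⁻¹ • M w := by rw [hκM w hw, inv_smul_smul₀ hκ]
  have hMw : M w = unitaryChar ξ (-w) • φm w := by
    simp only [hM, unitaryChar_neg_left]
  have hΦw : Φ w = unitaryChar ξ w • φp w := rfl
  have h2 : unitaryChar ξ (2 * w) = unitaryChar ξ w * unitaryChar ξ w := by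
    rw [two_mul, unitaryChar_add]
  have h2' : unitaryChar ξ (2 * -w) = unitaryChar ξ (-w) * unitaryChar ξ (-w) := by
    rw [two_mul, unitaryChar_add]
  have hw1 := hχ w
  constructor
  · rw [hφ.plus.hatNabla_eq F hwΓ v, hW w hw, hr, hMw, hΦw, ← hbp w hw, h2']
    funext j
    simp only [Pi.smul_apply, Pi.add_apply, smul_eq_mul]
    field_simp
    linear_combination κ * v * α * φp w j * hw1
  · have hhol : holNabla τ F M w = -κ • (α • Φ (-w) + B (-w) • Φ w) := by
      have h1 := hW (-w) hwn
      rw [neg_neg] at h1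
      rw [holNabla_congr F (Φ := fun w => Φ (-w)) (κ := κ), hϑ.holNabla_reflect, h1, smul_neg,
        neg_smul]
      filter_upwards [(isClosed_halfLattice τ).isOpen_compl.mem_nhds hw] with u hu using hκM u hu
    rw [hatNabla_smul, hφ.minus.hatNabla_eq F hwΓ v, hhol, hr, hMw, hΦw, ← hbm w hw, h2,
      unitaryChar_neg_left, neg_neg]
    funext j
    simp only [Pi.smul_apply, Pi.add_apply, smul_eq_mul, map_neg]
    field_simp
    linear_combination -(v * α * φm w j) * hw1

end IsShiftedTheta

end Abelianization

end

/-- `x = (τ - τ̄) ξ / (2πi)`. In a suitably scaled frame, the abelianized connection has the normal form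
with the explicit second fundamental forms. For each sign these are meromorphic sections, with at most
simple poles, of `L(∂̄ ± 2ξ dw̄) ⊗ K`, where `L(∂̄ ± 2ξ dw̄) = L([∓2x] - [0])`, and on the space of such
sections the residue map is an isomorphism. -/
theorem proposition2 (τ : UpperHalfPlane) (ϑ : ℂ → ℂ) (hϑ : Abelianization.IsShiftedTheta τ ϑ)
    (ρ : Fin 4 → ℝ) (hρ : ∀ i, 0 < ρ i ∧ ρ i < 1 / 2)
    (F : Abelianization.FuchsianSystem ρ) (Ψ : Abelianization.ParabolicHiggsField F)
    (hΨ : Ψ.DetNeZero (Abelianization.branchPoint τ))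
    (ξ : ℂ) (φp φm : ℂ → Fin 2 → ℂ) (hφ : Abelianization.IsAbelianFrame τ Ψ ξ φp φm)
    (hξ : ¬ Abelianization.IsSpin τ ξ)
    (x : ℂ) (hx : x = ((τ : ℂ) - starRingEnd ℂ (τ : ℂ)) / (2 * Real.pi * Complex.I) * ξ) :
    (∃ α c : ℂ, c ≠ 0 ∧ Abelianization.HasConnectionForm τ F φp (c • φm) α ξ
      (Abelianization.betaForm τ ϑ ρ 1 x) (Abelianization.betaForm τ ϑ ρ (-1) x)) ∧
    ∀ σ : ℤˣ,
      Set.indicator (Abelianization.halfLattice τ)ᶜ (Abelianization.betaForm τ ϑ ρ σ x) ∈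
        Abelianization.meroSections τ ((σ : ℤ) * (2 * ξ)) ∧
      Abelianization.IsPointBundle τ ((σ : ℤ) * (2 * ξ)) (-(σ : ℤ) * (2 * x)) ∧
      Function.Bijective (Abelianization.residueMap τ ((σ : ℤ) * (2 * ξ))) := by
  refine ⟨hϑ.exists_hasConnectionForm hΨ hφ hξ hx, fun σ => ⟨hϑ.betaForm_mem ρ hx σ, ?_,
    Abelianization.residueMap_injective (Abelianization.not_forall_expConj_eq_one hξ σ), ?_⟩⟩
  · rw [← Abelianization.two_pi_I_div_mul hx]
    exact hϑ.isPointBundle _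
  · rw [← Abelianization.two_pi_I_div_mul hx]
    refine hϑ.residueMap_surjective fun h => Abelianization.two_mul_notMem_lattice hξ hx ?_
    rwa [← Abelianization.units_mul_mem_lattice σ, ← neg_mem_iff, ← neg_mul]
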